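/- Let $G=(V,E)$ be a $D$-regular simple graph with $D\ge 1$ and $V=\{0,\dots,n-1\}$, $n\ge 1$. Let $H$ be a Hamiltonian on $n$ particles (qudits) of dimension $d\ge 1$ of the form $$H=\mathop{\mathbb E}_{(i,j)\in E}H_{i,j}=\frac{2}{nD}\sum_{(i,j)\in E}H_{i,j},$$ where every edge occurs once in the sum, and $H_{i,j}$ is Hermitian, acts only on qudits $i,j$ and satisfies $\|H_{i,j}\|\le 1$ (operator norm). Let $e_0(H)=\min\{\langle\psi|H|\psi\rangle : \langle\psi|\psi\rangle=1\}$ be its ground-state energy. Consider the promise problem of deciding whether $e_0(H)\le\alpha$ (yes case) or $e_0(H)\ge\beta$ (no case), where $\alpha,\beta\in\mathbb R$ and $\delta\in(0,1]$ satisfy $$\beta-\alpha\ \ge\ 12\left(\frac{d^2\ln d}{D}\right)^{1/3}+\delta .$$ There are a single deterministic classical verifier (a program for a random access machine) and universal constants $C,c$ such that, for all such $n,d,D,G,H,\alpha,\beta,\delta$: 1. (time) for every bit string $w$, given the instance and $w$, the verifier halts within time $C\,nDd^4\,(1+\ln(1/\delta))^{c}$; 2. (yes case) if $e_0(H)\le\alpha$,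 there is a classical witness, a bit string of length at most $C\,nd\ln(n/\delta)$, that the verifier accepts; 3. (no case) if $e_0(H)\ge\beta$, the verifier rejects every bit string. Machine model: a random access machine with words of $\lfloor\log_2(nd)\rfloor+1$ bits, whose memory cells hold integers. Each elementary operation ($+,-,\times$, integer division, sign test, indirect load and store, reading an input position) is charged the number of words that it touches, a multiplication or division the product of the word counts of its operands; a sign test costs one unit. Input positions are randomly accessible. The instance is given by $n,d,D$, a list of the edges (in any order, each once as $(i,j)$ with $i<j$), and the real numbers $\alpha,\beta,\delta$ and the real and imaginary parts of the entries of the $d^2\times d^2$ matrices of the $H_{i,j}$. A real number $x$ can be read at any precision $k\in\mathbb N$: this returns $\lfloor 2^kx\rfloor$, truncated to the interval $[-4^k,4^k]$, and is charged for the $2k$ digits. -/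

import Mathlib

/-! ### Two-local Hamiltonians on `n` qudits -/

/-- The operator on `n` qudits of dimension `d` that acts as `A` on the (ordered) pair of qudits
`i, j` and as the identity on all the others, in the computational basis `Fin n → Fin d`. -/
noncomputable def twoSite {n d : ℕ} (i j : Fin n)
    (A : Matrix (Fin d × Fin d) (Fin d × Fin d) ℂ) :
    Matrix (Fin n → Fin d) (Fin n → Fin d) ℂ :=
  Matrix.of fun x y =>
    if ∀ k, k ≠ i → k ≠ j → x k = y k then A (x i, x j) (y i, y j) else 0

/-- The Hamiltonian `(2 / (n D)) ∑_{(i,j) ∈ E} H_{i,j}`, where every edge of `G` is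
counted once, as the pair `(i, j)` with `i < j`. -/
noncomputable def edgeHamiltonian {n d : ℕ} (D : ℕ) (G : SimpleGraph (Fin n))
    [DecidableRel G.Adj] (h : Fin n → Fin n → Matrix (Fin d × Fin d) (Fin d × Fin d) ℂ) :
    Matrix (Fin n → Fin d) (Fin n → Fin d) ℂ :=
  ((2 : ℂ) / ((n : ℂ) * (D : ℂ))) •
    ∑ e ∈ (Finset.univ : Finset (Fin n × Fin n)).filter (fun e => e.1 < e.2 ∧ G.Adj e.1 e.2),
      twoSite e.1 e.2 (h e.1 e.2)

/-- The ground-state energy: the least value of `⟨ψ| H |ψ⟩` over the unit vectors `ψ`. -/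
noncomputable def groundEnergy {ι : Type*} [Fintype ι] (H : Matrix ι ι ℂ) : ℝ :=
  sInf {E : ℝ | ∃ ψ : ι → ℂ, dotProduct (star ψ) ψ = 1 ∧
    (dotProduct (star ψ) (H.mulVec ψ)).re = E}

/-- The operator norm (largest singular value) of a square complex matrix. -/
noncomputable def operatorNorm {ι : Type*} [Fintype ι] [DecidableEq ι] (A : Matrix ι ι ℂ) : ℝ :=
  ‖Matrix.toEuclideanCLM (n := ι) (𝕜 := ℂ) A‖

/-- `edges` lists every edge of `G` exactly once, as the pair `(i, j)` with `i < j`. -/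
def ListsEdges {n : ℕ} (G : SimpleGraph (Fin n)) (edges : List (Fin n × Fin n)) : Prop :=
  edges.Nodup ∧ ∀ e : Fin n × Fin n, e ∈ edges ↔ e.1 < e.2 ∧ G.Adj e.1 e.2

/-! ### Random access machines

Programs of a random access machine whose memory cells hold integers.  The machine has words of
`w` bits; an integer that does not fit into one word occupies several words, and every
operation is charged the number of words that it touches (the product of the two word counts for a
multiplication or a division, as in the schoolbook algorithms). -/

/-- The three read-only, randomly accessible input tapes: a tape of integers, a tape of real
numbers (given by their infinite binary expansions), and a tape of witness bits. Positions
beyond the end of a tape hold zeros. -/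
structure RamInput where
  ints : List ℤ
  reals : List ℝ
  bits : List Bool

/-- Fixed-point approximation of a real number with `k` fractional bits and `k` integer bits;
numbers outside `[-2^k, 2^k]` saturate. -/
noncomputable def fixedPoint (k : ℕ) (x : ℝ) : ℤ :=
  max (-4 ^ k) (min (4 ^ k) ⌊(2 : ℝ) ^ k * x⌋)

/-- The number of `w`-bit words charged for an integer. -/
def wordCount (w : ℕ) (z : ℤ) : ℕ := 1 + Nat.size z.natAbs / w

/-- Arithmetic expressions. `load` reads a memory cell, `intIn`, `bitIn` and `realIn` read a
position of an input tape; the second argument of `realIn` is the precision. -/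
inductive RamExpr : Type
  | const (z : ℤ) : RamExpr
  | load (a : RamExpr) : RamExpr
  | add (a b : RamExpr) : RamExpr
  | sub (a b : RamExpr) : RamExpr
  | mul (a b : RamExpr) : RamExpr
  | div (a b : RamExpr) : RamExpr
  | intIn (a : RamExpr) : RamExpr
  | bitIn (a : RamExpr) : RamExpr
  | realIn (a k : RamExpr) : RamExpr

/-- The value of an expression on a given input and memory content. -/
noncomputable def RamExpr.eval (x : RamInput) (m : ℕ → ℤ) : RamExpr → ℤ
  | .const z => z
  | .load a => m (a.eval x m).toNat
  | .add a b => a.eval x m + b.eval x m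
  | .sub a b => a.eval x m - b.eval x m
  | .mul a b => a.eval x m * b.eval x m
  | .div a b => a.eval x m / b.eval x m
  | .intIn a => x.ints.getD (a.eval x m).toNat 0
  | .bitIn a => if x.bits.getD (a.eval x m).toNat false then 1 else 0
  | .realIn a k => fixedPoint (k.eval x m).toNat (x.reals.getD (a.eval x m).toNat 0)

/-- The time needed to evaluate an expression on a machine with `w`-bit words. Reading a
position of a tape or a memory cell is charged for the address and for the digits read. -/
noncomputable def RamExpr.cost (w : ℕ) (x : RamInput) (m : ℕ → ℤ) : RamExpr → ℕ
  | .const z => wordCount w z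
  | .load a => a.cost w x m + wordCount w (a.eval x m) + wordCount w ((RamExpr.load a).eval x m)
  | .add a b =>
      a.cost w x m + b.cost w x m + wordCount w (a.eval x m) + wordCount w (b.eval x m)
  | .sub a b =>
      a.cost w x m + b.cost w x m + wordCount w (a.eval x m) + wordCount w (b.eval x m)
  | .mul a b =>
      a.cost w x m + b.cost w x m + wordCount w (a.eval x m) * wordCount w (b.eval x m)
  | .div a b =>
      a.cost w x m + b.cost w x m + wordCount w (a.eval x m) * wordCount w (b.eval x m)
  | .intIn a => a.cost w x m + wordCount w (a.eval x m) + wordCount w ((RamExpr.intIn a).eval x m)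
  | .bitIn a => a.cost w x m + wordCount w (a.eval x m) + 1
  | .realIn a k =>
      a.cost w x m + k.cost w x m + wordCount w (a.eval x m) + wordCount w (k.eval x m) +
        (1 + 2 * (k.eval x m).toNat / w)

/-- Programs. `assign a e` stores the value of `e` in the memory cell with address `a`;
the tests of `ite` and `loop` succeed when the value of the expression is positive. -/
inductive RamProg : Type
  | skip : RamProg
  | assign (a e : RamExpr) : RamProg
  | seq (p q : RamProg) : RamProg
  | ite (e : RamExpr) (p q : RamProg) : RamProg
  | loop (e : RamExpr) (p : RamProg) : RamProg

/-- `RamExec w x p m m' t`: on a machine with `w`-bit words and on input `x`, the program `p`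
started with memory content `m` halts after time exactly `t` with memory content `m'`. -/
inductive RamExec (w : ℕ) (x : RamInput) : RamProg → (ℕ → ℤ) → (ℕ → ℤ) → ℕ → Prop
  | skip (m : ℕ → ℤ) : RamExec w x .skip m m 1
  | assign (a e : RamExpr) (m : ℕ → ℤ) :
      RamExec w x (.assign a e) m (Function.update m (a.eval x m).toNat (e.eval x m))
        (a.cost w x m + e.cost w x m + wordCount w (a.eval x m) + wordCount w (e.eval x m))
  | seq {p q : RamProg} {m m' m'' : ℕ → ℤ} {s t : ℕ} :
      RamExec w x p m m' s → RamExec w x q m' m'' t → RamExec w x (.seq p q) m m'' (s + t)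
  | iteTrue {e : RamExpr} {p q : RamProg} {m m' : ℕ → ℤ} {t : ℕ} :
      0 < e.eval x m → RamExec w x p m m' t →
        RamExec w x (.ite e p q) m m' (e.cost w x m + 1 + t)
  | iteFalse {e : RamExpr} {p q : RamProg} {m m' : ℕ → ℤ} {t : ℕ} :
      ¬ 0 < e.eval x m → RamExec w x q m m' t →
        RamExec w x (.ite e p q) m m' (e.cost w x m + 1 + t)
  | loopTrue {e : RamExpr} {p : RamProg} {m m' m'' : ℕ → ℤ} {s t : ℕ} :
      0 < e.eval x m → RamExec w x p m m' s → RamExec w x (.loop e p) m' m'' t →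
        RamExec w x (.loop e p) m m'' (e.cost w x m + 1 + s + t)
  | loopFalse {e : RamExpr} {p : RamProg} {m : ℕ → ℤ} :
      ¬ 0 < e.eval x m → RamExec w x (.loop e p) m m (e.cost w x m + 1)

/-- Execution is deterministic: the final memory content and the time are functions of the program,
the input and the initial memory content. -/
theorem RamExec.det {w : ℕ} {x : RamInput} {p : RamProg} {m m₁ : ℕ → ℤ} {t₁ : ℕ}
    (h₁ : RamExec w x p m m₁ t₁) :
    ∀ {m₂ : ℕ → ℤ} {t₂ : ℕ}, RamExec w x p m m₂ t₂ → m₁ = m₂ ∧ t₁ = t₂ := by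
  induction h₁ with
  | skip m => intro m₂ t₂ h; cases h; exact ⟨rfl, rfl⟩
  | assign a e m => intro m₂ t₂ h; cases h; exact ⟨rfl, rfl⟩
  | seq _ _ ih₁ ih₂ =>
    intro m₂ t₂ h
    cases h with
    | seq a b =>
      obtain ⟨rfl, rfl⟩ := ih₁ a
      obtain ⟨rfl, rfl⟩ := ih₂ b
      exact ⟨rfl, rfl⟩
  | iteTrue hp _ ih =>
    intro m₂ t₂ h
    cases h with
    | iteTrue _ a => obtain ⟨rfl, rfl⟩ := ih a; exact ⟨rfl, rfl⟩
    | iteFalse hn _ => exact absurd hp hn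
  | iteFalse hn _ ih =>
    intro m₂ t₂ h
    cases h with
    | iteTrue hp _ => exact absurd hp hn
    | iteFalse _ a => obtain ⟨rfl, rfl⟩ := ih a; exact ⟨rfl, rfl⟩
  | loopTrue hp _ _ ih₁ ih₂ =>
    intro m₂ t₂ h
    cases h with
    | loopTrue _ a b =>
      obtain ⟨rfl, rfl⟩ := ih₁ a
      obtain ⟨rfl, rfl⟩ := ih₂ b
      exact ⟨rfl, rfl⟩
    | loopFalse hn => exact absurd hp hn
  | loopFalse hn =>
    intro m₂ t₂ h
    cases h with
    | loopTrue hp _ _ => exact absurd hp hn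
    | loopFalse _ => exact ⟨rfl, rfl⟩

/-- `p`, started with the zero memory, halts on input `x` after at most `T` time steps. -/
def HaltsWithin (w : ℕ) (p : RamProg) (x : RamInput) (T : ℝ) : Prop :=
  ∃ (m : ℕ → ℤ) (t : ℕ), RamExec w x p (fun _ => 0) m t ∧ (t : ℝ) ≤ T

/-- `p`, started with the zero memory, halts on input `x` with the value `1` in cell `0`. -/
def Accepts (w : ℕ) (p : RamProg) (x : RamInput) : Prop :=
  ∃ (m : ℕ → ℤ) (t : ℕ), RamExec w x p (fun _ => 0) m t ∧ m 0 = 1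

/-! ### Presentation of an instance and a witness to the verifier -/

/-- The entries of a two-qudit operator in row-major order, each as its real part followed by its
imaginary part. -/
noncomputable def matrixEntries {d : ℕ} (A : Matrix (Fin d × Fin d) (Fin d × Fin d) ℂ) :
    List ℝ :=
  (List.finRange d).flatMap fun a => (List.finRange d).flatMap fun b =>
    (List.finRange d).flatMap fun a' => (List.finRange d).flatMap fun b' =>
      [(A (a, b) (a', b')).re, (A (a, b) (a', b')).im]

/-- The input of the verifier. Integers: `n, d, D`, then the two end points of each edge.
Reals: `α, β, δ`, then the entries of the interaction term of each edge, in the same order of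
the edges. Bits: the witness. -/
noncomputable def verifierInput {n d : ℕ} (D : ℕ) (edges : List (Fin n × Fin n))
    (h : Fin n → Fin n → Matrix (Fin d × Fin d) (Fin d × Fin d) ℂ) (α β δ : ℝ)
    (wit : List Bool) : RamInput where
  ints := [(n : ℤ), (d : ℤ), (D : ℤ)] ++
    edges.flatMap fun e => [((e.1 : ℕ) : ℤ), ((e.2 : ℕ) : ℤ)]
  reals := [α, β, δ] ++ edges.flatMap fun e => matrixEntries (h e.1 e.2)
  bits := wit

/-- The word length: `⌊log₂ (n d)⌋ + 1` bits, so that a word can hold the index of a basis vector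
of one of the `n` qudits. -/
def wordLength (n d : ℕ) : ℕ := Nat.size (n * d)

/-! The witness lists the amplitudes of a product state, rounded to $K$ bits, and the verifier
computes the energy of that state in integer arithmetic. Soundness is the variational principle: a
product state has at least the ground-state energy, so only rounding needs control (`not_good`). The
substance is completeness: near any state ψ there is a product state of almost the same energy. If
$g^3 D \ge d^2(1-1/d)$, the loss is at most $7g$ (`exists_productEnergy_le`).

That product state is found by measuring a few sites of ψ. The potential is the total purity $\sum_i
\mathrm{Tr}\,\rho_i^2$, averaged over the outcomes; it lies between $n/d$ and $n$, and no
measurement decreases it. Always measuring the site with the largest gain therefore leads, with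
fewer than $m$ measured sites, to an ensemble in which the gains of all ordered pairs add up to at
most $n^2(1-1/d)/m$ (`exists_decoupled`). The gain of $i$ from measuring $j$ is a variance: the mean
squared Hilbert–Schmidt distance of the conditional states of $i$ from its unconditional state
(`gain_eq`). The measurement consists of the vectors $e_a + i^w e_b$, which by polarization span all
operators. Hence the energy difference between $\rho_{ij}$ and $\rho_i\otimes\rho_j$ is a linear
function of these conditional deviations, and Young's inequality bounds it by the gain
(`correlation_bound`). Edges at measured sites are abandoned; regularity makes them few. Some member
of the ensemble does at least as well as the average, and as the energy is affine in the state of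
each single site, its mixed product state can be replaced by a pure one
(`exists_pure_productEnergy_le`). Finally $1-1/d \le \ln d$ brings in the logarithm of the
statement.

The precision $K$ is the least one with $2^K\delta \ge 4096\,d^4$, so that rounding errors of order
$d^4/2^K$ are negligible against $\delta$. For $d<n$ this gives $K = O(\ln(n/\delta))$, hence a
witness of the permitted length. For $d\ge n$ that length could be exceeded, but then $D<d$ and the
promise gap is at least 12, while all energies lie in $[-1,1]$; a rough look at $\beta$ decides
without any witness.

For the running time, all numbers in memory have at most $M = 100+30w+6l$ bits, where $w$ is the
word length and $l$ is about $\log_2(1/\delta)$. A single step then costs a constant times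
$(1+M/w)^2$, which is $O((1+l)^2)$, and there are $O(nDd^4(1+l))$ steps. `RunsTo` is a Hoare
calculus that tracks the invariants, the bit bound and the step count together. -/

/-! ### Reduced density matrices -/

section ReducedStates

open Finset Function

variable {n d : ℕ}

/-- Averaging a single coordinate over all its values does not change a sum over all points. -/
theorem sum_sum_update {n d : ℕ} {M : Type*} [AddCommMonoid M] (j : Fin n)
    (f : (Fin n → Fin d) → M) :
    ∑ x, ∑ b, f (update x j b) = d • ∑ x, f x := by
  rw [← Fintype.sum_prod_type']
  -- Exchanging the coordinate `x j` with the inserted value makes the summand independent of the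
  -- second variable, which then contributes the factor `d`.
  have e : Function.Involutive
      (fun p : (Fin n → Fin d) × Fin d => (update p.1 j p.2, p.1 j)) := by
    intro p
    simp
  rw [Fintype.sum_equiv e.toPerm (fun p => f (update p.1 j p.2)) (fun p => f p.1)
    (fun p => rfl), Fintype.sum_prod_type]
  simp [Finset.smul_sum]

/-- The squared Euclidean norm. -/
noncomputable def sqNorm {ι : Type*} [Fintype ι] (φ : ι → ℂ) : ℝ := ∑ x, Complex.normSq (φ x)

theorem sqNorm_nonneg {ι : Type*} [Fintype ι] (φ : ι → ℂ) : 0 ≤ sqNorm φ :=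
  Finset.sum_nonneg fun _ _ => Complex.normSq_nonneg _

theorem sqNorm_eq_zero {ι : Type*} [Fintype ι] {φ : ι → ℂ} : sqNorm φ = 0 ↔ φ = 0 := by
  rw [sqNorm, Finset.sum_eq_zero_iff_of_nonneg fun _ _ => Complex.normSq_nonneg _]
  simp [funext_iff]

theorem ofReal_sqNorm {ι : Type*} [Fintype ι] (φ : ι → ℂ) :
    ((sqNorm φ : ℝ) : ℂ) = ∑ x, φ x * star (φ x) := by
  simp [sqNorm, Complex.mul_conj]

/-- The reduced density matrix of site `i`. -/
noncomputable def rdmOne (φ : (Fin n → Fin d) → ℂ) (i : Fin n) (a a' : Fin d) : ℂ :=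
  (d : ℂ)⁻¹ * ∑ x, φ (update x i a) * star (φ (update x i a'))

/-- The reduced density matrix of the sites `i, j`. -/
noncomputable def rdmTwo (φ : (Fin n → Fin d) → ℂ) (i j : Fin n) (p p' : Fin d × Fin d) : ℂ :=
  ((d : ℂ) ^ 2)⁻¹ * ∑ x, φ (update (update x i p.1) j p.2) *
    star (φ (update (update x i p'.1) j p'.2))

/-- The sum in `rdmOne` also runs over the coordinate `x i` that is overwritten; the factor `d⁻¹`
undoes this multiple counting. -/
theorem sum_rdmOne_diag (hd : 0 < d) (φ : (Fin n → Fin d) → ℂ) (i : Fin n) :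
    ∑ a, rdmOne φ i a a = (sqNorm φ : ℂ) := by
  have hd' : (d : ℂ) ≠ 0 := by exact_mod_cast hd.ne'
  simp only [rdmOne, ← Finset.mul_sum]
  rw [Finset.sum_comm, sum_sum_update i (fun x => φ x * star (φ x)), ofReal_sqNorm, nsmul_eq_mul]
  field_simp

/-- Summing over the points that agree with `x` off `i, j`. -/
theorem sum_agree_off {M : Type*} [AddCommMonoid M] {i j : Fin n} (hij : i ≠ j)
    (x : Fin n → Fin d) (g : (Fin n → Fin d) → M) :
    (∑ y, if ∀ k, k ≠ i → k ≠ j → x k = y k then g y else 0) =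
      ∑ p : Fin d × Fin d, g (update (update x i p.1) j p.2) := by
  rw [← Finset.sum_filter]
  refine Finset.sum_bij' (fun y _ => (y i, y j)) (fun p _ => update (update x i p.1) j p.2)
    (by simp) ?_ ?_ ?_ ?_
  · intro p _
    simp only [Finset.mem_filter, Finset.mem_univ, true_and]
    intro k hi hj
    simp [hi, hj]
  · intro y hy
    simp only [Finset.mem_filter, Finset.mem_univ, true_and] at hy
    funext k
    by_cases hj : k = j
    · subst hj; simp
    · by_cases hi : k = i
      · subst hi; simp [hij]
      · simp [hi, hj, hy k hi hj]
  · intro p _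
    simp [hij]
  · intro y hy
    simp only [Finset.mem_filter, Finset.mem_univ, true_and] at hy
    congr 1
    funext k
    by_cases hj : k = j
    · subst hj; simp
    · by_cases hi : k = i
      · subst hi; simp [hij]
      · simp [hi, hj, hy k hi hj]

/-- The value `Tr (h R)` of a two-site operator. -/
def pairTrace (h : Matrix (Fin d × Fin d) (Fin d × Fin d) ℂ)
    (R : Fin d × Fin d → Fin d × Fin d → ℂ) : ℂ := ∑ p, ∑ p', h p p' * R p' p

theorem twoSite_expectation (hd : 0 < d) (φ : (Fin n → Fin d) → ℂ) {i j : Fin n} (hij : i ≠ j)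
    (h : Matrix (Fin d × Fin d) (Fin d × Fin d) ℂ) :
    dotProduct (star φ) ((twoSite i j h).mulVec φ) = pairTrace h (rdmTwo φ i j) := by
  have hd' : (d : ℂ) ≠ 0 := by exact_mod_cast hd.ne'
  have h1 : dotProduct (star φ) ((twoSite i j h).mulVec φ) =
      ∑ x, ∑ p' : Fin d × Fin d,
        star (φ x) * (h (x i, x j) p' * φ (update (update x i p'.1) j p'.2)) := by
    simp only [dotProduct, Matrix.mulVec, twoSite, Matrix.of_apply, Pi.star_apply]
    refine Finset.sum_congr rfl fun x _ => ?_
    rw [← Finset.mul_sum, Finset.mul_sum, Finset.mul_sum]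
    have := sum_agree_off hij x (fun y => star (φ x) * (h (x i, x j) (y i, y j) * φ y))
    simp only [update_self, update_of_ne hij, Prod.mk.eta] at this
    rw [← this]
    refine Finset.sum_congr rfl fun y _ => ?_
    split_ifs <;> simp
  -- Averaging over the values at `i` and `j` turns these two coordinates of `x` into the free row
  -- index `p`.
  have h2 : ∀ f : (Fin n → Fin d) → ℂ, ∑ x, f x = ((d : ℂ) ^ 2)⁻¹ *
      ∑ x, ∑ p : Fin d × Fin d, f (update (update x i p.1) j p.2) := by
    intro f
    simp only [Fintype.sum_prod_type]
    have e1 : ∀ x : Fin n → Fin d, ∑ a, ∑ b, f (update (update x i a) j b) =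
      ∑ a, (fun y => ∑ b, f (update y j b)) (update x i a) := fun x => rfl
    simp only [e1]
    rw [sum_sum_update i (fun y => ∑ b, f (update y j b)), sum_sum_update j f, nsmul_eq_mul,
      nsmul_eq_mul]
    field_simp
  rw [h1, h2]
  simp only [pairTrace, rdmTwo, update_self, update_of_ne hij, Prod.mk.eta]
  have e3 : ∀ (x : Fin n → Fin d) (p p' : Fin d × Fin d),
      update (update (update (update x i p.1) j p.2) i p'.1) j p'.2 =
        update (update x i p'.1) j p'.2 := by
    intro x p p'
    funext k
    by_cases hj : k = j
    · subst hj; simp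
    · by_cases hi : k = i
      · subst hi; simp [hij]
      · simp [hi, hj]
  simp only [e3]
  rw [Finset.sum_comm, Finset.mul_sum]
  refine Finset.sum_congr rfl fun p _ => ?_
  rw [Finset.sum_comm, Finset.mul_sum]
  refine Finset.sum_congr rfl fun p' _ => ?_
  rw [Finset.mul_sum, Finset.mul_sum, Finset.mul_sum]
  refine Finset.sum_congr rfl fun x _ => ?_
  ring

end ReducedStates

/-! ### Operators of norm at most one -/

section Contractions

open Finset

theorem sqNorm_eq_norm_sq {ι : Type*} [Fintype ι] (φ : ι → ℂ) :
    sqNorm φ = ‖WithLp.toLp 2 φ‖ ^ 2 := by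
  simp [sqNorm, EuclideanSpace.norm_sq_eq, Complex.normSq_eq_norm_sq]

theorem sqNorm_mulVec_le {ι : Type*} [Fintype ι] [DecidableEq ι] {A : Matrix ι ι ℂ}
    (hA : operatorNorm A ≤ 1) (u : ι → ℂ) : sqNorm (A.mulVec u) ≤ sqNorm u := by
  have h1 := (Matrix.toEuclideanCLM (n := ι) (𝕜 := ℂ) A).le_opNorm (WithLp.toLp 2 u)
  rw [Matrix.toEuclideanCLM_toLp] at h1
  rw [sqNorm_eq_norm_sq, sqNorm_eq_norm_sq]
  have h2 : ‖WithLp.toLp 2 (A.mulVec u)‖ ≤ ‖WithLp.toLp 2 u‖ :=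
    h1.trans (mul_le_of_le_one_left (norm_nonneg _) hA)
  gcongr

theorem norm_dotProduct_sq_le {ι : Type*} [Fintype ι] (u v : ι → ℂ) :
    Complex.normSq (∑ x, u x * star (v x)) ≤ sqNorm u * sqNorm v := by
  have h1 : ‖∑ x, u x * star (v x)‖ ≤ ∑ x, ‖u x‖ * ‖v x‖ :=
    (norm_sum_le _ _).trans_eq (by simp)
  have h2 := Finset.sum_mul_sq_le_sq_mul_sq univ (fun x => ‖u x‖) (fun x => ‖v x‖)
  rw [Complex.normSq_eq_norm_sq]
  simp only [sqNorm, Complex.normSq_eq_norm_sq]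
  exact (pow_le_pow_left₀ (norm_nonneg _) h1 2).trans h2

theorem abs_re_dotProduct_mulVec_le {ι : Type*} [Fintype ι] [DecidableEq ι] {A : Matrix ι ι ℂ}
    (hA : operatorNorm A ≤ 1) (u : ι → ℂ) :
    |(∑ p, ∑ p', A p p' * (u p' * star (u p))).re| ≤ sqNorm u := by
  have e : ∑ p, ∑ p', A p p' * (u p' * star (u p)) = ∑ p, (A.mulVec u) p * star (u p) := by
    refine Finset.sum_congr rfl fun p _ => ?_
    simp only [Matrix.mulVec, dotProduct, Finset.sum_mul]
    exact Finset.sum_congr rfl fun p' _ => by ring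
  rw [e]
  refine (Complex.abs_re_le_norm _).trans (abs_le_of_sq_le_sq' ?_ (sqNorm_nonneg u)).2
  rw [← Complex.normSq_eq_norm_sq, sq]
  exact (norm_dotProduct_sq_le _ _).trans
    (mul_le_mul_of_nonneg_right (sqNorm_mulVec_le hA u) (sqNorm_nonneg u))

theorem sum_normSq_col_le {ι : Type*} [Fintype ι] [DecidableEq ι] {A : Matrix ι ι ℂ}
    (hA : operatorNorm A ≤ 1) (p' : ι) : ∑ p, Complex.normSq (A p p') ≤ 1 := by
  have h := sqNorm_mulVec_le hA (Pi.single p' 1)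
  rw [Matrix.mulVec_single_one] at h
  have e : sqNorm (Pi.single p' (1 : ℂ)) = 1 := by
    simp [sqNorm, Pi.single_apply, apply_ite Complex.normSq]
  rw [e] at h
  exact h

theorem sum_normSq_row_le {ι : Type*} [Fintype ι] [DecidableEq ι] {A : Matrix ι ι ℂ}
    (hA : operatorNorm A ≤ 1) (hH : A.IsHermitian) (p : ι) :
    ∑ p', Complex.normSq (A p p') ≤ 1 := by
  refine le_trans (le_of_eq ?_) (sum_normSq_col_le hA p)
  refine Finset.sum_congr rfl fun p' _ => ?_
  rw [← hH.apply p' p]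
  simp

end Contractions

/-! ### Measuring one site -/

section Measurement

open Finset Function

variable {n d : ℕ}

/-- The unnormalized vectors `e_a + i^w e_b` of the measurement. -/
noncomputable def probe (z : Fin d × Fin d × Fin 4) (b : Fin d) : ℂ :=
  (if b = z.1 then 1 else 0) + Complex.I ^ (z.2.2 : ℕ) * (if b = z.2.1 then 1 else 0)

theorem star_probe (z : Fin d × Fin d × Fin 4) (b : Fin d) :
    star (probe z b) = (if b = z.1 then 1 else 0) +
      star (Complex.I ^ (z.2.2 : ℕ)) * (if b = z.2.1 then 1 else 0) := by
  simp only [probe, star_add, star_mul']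
  split_ifs <;> simp

/-- Polarization: after expansion every product except `e₁ * f₂` carries a factor $i^w$ or $i^{2w}$,
and these sum to zero over the four phases. -/
theorem sum_phase_mul (e₁ e₂ f₁ f₂ : ℂ) :
    ∑ w : Fin 4, Complex.I ^ (w : ℕ) *
      ((f₁ + star (Complex.I ^ (w : ℕ)) * f₂) * (e₁ + Complex.I ^ (w : ℕ) * e₂)) = 4 * (e₁ * f₂) := by
  have h3 : Complex.I ^ 3 = -Complex.I := by rw [pow_succ, Complex.I_sq]; ring
  simp only [Fin.sum_univ_four, Fin.val_zero, Fin.val_one, Fin.val_two, pow_zero, pow_one,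
    Complex.I_sq, show ((3 : Fin 4) : ℕ) = 3 from rfl, h3, star_one, star_neg,
    show star Complex.I = -Complex.I from Complex.conj_I]
  linear_combination (2 * e₂ * f₁ - 2 * e₁ * f₂) * Complex.I_sq

theorem sum_phase (e₁ e₂ f₁ f₂ : ℂ) :
    ∑ w : Fin 4, (f₁ + star (Complex.I ^ (w : ℕ)) * f₂) * (e₁ + Complex.I ^ (w : ℕ) * e₂) =
      4 * (e₁ * f₁ + e₂ * f₂) := by
  have h3 : Complex.I ^ 3 = -Complex.I := by rw [pow_succ, Complex.I_sq]; ring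
  simp only [Fin.sum_univ_four, Fin.val_zero, Fin.val_one, Fin.val_two, pow_zero, pow_one,
    Complex.I_sq, show ((3 : Fin 4) : ℕ) = 3 from rfl, h3, star_one, star_neg,
    show star Complex.I = -Complex.I from Complex.conj_I]
  linear_combination (-2 * e₂ * f₂) * Complex.I_sq

/-- The probes resolve the matrix units. -/
theorem sum_phase_probe (a b c c' : Fin d) :
    ∑ w : Fin 4, Complex.I ^ (w : ℕ) * (star (probe (a, b, w) c) * probe (a, b, w) c') =
      4 * if c' = a ∧ c = b then 1 else 0 := by
  have h := sum_phase_mul (if c' = a then 1 else 0) (if c' = b then 1 else 0)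
    (if c = a then 1 else 0) (if c = b then 1 else 0)
  simp only [star_probe]
  simp only [probe]
  rw [h, ite_and]
  split_ifs <;> simp

theorem sum_probe_phase (a b c c' : Fin d) :
    ∑ w : Fin 4, star (probe (a, b, w) c) * probe (a, b, w) c' =
      4 * ((if c' = a ∧ c = a then 1 else 0) + if c' = b ∧ c = b then 1 else 0) := by
  have h := sum_phase (if c' = a then 1 else 0) (if c' = b then 1 else 0)
    (if c = a then 1 else 0) (if c = b then 1 else 0)
  simp only [star_probe]
  simp only [probe]
  rw [h, ite_and, ite_and]
  congr 2
  · split_ifs <;> simp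
  · split_ifs <;> simp

theorem sum_outcomes {M : Type*} [AddCommMonoid M] (f : Fin d × Fin d × Fin 4 → M) :
    ∑ z, f z = ∑ a, ∑ b, ∑ w, f (a, b, w) := by
  rw [Fintype.sum_prod_type]
  exact Finset.sum_congr rfl fun a _ => Fintype.sum_prod_type _

/-- Completeness of the measurement: for fixed $a,b$ the four phases give $4(|a\rangle\langle a| +
|b\rangle\langle b|)$, so the probes divided by $\sqrt{8d}$ resolve the identity. -/
theorem sum_probe (c c' : Fin d) :
    ∑ z : Fin d × Fin d × Fin 4, star (probe z c) * probe z c' =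
      if c = c' then 8 * (d : ℂ) else 0 := by
  rw [sum_outcomes]
  simp only [sum_probe_phase, ← Finset.mul_sum, Finset.sum_add_distrib]
  have e : ∀ x : Fin d, (if c' = x ∧ c = x then (1 : ℂ) else 0) =
      if c' = x then (if c = c' then 1 else 0) else 0 := by
    intro x
    by_cases h1 : c' = x
    · subst h1; simp
    · simp [h1]
  simp only [e, Finset.sum_const, Finset.card_univ, Fintype.card_fin, Finset.sum_ite_eq,
    Finset.mem_univ, if_true]
  split_ifs
  · rw [← Finset.smul_sum, Finset.sum_ite_eq, if_pos (Finset.mem_univ _), nsmul_eq_mul]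
    ring
  · simp

/-- The unnormalized state after site `j` was measured with outcome `z` and reset. -/
noncomputable def collapse (φ : (Fin n → Fin d) → ℂ) (j : Fin n) (z : Fin d × Fin d × Fin 4)
    (x : Fin n → Fin d) : ℂ :=
  (((Real.sqrt 8 * d)⁻¹ : ℝ) : ℂ) * ∑ b, star (probe z b) * φ (update x j b)

theorem collapse_update (φ : (Fin n → Fin d) → ℂ) (j : Fin n) (z : Fin d × Fin d × Fin 4)
    (x : Fin n → Fin d) (a : Fin d) : collapse φ j z (update x j a) = collapse φ j z x := by
  simp [collapse]

/-- The scalar in `collapse` is $1/\sqrt{8d}$ from the measurement times $1/\sqrt d$, the amplitude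
of the uniform superposition to which site `j` is reset; its square is the prefactor here. -/
theorem collapse_mul_star (φ : (Fin n → Fin d) → ℂ) (j : Fin n) (z : Fin d × Fin d × Fin 4)
    (x y : Fin n → Fin d) : collapse φ j z x * star (collapse φ j z y) =
      (8 * (d : ℂ) ^ 2)⁻¹ * ∑ b, ∑ b', star (probe z b) * probe z b' *
        (φ (update x j b) * star (φ (update y j b'))) := by
  have h8 : (((Real.sqrt 8 * d)⁻¹ : ℝ) : ℂ) * star (((Real.sqrt 8 * d)⁻¹ : ℝ) : ℂ) =
      (8 * (d : ℂ) ^ 2)⁻¹ := by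
    rw [show star (((Real.sqrt 8 * d)⁻¹ : ℝ) : ℂ) = (((Real.sqrt 8 * d)⁻¹ : ℝ) : ℂ) from
      Complex.conj_ofReal _, ← Complex.ofReal_mul, ← mul_inv, mul_mul_mul_comm,
      Real.mul_self_sqrt (by norm_num)]
    push_cast
    ring
  simp only [collapse]
  rw [star_mul', mul_mul_mul_comm, h8, star_sum, Finset.sum_mul_sum]
  congr 1
  refine Finset.sum_congr rfl fun b _ => Finset.sum_congr rfl fun b' _ => ?_
  rw [star_mul', star_star]
  ring

/-- Conditioning on an outcome contracts the second site with the measurement operator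
$|v_z\rangle\langle v_z|/(8d)$. The conditional states of `i` are thus linear in the two-site state,
which `frame_identity` exploits. -/
theorem rdmOne_collapse (hd : 0 < d) (φ : (Fin n → Fin d) → ℂ) (i j : Fin n)
    (z : Fin d × Fin d × Fin 4) (a a' : Fin d) :
    rdmOne (collapse φ j z) i a a' = (8 * (d : ℂ))⁻¹ *
      ∑ b, ∑ b', star (probe z b) * probe z b' * rdmTwo φ i j (a, b) (a', b') := by
  have hd' : (d : ℂ) ≠ 0 := by exact_mod_cast hd.ne'
  simp only [rdmOne, collapse_mul_star, rdmTwo, Finset.mul_sum]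
  rw [Finset.sum_comm]
  refine Finset.sum_congr rfl fun b _ => ?_
  rw [Finset.sum_comm]
  refine Finset.sum_congr rfl fun b' _ => Finset.sum_congr rfl fun x _ => ?_
  field_simp

theorem ofReal_sqNorm_collapse (hd : 0 < d) (φ : (Fin n → Fin d) → ℂ) (j : Fin n)
    (z : Fin d × Fin d × Fin 4) :
    (sqNorm (collapse φ j z) : ℂ) = (8 * (d : ℂ))⁻¹ *
      ∑ b, ∑ b', star (probe z b) * probe z b' * rdmOne φ j b b' := by
  have hd' : (d : ℂ) ≠ 0 := by exact_mod_cast hd.ne'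
  simp only [ofReal_sqNorm, collapse_mul_star, rdmOne, Finset.mul_sum]
  rw [Finset.sum_comm]
  refine Finset.sum_congr rfl fun b _ => ?_
  rw [Finset.sum_comm]
  refine Finset.sum_congr rfl fun b' _ => Finset.sum_congr rfl fun x _ => ?_
  field_simp

theorem sum_collapse_mul_star (hd : 0 < d) (φ : (Fin n → Fin d) → ℂ) (j : Fin n) (x y : Fin n → Fin d) :
    ∑ z, collapse φ j z x * star (collapse φ j z y) =
      (d : ℂ)⁻¹ * ∑ b, φ (update x j b) * star (φ (update y j b)) := by
  have hd' : (d : ℂ) ≠ 0 := by exact_mod_cast hd.ne'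
  simp only [collapse_mul_star, ← Finset.mul_sum]
  rw [Finset.sum_comm]
  simp only [Finset.sum_comm (s := (univ : Finset (Fin d × Fin d × Fin 4))), ← Finset.sum_mul,
    sum_probe, ite_mul, zero_mul, Finset.sum_ite_eq, Finset.mem_univ, if_true]
  rw [← Finset.mul_sum]
  field_simp

/-- Measuring `j` does not disturb the average state of another site. -/
theorem sum_rdmOne_collapse (hd : 0 < d) (φ : (Fin n → Fin d) → ℂ) {i j : Fin n} (hij : i ≠ j)
    (a a' : Fin d) : ∑ z, rdmOne (collapse φ j z) i a a' = rdmOne φ i a a' := by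
  have hd' : (d : ℂ) ≠ 0 := by exact_mod_cast hd.ne'
  simp only [rdmOne, ← Finset.mul_sum]
  rw [Finset.sum_comm]
  simp only [sum_collapse_mul_star hd, update_comm hij, ← Finset.mul_sum]
  rw [sum_sum_update j (fun x => φ (update x i a) * star (φ (update x i a'))), nsmul_eq_mul]
  field_simp

theorem sum_rdmTwo_collapse (hd : 0 < d) (φ : (Fin n → Fin d) → ℂ) {i k j : Fin n} (hij : i ≠ j)
    (hkj : k ≠ j) (p p' : Fin d × Fin d) :
    ∑ z, rdmTwo (collapse φ j z) i k p p' = rdmTwo φ i k p p' := by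
  have hd' : (d : ℂ) ≠ 0 := by exact_mod_cast hd.ne'
  simp only [rdmTwo, ← Finset.mul_sum]
  rw [Finset.sum_comm]
  simp only [sum_collapse_mul_star hd, update_comm hij, update_comm hkj, ← Finset.mul_sum]
  rw [sum_sum_update j (fun x => φ (update (update x i p.1) k p.2) *
    star (φ (update (update x i p'.1) k p'.2))), nsmul_eq_mul]
  field_simp

theorem sum_sqNorm_collapse (hd : 0 < d) (φ : (Fin n → Fin d) → ℂ) (j : Fin n) :
    ∑ z, sqNorm (collapse φ j z) = sqNorm φ := by
  have hd' : (d : ℂ) ≠ 0 := by exact_mod_cast hd.ne'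
  have h : ((∑ z, sqNorm (collapse φ j z) : ℝ) : ℂ) = (sqNorm φ : ℂ) := by
    push_cast
    simp only [ofReal_sqNorm]
    rw [Finset.sum_comm]
    simp only [sum_collapse_mul_star hd, ← Finset.mul_sum]
    rw [sum_sum_update j (fun x => φ x * star (φ x)), nsmul_eq_mul]
    field_simp
  exact_mod_cast h

/-- After the reset the vector does not depend on the coordinate `j`, so site `j` is in the pure
uniform superposition and all its matrix entries agree. -/
theorem rdmOne_collapse_self (φ : (Fin n → Fin d) → ℂ) (j : Fin n)
    (z : Fin d × Fin d × Fin 4) (a a' : Fin d) :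
    rdmOne (collapse φ j z) j a a' = (d : ℂ)⁻¹ * (sqNorm (collapse φ j z) : ℂ) := by
  simp only [rdmOne, collapse_update, ofReal_sqNorm]

/-! ### Purity of the one-site states -/

/-- The squared Hilbert-Schmidt norm of an operator on one site. -/
noncomputable def hsSq (A : Fin d → Fin d → ℂ) : ℝ := ∑ a, ∑ a', Complex.normSq (A a a')

theorem hsSq_nonneg (A : Fin d → Fin d → ℂ) : 0 ≤ hsSq A :=
  Finset.sum_nonneg fun _ _ => Finset.sum_nonneg fun _ _ => Complex.normSq_nonneg _

/-- The norm times the purity of the normalized state of site `i`. -/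
noncomputable def purity (φ : (Fin n → Fin d) → ℂ) (i : Fin n) : ℝ :=
  hsSq (rdmOne φ i) / sqNorm φ

/-- Cauchy–Schwarz gives $|\rho_{aa'}|^2 \le \rho_{aa}\rho_{a'a'}$ for each entry; the sum of the
right-hand sides is $(\mathrm{Tr}\,\rho)^2$. -/
theorem hsSq_rdmOne_le (hd : 0 < d) (φ : (Fin n → Fin d) → ℂ) (i : Fin n) :
    hsSq (rdmOne φ i) ≤ sqNorm φ ^ 2 := by
  have hd' : (d : ℝ) ≠ 0 := by exact_mod_cast hd.ne'
  set s : Fin d → ℝ := fun a => sqNorm (fun x : Fin n → Fin d => φ (update x i a)) with hs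
  have h1 : ∀ a a', Complex.normSq (rdmOne φ i a a') ≤ ((d : ℝ) ^ 2)⁻¹ * (s a * s a') := by
    intro a a'
    rw [rdmOne, Complex.normSq_mul, Complex.normSq_inv, Complex.normSq_natCast, ← sq]
    exact mul_le_mul_of_nonneg_left (norm_dotProduct_sq_le _ _) (by positivity)
  have h2 : ∑ a, s a = d * sqNorm φ := by
    simp only [hs, sqNorm]
    rw [Finset.sum_comm, sum_sum_update i (fun x => Complex.normSq (φ x)), nsmul_eq_mul]
  calc hsSq (rdmOne φ i) ≤ ∑ a, ∑ a', ((d : ℝ) ^ 2)⁻¹ * (s a * s a') :=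
        Finset.sum_le_sum fun a _ => Finset.sum_le_sum fun a' _ => h1 a a'
    _ = ((d : ℝ) ^ 2)⁻¹ * ((∑ a, s a) * ∑ a', s a') := by
        simp only [← Finset.mul_sum, Finset.sum_mul_sum]
    _ = sqNorm φ ^ 2 := by rw [h2]; field_simp

theorem rdmOne_eq_zero {φ : (Fin n → Fin d) → ℂ} (h : sqNorm φ = 0) (i : Fin n)
    (a a' : Fin d) : rdmOne φ i a a' = 0 := by
  rw [sqNorm_eq_zero] at h
  simp [rdmOne, h]

theorem purity_le (hd : 0 < d) (φ : (Fin n → Fin d) → ℂ) (i : Fin n) :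
    purity φ i ≤ sqNorm φ := by
  rcases (sqNorm_nonneg φ).eq_or_lt with h | h
  · simp [purity, ← h]
  · rw [purity, div_le_iff₀ h, ← sq]
    exact hsSq_rdmOne_le hd φ i

/-- The diagonal alone suffices: $(\mathrm{Tr}\,\rho)^2 \le d\sum_a|\rho_{aa}|^2$ by Cauchy–Schwarz.
-/
theorem le_purity (hd : 0 < d) (φ : (Fin n → Fin d) → ℂ) (i : Fin n) :
    sqNorm φ / d ≤ purity φ i := by
  have hd' : (0 : ℝ) < d := by exact_mod_cast hd
  rcases (sqNorm_nonneg φ).eq_or_lt with h | h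
  · simp [purity, ← h]
  · rw [purity, le_div_iff₀ h, div_mul_eq_mul_div, div_le_iff₀ hd']
    have h1 : ∑ a, (rdmOne φ i a a).re = sqNorm φ := by
      have := congrArg Complex.re (sum_rdmOne_diag hd φ i)
      simpa using this
    have h2 := Finset.sum_mul_sq_le_sq_mul_sq univ (fun a => (rdmOne φ i a a).re) (fun _ => 1)
    simp only [mul_one, one_pow, Finset.sum_const, Finset.card_univ, Fintype.card_fin,
      nsmul_eq_mul, h1] at h2
    rw [← sq]
    refine h2.trans (mul_le_mul_of_nonneg_right ?_ hd'.le)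
    refine Finset.sum_le_sum fun a _ => ?_
    refine le_trans ?_ (Finset.single_le_sum (f := fun a' => Complex.normSq (rdmOne φ i a a'))
      (fun _ _ => Complex.normSq_nonneg _) (Finset.mem_univ a))
    simp only [Complex.normSq_apply]
    nlinarith [mul_self_nonneg (rdmOne φ i a a).im]

/-- The gain of purity of site `i` when site `j` is measured. -/
noncomputable def gain (φ : (Fin n → Fin d) → ℂ) (i j : Fin n) : ℝ :=
  ∑ z, purity (collapse φ j z) i - purity φ i

/-- The deviation of the state of `i` after the outcome `z` from a fair share of its old state. -/
noncomputable def deviation (φ : (Fin n → Fin d) → ℂ) (i j : Fin n) (z : Fin d × Fin d × Fin 4)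
    (a a' : Fin d) : ℂ :=
  rdmOne (collapse φ j z) i a a' -
    ((sqNorm (collapse φ j z) / sqNorm φ : ℝ) : ℂ) * rdmOne φ i a a'

/-- A variance identity: the conditional states add up to the unconditional one, so expanding the
squares leaves the mean purity minus the old purity. The gain thus measures how strongly `i` is
correlated with the outcome at `j`. -/
theorem gain_eq (hd : 0 < d) (φ : (Fin n → Fin d) → ℂ) {i j : Fin n} (hij : i ≠ j) :
    gain φ i j = ∑ z, hsSq (deviation φ i j z) / sqNorm (collapse φ j z) := by
  rcases (sqNorm_nonneg φ).eq_or_lt with h | h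
  · have h0 : ∀ z, sqNorm (collapse φ j z) = 0 := fun z => by
      rw [sqNorm_eq_zero.1 h.symm, sqNorm_eq_zero]; funext x; simp [collapse]
    simp [gain, purity, h0, ← h]
  · set q := sqNorm φ with hq
    set r : Fin d × Fin d × Fin 4 → ℝ := fun z => sqNorm (collapse φ j z) with hr
    have hsum : ∑ z, r z = q := sum_sqNorm_collapse hd φ j
    have key : ∀ z, hsSq (deviation φ i j z) / r z = purity (collapse φ j z) i +
        (r z / q ^ 2) * hsSq (rdmOne φ i) - (2 / q) * ∑ a, ∑ a',
          (rdmOne (collapse φ j z) i a a' * star (rdmOne φ i a a')).re := by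
      intro z
      -- An outcome of probability zero has vanishing reduced states, and both sides are zero
      -- because division by zero yields zero.
      rcases (sqNorm_nonneg (collapse φ j z)).eq_or_lt with h0 | h0
      · have h0' : r z = 0 := h0.symm
        simp [h0', purity, ← h0, rdmOne_eq_zero h0.symm]
      · have h0' : 0 < r z := h0
        have e : hsSq (deviation φ i j z) = hsSq (rdmOne (collapse φ j z) i) +
            (r z / q) ^ 2 * hsSq (rdmOne φ i) - 2 * (r z / q) * ∑ a, ∑ a',
          (rdmOne (collapse φ j z) i a a' * star (rdmOne φ i a a')).re := by
          simp only [hsSq, Finset.mul_sum, ← Finset.sum_add_distrib, ← Finset.sum_sub_distrib]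
          refine Finset.sum_congr rfl fun a _ => Finset.sum_congr rfl fun a' _ => ?_
          simp only [deviation]
          rw [show sqNorm (collapse φ j z) / sqNorm φ = r z / q from rfl]
          generalize r z / q = c
          simp only [Complex.normSq_apply, Complex.sub_re, Complex.sub_im, Complex.mul_re,
            Complex.mul_im, Complex.ofReal_re, Complex.ofReal_im, Complex.star_def,
            Complex.conj_re, Complex.conj_im]
          ring
        rw [e, purity, show sqNorm (collapse φ j z) = r z from rfl]
        field_simp
    simp only [hr] at key
    simp only [key, Finset.sum_add_distrib, Finset.sum_sub_distrib, ← Finset.mul_sum,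
      ← Finset.sum_mul, ← Finset.sum_div]
    rw [show ∑ z, sqNorm (collapse φ j z) = q from hsum, Finset.sum_comm]
    simp only [Finset.sum_comm (s := (univ : Finset (Fin d × Fin d × Fin 4))), ← Complex.re_sum,
      ← Finset.sum_mul, sum_rdmOne_collapse hd φ hij]
    have e2 : ∑ a, ∑ a', (rdmOne φ i a a' * star (rdmOne φ i a a')).re = hsSq (rdmOne φ i) := by
      simp [hsSq, Complex.mul_conj]
    simp only [Complex.re_sum]
    rw [e2, gain, purity, ← hq]
    field_simp
    ring

/-- Off the diagonal the gain is a sum of squares. On the diagonal the reset leaves the measured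
site pure, so its purity reaches the maximum. -/
theorem gain_nonneg (hd : 0 < d) (φ : (Fin n → Fin d) → ℂ) (i j : Fin n) : 0 ≤ gain φ i j := by
  by_cases hij : i = j
  · subst hij
    have h : ∀ z, purity (collapse φ i z) i = sqNorm (collapse φ i z) := by
      intro z
      have hd' : (d : ℝ) ≠ 0 := by exact_mod_cast hd.ne'
      have : hsSq (rdmOne (collapse φ i z) i) = sqNorm (collapse φ i z) ^ 2 := by
        simp only [hsSq, rdmOne_collapse_self, Complex.normSq_mul, Complex.normSq_inv,
          Complex.normSq_natCast, Complex.normSq_ofReal, Finset.sum_const, Finset.card_univ,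
          Fintype.card_fin, nsmul_eq_mul]
        field_simp
      rw [purity, this, sq, mul_self_div_self]
    simp only [gain, h, sum_sqNorm_collapse hd]
    linarith [purity_le hd φ i]
  · rw [gain_eq hd φ hij]
    exact Finset.sum_nonneg fun z _ => div_nonneg (hsSq_nonneg _) (sqNorm_nonneg _)

end Measurement

/-! ### Weakly correlated sites are almost in a product state -/

section Correlation

open Finset Function

variable {n d : ℕ}

/-- The coefficients of a two-site operator with respect to the measurement of the second site. -/
noncomputable def frameCoeff (h : Matrix (Fin d × Fin d) (Fin d × Fin d) ℂ)
    (z : Fin d × Fin d × Fin 4) (s s' : Fin d) : ℂ :=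
  2 * (d : ℂ) * Complex.I ^ (z.2.2 : ℕ) * h (s, z.1) (s', z.2.1)

/-- This is the expansion $h = \sum_z F_z\otimes|v_z\rangle\langle v_z|/(8d)$ with $F_z$ given by
`frameCoeff`. The factor $2d$ in $F_z$ turns $1/(8d)$ into $1/4$, which cancels the 4 from
polarization. -/
theorem frame_identity (hd : 0 < d) (h : Matrix (Fin d × Fin d) (Fin d × Fin d) ℂ)
    (R : Fin d × Fin d → Fin d × Fin d → ℂ) :
    ∑ z, ∑ s, ∑ s', frameCoeff h z s s' * ((8 * (d : ℂ))⁻¹ *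
      ∑ b, ∑ b', star (probe z b) * probe z b' * R (s', b) (s, b')) = pairTrace h R := by
  have hd' : (d : ℂ) ≠ 0 := by exact_mod_cast hd.ne'
  have key : ∀ a b s s', ∑ w : Fin 4, frameCoeff h (a, b, w) s s' * ((8 * (d : ℂ))⁻¹ *
      ∑ c, ∑ c', star (probe (a, b, w) c) * probe (a, b, w) c' * R (s', c) (s, c')) =
      h (s, a) (s', b) * R (s', b) (s, a) := by
    intro a b s s'
    have e : ∀ w : Fin 4, frameCoeff h (a, b, w) s s' * ((8 * (d : ℂ))⁻¹ *
      ∑ c, ∑ c', star (probe (a, b, w) c) * probe (a, b, w) c' * R (s', c) (s, c')) =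
        ∑ c, ∑ c', (4⁻¹ * h (s, a) (s', b) * R (s', c) (s, c')) *
          (Complex.I ^ (w : ℕ) * (star (probe (a, b, w) c) * probe (a, b, w) c')) := by
      intro w
      simp only [frameCoeff, Finset.mul_sum]
      refine Finset.sum_congr rfl fun c _ => Finset.sum_congr rfl fun c' _ => ?_
      field_simp
      ring
    simp only [e]
    rw [Finset.sum_comm]
    have e2 : ∀ c, ∑ w : Fin 4, ∑ c', (4⁻¹ * h (s, a) (s', b) * R (s', c) (s, c')) *
          (Complex.I ^ (w : ℕ) * (star (probe (a, b, w) c) * probe (a, b, w) c')) =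
        if c = b then h (s, a) (s', b) * R (s', c) (s, a) else 0 := by
      intro c
      rw [Finset.sum_comm]
      simp only [← Finset.mul_sum, sum_phase_probe]
      by_cases hc : c = b
      · simp only [hc, and_true, if_true, mul_ite, mul_one, mul_zero, Finset.sum_ite_eq',
          Finset.mem_univ]
        ring
      · simp [hc]
    simp only [e2, Finset.sum_ite_eq', Finset.mem_univ, if_true]
  rw [sum_outcomes]
  have e3 : ∀ a b, ∑ w : Fin 4, ∑ s, ∑ s', frameCoeff h (a, b, w) s s' * ((8 * (d : ℂ))⁻¹ *
      ∑ c, ∑ c', star (probe (a, b, w) c) * probe (a, b, w) c' * R (s', c) (s, c')) =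
      ∑ s, ∑ s', h (s, a) (s', b) * R (s', b) (s, a) := by
    intro a b
    rw [Finset.sum_comm]
    refine Finset.sum_congr rfl fun s _ => ?_
    rw [Finset.sum_comm]
    exact Finset.sum_congr rfl fun s' _ => key a b s s'
  simp only [e3, pairTrace, Fintype.sum_prod_type]
  rw [Finset.sum_comm' (t' := univ) (s' := fun _ => univ) (by simp)]
  have e4 : ∀ y, ∑ x, ∑ s, ∑ s', h (s, x) (s', y) * R (s', y) (s, x) =
      ∑ s, ∑ x, ∑ s', h (s, x) (s', y) * R (s', y) (s, x) := fun y => Finset.sum_comm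
  simp only [e4]
  rw [Finset.sum_comm]
  refine Finset.sum_congr rfl fun s _ => ?_
  rw [Finset.sum_comm]
  refine Finset.sum_congr rfl fun x _ => ?_
  rw [Finset.sum_comm]

theorem rdmOne_diag_re_nonneg (φ : (Fin n → Fin d) → ℂ) (i : Fin n) (a : Fin d) :
    0 ≤ (rdmOne φ i a a).re := by
  have e : rdmOne φ i a a = (((d : ℝ)⁻¹ * sqNorm fun x => φ (update x i a) : ℝ) : ℂ) := by
    rw [Complex.ofReal_mul, ofReal_sqNorm]
    simp [rdmOne]
  rw [e, Complex.ofReal_re]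
  exact mul_nonneg (by positivity) (sqNorm_nonneg _)

theorem sum_rdmOne_diag_re (hd : 0 < d) (φ : (Fin n → Fin d) → ℂ) (i : Fin n) :
    ∑ a, (rdmOne φ i a a).re = sqNorm φ := by
  have := congrArg Complex.re (sum_rdmOne_diag hd φ i)
  simpa using this

/-- Summing over the phase removes the coherences between $a$ and $b$; only their populations
determine the probability. -/
theorem sum_sqNorm_collapse_phase (hd : 0 < d) (φ : (Fin n → Fin d) → ℂ) (j : Fin n)
    (a b : Fin d) : ∑ w : Fin 4, sqNorm (collapse φ j (a, b, w)) =
      (2 * (d : ℝ))⁻¹ * ((rdmOne φ j a a).re + (rdmOne φ j b b).re) := by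
  have hd' : (d : ℂ) ≠ 0 := by exact_mod_cast hd.ne'
  have h : ((∑ w : Fin 4, sqNorm (collapse φ j (a, b, w)) : ℝ) : ℂ) =
      (2 * (d : ℂ))⁻¹ * (rdmOne φ j a a + rdmOne φ j b b) := by
    push_cast
    simp only [ofReal_sqNorm_collapse hd, ← Finset.mul_sum]
    rw [Finset.sum_comm]
    have e : ∀ c, ∑ w : Fin 4, ∑ c', star (probe (a, b, w) c) * probe (a, b, w) c' *
        rdmOne φ j c c' = 4 * ((if c = a then rdmOne φ j c a else 0) +
          if c = b then rdmOne φ j c b else 0) := by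
      intro c
      rw [Finset.sum_comm]
      simp only [← Finset.sum_mul, sum_probe_phase]
      simp only [mul_assoc, ← Finset.mul_sum, add_mul, Finset.sum_add_distrib, ite_and, ite_mul,
        one_mul, zero_mul, Finset.sum_ite_eq', Finset.mem_univ, if_true]
    simp only [e, ← Finset.mul_sum, Finset.sum_add_distrib, Finset.sum_ite_eq', Finset.mem_univ,
      if_true]
    field_simp
    ring
  have := congrArg Complex.re h
  rw [Complex.ofReal_re] at this
  rw [this, show (2 * (d : ℂ))⁻¹ = (((2 * (d : ℝ))⁻¹ : ℝ) : ℂ) by push_cast; rfl,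
    Complex.re_ofReal_mul, Complex.add_re]

/-- The coefficients are bounded on average over the outcomes, not in the worst case. The phase sum
weights the pair $(a,b)$ by the populations of $a$ and $b$, and each row or column sum of `η` is at
most `d`, because `h` has rows and columns of norm at most one. -/
theorem sum_sqNorm_mul_hsSq_frameCoeff_le (hd : 0 < d) (φ : (Fin n → Fin d) → ℂ) (j : Fin n)
    {h : Matrix (Fin d × Fin d) (Fin d × Fin d) ℂ} (hH : h.IsHermitian)
    (hn : operatorNorm h ≤ 1) :
    ∑ z, sqNorm (collapse φ j z) * hsSq (frameCoeff h z) ≤ 4 * (d : ℝ) ^ 2 * sqNorm φ := by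
  have hd' : (0 : ℝ) < d := by exact_mod_cast hd
  set η : Fin d → Fin d → ℝ := fun a b => ∑ s, ∑ s', Complex.normSq (h (s, a) (s', b)) with hη
  have hF : ∀ a b (w : Fin 4), hsSq (frameCoeff h (a, b, w)) = 4 * (d : ℝ) ^ 2 * η a b := by
    intro a b w
    simp only [hsSq, frameCoeff, Complex.normSq_mul, map_pow, Complex.normSq_I, one_pow, mul_one,
      ← Finset.mul_sum, Complex.normSq_natCast, hη]
    rw [show Complex.normSq 2 = 4 by norm_num [Complex.normSq_apply]]
    ring
  have hrow : ∀ a, ∑ b, η a b ≤ d := by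
    intro a
    simp only [hη]
    rw [Finset.sum_comm]
    calc ∑ s, ∑ b, ∑ s', Complex.normSq (h (s, a) (s', b))
        = ∑ s : Fin d, ∑ p', Complex.normSq (h (s, a) p') := by
          refine Finset.sum_congr rfl fun s _ => ?_
          rw [Finset.sum_comm, Fintype.sum_prod_type]
      _ ≤ ∑ s : Fin d, 1 := Finset.sum_le_sum fun s _ => sum_normSq_row_le hn hH _
      _ = d := by simp
  have hcol : ∀ b, ∑ a, η a b ≤ d := by
    intro b
    simp only [hη]
    calc ∑ a, ∑ s, ∑ s', Complex.normSq (h (s, a) (s', b))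
        = ∑ s', ∑ p, Complex.normSq (h p (s', b)) := by
          simp only [Fintype.sum_prod_type]
          rw [Finset.sum_comm]
          conv_rhs => rw [Finset.sum_comm]
          refine Finset.sum_congr rfl fun s _ => Finset.sum_comm
      _ ≤ ∑ s : Fin d, 1 := Finset.sum_le_sum fun s _ => sum_normSq_col_le hn _
      _ = d := by simp
  set B : Fin d → ℝ := fun a => (rdmOne φ j a a).re with hB
  have hB0 : ∀ a, 0 ≤ B a := fun a => rdmOne_diag_re_nonneg φ j a
  have hBs : ∑ a, B a = sqNorm φ := sum_rdmOne_diag_re hd φ j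
  rw [sum_outcomes]
  have e : ∀ a b, ∑ w : Fin 4, sqNorm (collapse φ j (a, b, w)) * hsSq (frameCoeff h (a, b, w)) =
      2 * d * (B a * η a b + B b * η a b) := by
    intro a b
    simp only [hF, ← Finset.sum_mul, sum_sqNorm_collapse_phase hd]
    field_simp
    ring
  simp only [e, ← Finset.mul_sum, Finset.sum_add_distrib]
  rw [Finset.sum_comm (f := fun a b => B b * η a b)]
  simp only [← Finset.mul_sum]
  have h1 : ∑ a, B a * ∑ b, η a b ≤ d * sqNorm φ := by
    rw [← hBs, Finset.mul_sum]
    exact Finset.sum_le_sum fun a _ => by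
      rw [mul_comm]; exact mul_le_mul_of_nonneg_right (hrow a) (hB0 a)
  have h2 : ∑ b, B b * ∑ a, η a b ≤ d * sqNorm φ := by
    rw [← hBs, Finset.mul_sum]
    exact Finset.sum_le_sum fun a _ => by
      rw [mul_comm]; exact mul_le_mul_of_nonneg_right (hcol a) (hB0 a)
  nlinarith [mul_le_mul_of_nonneg_left (add_le_add h1 h2) hd'.le]

/-- The product of two one-site operators. -/
def tensorTwo (A B : Fin d → Fin d → ℂ) (p p' : Fin d × Fin d) : ℂ := A p.1 p'.1 * B p.2 p'.2

/-- The energy of a pair of sites exceeds the one in the product of their states by little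
if the purity of one site gains little from a measurement of the other. -/
theorem correlation_bound (hd : 0 < d) (φ : (Fin n → Fin d) → ℂ) {i j : Fin n} (hij : i ≠ j)
    {h : Matrix (Fin d × Fin d) (Fin d × Fin d) ℂ} (hH : h.IsHermitian)
    (hn : operatorNorm h ≤ 1) {t : ℝ} (ht : 0 < t) :
    (pairTrace h (tensorTwo (rdmOne φ i) (rdmOne φ j))).re / sqNorm φ -
      (pairTrace h (rdmTwo φ i j)).re ≤ 2 * (d : ℝ) ^ 2 * t * sqNorm φ + gain φ i j / (2 * t) := by
  have h1 : pairTrace h (rdmTwo φ i j) =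
      ∑ z, ∑ s, ∑ s', frameCoeff h z s s' * rdmOne (collapse φ j z) i s' s := by
    rw [← frame_identity hd]
    simp only [rdmOne_collapse hd]
  have h2 : ((sqNorm φ)⁻¹ : ℝ) * pairTrace h (tensorTwo (rdmOne φ i) (rdmOne φ j)) =
      ∑ z, ∑ s, ∑ s', frameCoeff h z s s' *
        (((sqNorm (collapse φ j z) / sqNorm φ : ℝ) : ℂ) * rdmOne φ i s' s) := by
    rw [← frame_identity hd]
    rw [Finset.mul_sum]
    simp_rw [Finset.mul_sum _ _ (((sqNorm φ)⁻¹ : ℝ) : ℂ)]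
    refine Finset.sum_congr rfl fun z _ => Finset.sum_congr rfl fun s _ =>
      Finset.sum_congr rfl fun s' _ => ?_
    rw [Complex.ofReal_div, ofReal_sqNorm_collapse hd]
    have e : ∀ b b', star (probe z b) * probe z b' *
        tensorTwo (rdmOne φ i) (rdmOne φ j) (s', b) (s, b') =
        rdmOne φ i s' s * (star (probe z b) * probe z b' * rdmOne φ j b b') := by
      intro b b'
      simp only [tensorTwo]
      ring
    simp only [e, ← Finset.mul_sum]
    push_cast
    ring
  have h3 : (pairTrace h (tensorTwo (rdmOne φ i) (rdmOne φ j))).re / sqNorm φ -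
      (pairTrace h (rdmTwo φ i j)).re =
      ∑ z, ∑ s, ∑ s', -(frameCoeff h z s s' * deviation φ i j z s' s).re := by
    have := congrArg Complex.re h2
    rw [Complex.re_ofReal_mul] at this
    rw [div_eq_inv_mul, this, h1, ← Complex.sub_re, ← Finset.sum_sub_distrib]
    simp only [← Finset.sum_sub_distrib, ← mul_sub, Complex.re_sum]
    refine Finset.sum_congr rfl fun z _ => Finset.sum_congr rfl fun s _ =>
      Finset.sum_congr rfl fun s' _ => ?_
    rw [← Complex.neg_re, deviation]
    congr 1
    ring
  -- Young's inequality, weighted with the probability $q$ of the outcome: $|F\Delta| \le tq|F|^2/2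
  -- + |\Delta|^2/(2tq)$. With this weight the second part sums exactly to the gain.
  have h4 : ∀ z, ∑ s, ∑ s', -(frameCoeff h z s s' * deviation φ i j z s' s).re ≤
      t / 2 * (sqNorm (collapse φ j z) * hsSq (frameCoeff h z)) +
        (2 * t)⁻¹ * (hsSq (deviation φ i j z) / sqNorm (collapse φ j z)) := by
    intro z
    rcases (sqNorm_nonneg (collapse φ j z)).eq_or_lt with h0 | h0
    · simp [deviation, rdmOne_eq_zero h0.symm, ← h0]
    · set q := sqNorm (collapse φ j z)
      rw [hsSq, hsSq, Finset.sum_comm (f := fun a a' => Complex.normSq (deviation φ i j z a a'))]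
      simp only [Finset.mul_sum, Finset.sum_div, ← Finset.sum_add_distrib]
      refine Finset.sum_le_sum fun s _ => Finset.sum_le_sum fun s' _ => ?_
      generalize frameCoeff h z s s' = F
      generalize deviation φ i j z s' s = Δ
      have hre : -(F * Δ).re ≤ ‖F‖ * ‖Δ‖ := by
        rw [← norm_mul]
        exact (neg_le_abs _).trans (Complex.abs_re_le_norm _)
      refine hre.trans ?_
      rw [Complex.normSq_eq_norm_sq, Complex.normSq_eq_norm_sq]
      have e : t / 2 * (q * ‖F‖ ^ 2) + (2 * t)⁻¹ * (‖Δ‖ ^ 2 / q) - ‖F‖ * ‖Δ‖ =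
          (2 * t * q)⁻¹ * (t * q * ‖F‖ - ‖Δ‖) ^ 2 := by
        field_simp
        ring
      have : 0 ≤ (2 * t * q)⁻¹ * (t * q * ‖F‖ - ‖Δ‖) ^ 2 := by positivity
      linarith
  rw [h3, gain_eq hd φ hij]
  refine (Finset.sum_le_sum fun z _ => h4 z).trans ?_
  rw [Finset.sum_add_distrib, ← Finset.mul_sum, ← Finset.mul_sum]
  have e := div_eq_inv_mul (∑ z, hsSq (deviation φ i j z) / sqNorm (collapse φ j z)) (2 * t)
  have := mul_le_mul_of_nonneg_left (sum_sqNorm_mul_hsSq_frameCoeff_le hd φ j hH hn)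
    (half_pos ht).le
  linarith

end Correlation

/-! ### Decoupling all sites by measuring a few -/

section Decoupling

open Finset Function

variable {n d : ℕ}

/-- The vectors `φ x` arise from `ψ` by measuring sites in `C`. -/
def Unravels (ψ : (Fin n → Fin d) → ℂ) (C : Finset (Fin n)) {X : Type} [Fintype X]
    (φ : X → (Fin n → Fin d) → ℂ) : Prop :=
  ∑ x, sqNorm (φ x) = 1 ∧ ∀ i j, i ∉ C → j ∉ C → ∀ p p',
    ∑ x, rdmTwo (φ x) i j p p' = rdmTwo ψ i j p p'

theorem Unravels.collapse (hd : 0 < d) {ψ : (Fin n → Fin d) → ℂ} {C : Finset (Fin n)} {X : Type}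
    [Fintype X] {φ : X → (Fin n → Fin d) → ℂ} (h : Unravels ψ C φ) (j : Fin n) :
    Unravels ψ (insert j C) (fun y : X × (Fin d × Fin d × Fin 4) => collapse (φ y.1) j y.2) := by
  refine ⟨?_, fun i k hi hk p p' => ?_⟩
  · rw [Fintype.sum_prod_type]
    simp only [sum_sqNorm_collapse hd, h.1]
  · rw [Finset.mem_insert, not_or] at hi hk
    rw [Fintype.sum_prod_type]
    simp only [sum_rdmTwo_collapse hd _ hi.1 hk.1, h.2 i k hi.2 hk.2]

/-- The total purity of an ensemble. -/
noncomputable def totalPurity {X : Type} [Fintype X] (φ : X → (Fin n → Fin d) → ℂ) : ℝ :=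
  ∑ x, ∑ i, purity (φ x) i

theorem totalPurity_collapse {X : Type} [Fintype X] (φ : X → (Fin n → Fin d) → ℂ) (j : Fin n) :
    totalPurity (fun y : X × (Fin d × Fin d × Fin 4) => collapse (φ y.1) j y.2) =
      totalPurity φ + ∑ x, ∑ i, gain (φ x) i j := by
  rw [totalPurity, totalPurity, Fintype.sum_prod_type, ← Finset.sum_add_distrib]
  refine Finset.sum_congr rfl fun x _ => ?_
  rw [Finset.sum_comm, ← Finset.sum_add_distrib]
  refine Finset.sum_congr rfl fun i _ => ?_
  simp [gain]

theorem totalPurity_le (hd : 0 < d) {X : Type} [Fintype X] {φ : X → (Fin n → Fin d) → ℂ}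
    (h : ∑ x, sqNorm (φ x) = 1) : totalPurity φ ≤ n := by
  calc totalPurity φ ≤ ∑ x, ∑ _i : Fin n, sqNorm (φ x) :=
        Finset.sum_le_sum fun x _ => Finset.sum_le_sum fun i _ => purity_le hd (φ x) i
    _ = n := by simp [← Finset.mul_sum, h]

theorem le_totalPurity (hd : 0 < d) {X : Type} [Fintype X] {φ : X → (Fin n → Fin d) → ℂ}
    (h : ∑ x, sqNorm (φ x) = 1) : (n : ℝ) / d ≤ totalPurity φ := by
  calc (n : ℝ) / d = ∑ x, ∑ _i : Fin n, sqNorm (φ x) / d := by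
        simp [← Finset.mul_sum, ← Finset.sum_div, h]; ring
    _ ≤ totalPurity φ :=
        Finset.sum_le_sum fun x _ => Finset.sum_le_sum fun i _ => le_purity hd (φ x) i

/-- Greedily measuring the site from which most is learnt leaves, after few measurements,
only weak correlations. -/
theorem exists_decoupled (hd : 0 < d) (hn : 0 < n) (ψ : (Fin n → Fin d) → ℂ) (hψ : sqNorm ψ = 1)
    {m : ℕ} (hm : 0 < m) :
    ∃ (X : Type) (_ : Fintype X) (φ : X → (Fin n → Fin d) → ℂ) (C : Finset (Fin n)),
      Unravels ψ C φ ∧ C.card < m ∧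
        ∑ x, ∑ i, ∑ j, gain (φ x) i j ≤ (n : ℝ) ^ 2 * (1 - 1 / d) / m := by
  by_contra hcon
  push Not at hcon
  have hn' : (0 : ℝ) < n := by exact_mod_cast hn
  have hm' : (0 : ℝ) < m := by exact_mod_cast hm
  -- Chosen so that `m` increments of `T / n` cover exactly the distance from `n / d` to `n`
  -- available to the total purity.
  set T : ℝ := (n : ℝ) ^ 2 * (1 - 1 / d) / m with hT
  have step : ∀ (X : Type) (_ : Fintype X) (φ : X → (Fin n → Fin d) → ℂ) (C : Finset (Fin n)),
      Unravels ψ C φ → C.card < m →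
        ∃ j, totalPurity φ + T / n <
          totalPurity (fun y : X × (Fin d × Fin d × Fin 4) => collapse (φ y.1) j y.2) := by
    intro X _ φ C hφ hC
    have h1 := hcon X _ φ C hφ hC
    have h2 : ∑ _j : Fin n, T / n < ∑ j, ∑ x, ∑ i, gain (φ x) i j := by
      rw [Finset.sum_comm]
      simp only [Finset.sum_const, Finset.card_univ, Fintype.card_fin, nsmul_eq_mul]
      rw [mul_div_cancel₀ _ hn'.ne']
      refine h1.trans_eq (Finset.sum_congr rfl fun x _ => ?_)
      rw [Finset.sum_comm]
    obtain ⟨j, -, hj⟩ := Finset.exists_lt_of_sum_lt h2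
    exact ⟨j, by rw [totalPurity_collapse]; linarith⟩
  have claim : ∀ k, k < m → ∃ (X : Type) (_ : Fintype X) (φ : X → (Fin n → Fin d) → ℂ)
      (C : Finset (Fin n)), Unravels ψ C φ ∧ C.card ≤ k ∧
        (n : ℝ) / d + k * (T / n) ≤ totalPurity φ := by
    intro k
    induction k with
    | zero =>
      intro _
      refine ⟨Unit, inferInstance, fun _ => ψ, ∅, ⟨by simpa using hψ, by simp⟩, by simp, ?_⟩
      have := le_totalPurity (n := n) hd (φ := fun _ : Unit => ψ) (by simpa using hψ)
      simpa using this
    | succ k ih =>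
      intro hk
      obtain ⟨X, _, φ, C, hφ, hC, hP⟩ := ih (by omega)
      obtain ⟨j, hj⟩ := step X _ φ C hφ (by omega)
      refine ⟨_, inferInstance, _, _, hφ.collapse hd j,
        (Finset.card_insert_le _ _).trans (by omega), ?_⟩
      push_cast
      linarith
  -- After `m - 1` measurements one more is still possible, and its strict increase pushes the
  -- purity above `n`. Stopping one step earlier is what keeps `C.card < m`.
  obtain ⟨X, _, φ, C, hφ, hC, hP⟩ := claim (m - 1) (by omega)
  obtain ⟨j, hj⟩ := step X _ φ C hφ (by omega)
  have h3 := totalPurity_le hd (hφ.collapse hd j).1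
  have h4 : (n : ℝ) / d + m * (T / n) = n := by
    rw [hT]
    field_simp
    ring
  have h5 : ((m - 1 : ℕ) : ℝ) = m - 1 := by
    rw [Nat.cast_sub hm]; simp
  rw [h5] at hP
  linarith

end Decoupling

/-! ### Product states -/

section ProductStates

open Finset Function

variable {n d : ℕ}

/-- The rank-one operator `|v⟩⟨v|`. -/
def rankOne (v : Fin d → ℂ) (a a' : Fin d) : ℂ := v a * star (v a')

/-- A mixture of pure states. -/
def IsMixture (σ : Fin d → Fin d → ℂ) : Prop :=
  ∃ (X : Type) (_ : Fintype X) (w : X → Fin d → ℂ),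
    (∀ a a', σ a a' = ∑ x, rankOne (w x) a a') ∧ ∑ x, sqNorm (w x) = 1

theorem sqNorm_smul {ι : Type*} [Fintype ι] (c : ℝ) (φ : ι → ℂ) :
    sqNorm (fun x => (c : ℂ) * φ x) = c ^ 2 * sqNorm φ := by
  simp only [sqNorm, Complex.normSq_mul, Complex.normSq_ofReal, ← Finset.mul_sum, sq]

/-- The normalized state of site `i`. -/
noncomputable def siteState (φ : (Fin n → Fin d) → ℂ) (i : Fin n) (a a' : Fin d) : ℂ :=
  (((sqNorm φ)⁻¹ : ℝ) : ℂ) * rdmOne φ i a a'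

/-- The components are the slices of `φ` along coordinate `i`, one for each configuration. The value
of the configuration at `i` itself is idle, so each slice occurs `d` times, whence the `d⁻¹` in `c ^
2`. -/
theorem isMixture_siteState (hd : 0 < d) {φ : (Fin n → Fin d) → ℂ} (h : 0 < sqNorm φ)
    (i : Fin n) : IsMixture (siteState φ i) := by
  have hd' : (0 : ℝ) < d := by exact_mod_cast hd
  set c : ℝ := Real.sqrt ((sqNorm φ)⁻¹ * (d : ℝ)⁻¹) with hc
  have hcc : c ^ 2 = (sqNorm φ)⁻¹ * (d : ℝ)⁻¹ := Real.sq_sqrt (by positivity)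
  have hcc' : (c : ℂ) * c = ((sqNorm φ : ℝ) : ℂ)⁻¹ * (d : ℂ)⁻¹ := by
    rw [← sq, ← Complex.ofReal_pow, hcc]; push_cast; rfl
  refine ⟨Fin n → Fin d, inferInstance, fun x a => (c : ℂ) * φ (update x i a), ?_, ?_⟩
  · intro a a'
    simp only [siteState, rdmOne, rankOne, Finset.mul_sum]
    refine Finset.sum_congr rfl fun x _ => ?_
    rw [star_mul', show star (c : ℂ) = c from Complex.conj_ofReal c, mul_mul_mul_comm, hcc']
    push_cast
    ring
  · have e : ∀ x : Fin n → Fin d, sqNorm (fun a => (c : ℂ) * φ (update x i a)) =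
        c ^ 2 * ∑ a, Complex.normSq (φ (update x i a)) := fun x => sqNorm_smul c _
    simp only [e, ← Finset.mul_sum]
    rw [sum_sum_update i (fun x => Complex.normSq (φ x)), hcc, nsmul_eq_mul,
      show ∑ x, Complex.normSq (φ x) = sqNorm φ from rfl]
    field_simp

theorem pairTrace_tensorTwo_sum_left {X : Type} [Fintype X]
    (h : Matrix (Fin d × Fin d) (Fin d × Fin d) ℂ) (s : X → ℝ) (σ : X → Fin d → Fin d → ℂ)
    (τ : Fin d → Fin d → ℂ) :
    (pairTrace h (tensorTwo (fun a a' => ∑ x, (s x : ℂ) * σ x a a') τ)).re =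
      ∑ x, s x * (pairTrace h (tensorTwo (σ x) τ)).re := by
  have e : pairTrace h (tensorTwo (fun a a' => ∑ x, (s x : ℂ) * σ x a a') τ) =
      ∑ x, (s x : ℂ) * pairTrace h (tensorTwo (σ x) τ) := by
    simp only [pairTrace, tensorTwo, Finset.sum_mul, Finset.mul_sum]
    rw [Finset.sum_comm (s := (univ : Finset X))]
    refine Finset.sum_congr rfl fun p _ => ?_
    rw [Finset.sum_comm (s := (univ : Finset X))]
    exact Finset.sum_congr rfl fun p' _ => Finset.sum_congr rfl fun x _ => by ring
  rw [e, Complex.re_sum]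
  exact Finset.sum_congr rfl fun x _ => Complex.re_ofReal_mul _ _

theorem pairTrace_tensorTwo_sum_right {X : Type} [Fintype X]
    (h : Matrix (Fin d × Fin d) (Fin d × Fin d) ℂ) (s : X → ℝ) (σ : X → Fin d → Fin d → ℂ)
    (τ : Fin d → Fin d → ℂ) :
    (pairTrace h (tensorTwo τ (fun a a' => ∑ x, (s x : ℂ) * σ x a a'))).re =
      ∑ x, s x * (pairTrace h (tensorTwo τ (σ x))).re := by
  have e : pairTrace h (tensorTwo τ (fun a a' => ∑ x, (s x : ℂ) * σ x a a')) =
      ∑ x, (s x : ℂ) * pairTrace h (tensorTwo τ (σ x)) := by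
    simp only [pairTrace, tensorTwo, Finset.mul_sum]
    rw [Finset.sum_comm (s := (univ : Finset X))]
    refine Finset.sum_congr rfl fun p _ => ?_
    rw [Finset.sum_comm (s := (univ : Finset X))]
    exact Finset.sum_congr rfl fun p' _ => Finset.sum_congr rfl fun x _ => by ring
  rw [e, Complex.re_sum]
  exact Finset.sum_congr rfl fun x _ => Complex.re_ofReal_mul _ _

theorem abs_pairTrace_rankOne_le {h : Matrix (Fin d × Fin d) (Fin d × Fin d) ℂ}
    (hn : operatorNorm h ≤ 1) (v w : Fin d → ℂ) :
    |(pairTrace h (tensorTwo (rankOne v) (rankOne w))).re| ≤ sqNorm v * sqNorm w := by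
  have e := abs_re_dotProduct_mulVec_le hn (fun p : Fin d × Fin d => v p.1 * w p.2)
  have e2 : sqNorm (fun p : Fin d × Fin d => v p.1 * w p.2) = sqNorm v * sqNorm w := by
    simp only [sqNorm, Fintype.sum_prod_type, Complex.normSq_mul, Finset.sum_mul_sum]
  rw [e2] at e
  refine le_trans (le_of_eq ?_) e
  simp only [pairTrace, tensorTwo, rankOne]
  congr 2
  refine Finset.sum_congr rfl fun p _ => Finset.sum_congr rfl fun p' _ => ?_
  rw [star_mul']
  ring

theorem abs_pairTrace_mixture_le {h : Matrix (Fin d × Fin d) (Fin d × Fin d) ℂ}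
    (hn : operatorNorm h ≤ 1) {σ τ : Fin d → Fin d → ℂ} (hσ : IsMixture σ) (hτ : IsMixture τ) :
    |(pairTrace h (tensorTwo σ τ)).re| ≤ 1 := by
  obtain ⟨X, _, v, hv, hv1⟩ := hσ
  obtain ⟨Y, _, w, hw, hw1⟩ := hτ
  have e1 : σ = fun a a' => ∑ x, ((1 : ℝ) : ℂ) * rankOne (v x) a a' := by
    funext a a'; simp [hv]
  have e2 : τ = fun a a' => ∑ x, ((1 : ℝ) : ℂ) * rankOne (w x) a a' := by
    funext a a'; simp [hw]
  rw [e1, pairTrace_tensorTwo_sum_left h (fun _ => 1)]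
  simp only [one_mul]
  have e3 : ∀ x, (pairTrace h (tensorTwo (rankOne (v x)) τ)).re =
      ∑ y, (pairTrace h (tensorTwo (rankOne (v x)) (rankOne (w y)))).re := by
    intro x
    rw [e2, pairTrace_tensorTwo_sum_right h (fun _ => 1)]
    simp
  simp only [e3]
  calc _ ≤ ∑ x, ∑ y, sqNorm (v x) * sqNorm (w y) :=
        (Finset.abs_sum_le_sum_abs _ _).trans (Finset.sum_le_sum fun x _ =>
          (Finset.abs_sum_le_sum_abs _ _).trans (Finset.sum_le_sum fun y _ =>
            abs_pairTrace_rankOne_le hn _ _))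
    _ = 1 := by rw [← Finset.sum_mul_sum, hv1, hw1, one_mul]

/-- The total energy of a product of one-site states. -/
noncomputable def productEnergy (E : Finset (Fin n × Fin n))
    (h : Fin n → Fin n → Matrix (Fin d × Fin d) (Fin d × Fin d) ℂ)
    (σ : Fin n → Fin d → Fin d → ℂ) : ℝ :=
  ∑ e ∈ E, (pairTrace (h e.1 e.2) (tensorTwo (σ e.1) (σ e.2))).re

/-- An edge has two distinct ends, so each summand is linear in the state of `i` or does not contain
it; in the second case the weights sum to one. -/
theorem productEnergy_update_sum {E : Finset (Fin n × Fin n)} (hE : ∀ e ∈ E, e.1 ≠ e.2)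
    (h : Fin n → Fin n → Matrix (Fin d × Fin d) (Fin d × Fin d) ℂ)
    (σ : Fin n → Fin d → Fin d → ℂ) (i : Fin n) {X : Type} [Fintype X] (s : X → ℝ)
    (hs : ∑ x, s x = 1) (τ : X → Fin d → Fin d → ℂ) :
    productEnergy E h (update σ i fun a a' => ∑ x, (s x : ℂ) * τ x a a') =
      ∑ x, s x * productEnergy E h (update σ i (τ x)) := by
  simp only [productEnergy, Finset.mul_sum]
  rw [Finset.sum_comm]
  refine Finset.sum_congr rfl fun e he => ?_
  have hne := hE e he
  by_cases h1 : e.1 = i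
  · have h2 : e.2 ≠ i := fun h2 => hne (h1.trans h2.symm)
    simp only [h1, update_self, update_of_ne h2]
    rw [pairTrace_tensorTwo_sum_left]
  · by_cases h2 : e.2 = i
    · simp only [h2, update_self, update_of_ne h1]
      rw [pairTrace_tensorTwo_sum_right]
    · simp only [update_of_ne h1, update_of_ne h2]
      rw [← Finset.sum_mul, hs, one_mul]

/-- Some value does not exceed the average. Positivity of its weight is included because the chosen
component has to be normalized afterwards. -/
theorem exists_weight_le {X : Type} [Fintype X] {s f : X → ℝ} (hs0 : ∀ x, 0 ≤ s x)
    (hs : ∑ x, s x = 1) {c : ℝ} (hf : ∑ x, s x * f x ≤ c) : ∃ x, 0 < s x ∧ f x ≤ c := by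
  by_contra hcon
  push Not at hcon
  have h0 : 0 < ∑ x, s x * (f x - c) := by
    refine Finset.sum_pos' (fun x _ => ?_) ?_
    · rcases (hs0 x).eq_or_lt with h | h
      · simp [← h]
      · exact mul_nonneg h.le (sub_nonneg.2 (hcon x h).le)
    · obtain ⟨x, hx⟩ : ∃ x, 0 < s x := by
        by_contra h
        push Not at h
        have : ∑ x, s x ≤ 0 := Finset.sum_nonpos fun x _ => h x
        linarith
      exact ⟨x, Finset.mem_univ _, mul_pos hx (sub_pos.2 (hcon x hx))⟩
  simp only [mul_sub, Finset.sum_sub_distrib, ← Finset.sum_mul, hs] at h0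
  linarith

/-- Among the product states, pure ones have the least energy. -/
theorem exists_pure_productEnergy_le {E : Finset (Fin n × Fin n)} (hE : ∀ e ∈ E, e.1 ≠ e.2)
    (h : Fin n → Fin n → Matrix (Fin d × Fin d) (Fin d × Fin d) ℂ)
    {σ : Fin n → Fin d → Fin d → ℂ} (hσ : ∀ i, IsMixture (σ i)) :
    ∃ u : Fin n → Fin d → ℂ, (∀ i, sqNorm (u i) = 1) ∧
      productEnergy E h (fun i => rankOne (u i)) ≤ productEnergy E h σ := by
  -- Sites are purified one at a time. With the others fixed, the energy is an average over the
  -- components of the mixture, so one normalized component does not raise it.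
  have claim : ∀ S : Finset (Fin n), ∃ τ : Fin n → Fin d → Fin d → ℂ, (∀ i, IsMixture (τ i)) ∧
      (∀ i ∈ S, ∃ u, sqNorm u = 1 ∧ τ i = rankOne u) ∧
        productEnergy E h τ ≤ productEnergy E h σ := by
    intro S
    induction S using Finset.induction_on with
    | empty => exact ⟨σ, hσ, by simp, le_rfl⟩
    | insert i S hi ih =>
      obtain ⟨τ, hτ, hS, hle⟩ := ih
      obtain ⟨X, _, w, hw, hw1⟩ := hτ i
      set v : X → Fin d → ℂ := fun x a => (((Real.sqrt (sqNorm (w x)))⁻¹ : ℝ) : ℂ) * w x a with hv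
      have hsw : ∀ x, rankOne (w x) = fun a a' => ((sqNorm (w x) : ℝ) : ℂ) * rankOne (v x) a a' := by
        intro x
        funext a a'
        rcases (sqNorm_nonneg (w x)).eq_or_lt with h0 | h0
        · rw [← h0]
          simp [rankOne, sqNorm_eq_zero.1 h0.symm]
        · have e : ((sqNorm (w x) : ℝ) : ℂ) * ((((Real.sqrt (sqNorm (w x)))⁻¹ : ℝ) : ℂ) *
              (((Real.sqrt (sqNorm (w x)))⁻¹ : ℝ) : ℂ)) = 1 := by
            rw [← Complex.ofReal_mul, ← Complex.ofReal_mul, ← mul_inv,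
              Real.mul_self_sqrt h0.le, mul_inv_cancel₀ h0.ne', Complex.ofReal_one]
          simp only [rankOne, hv, star_mul', show ∀ c : ℝ, star (c : ℂ) = c from Complex.conj_ofReal]
          linear_combination (-(w x a * star (w x a'))) * e
      have e1 : τ = update τ i fun a a' => ∑ x, ((sqNorm (w x) : ℝ) : ℂ) * rankOne (v x) a a' := by
        have : τ i = fun a a' => ∑ x, ((sqNorm (w x) : ℝ) : ℂ) * rankOne (v x) a a' := by
          funext a a'
          rw [hw]
          exact Finset.sum_congr rfl fun x _ => by rw [hsw x]
        rw [← this, update_eq_self]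
      have e2 := productEnergy_update_sum hE h τ i _ hw1 (fun x => rankOne (v x))
      rw [← e1] at e2
      obtain ⟨x, hx, hfx⟩ := exists_weight_le (fun x => sqNorm_nonneg (w x)) hw1
        (e2.symm.le.trans hle)
      have hvx : sqNorm (v x) = 1 := by
        rw [hv, sqNorm_smul, inv_pow, Real.sq_sqrt hx.le, inv_mul_cancel₀ hx.ne']
      refine ⟨update τ i (rankOne (v x)), ?_, ?_, hfx⟩
      · intro k
        by_cases hk : k = i
        · subst hk
          rw [update_self]
          exact ⟨Unit, inferInstance, fun _ => v x, by simp, by simpa using hvx⟩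
        · rw [update_of_ne hk]
          exact hτ k
      · intro k hk
        by_cases hki : k = i
        · subst hki
          exact ⟨v x, hvx, update_self _ _ _⟩
        · rw [update_of_ne hki]
          exact hS k (Finset.mem_of_mem_insert_of_ne hk hki)
  obtain ⟨τ, -, hS, hle⟩ := claim univ
  choose u hu1 hu2 using fun i => hS i (Finset.mem_univ i)
  refine ⟨u, hu1, ?_⟩
  rwa [show (fun i => rankOne (u i)) = τ from funext fun i => (hu2 i).symm]

end ProductStates

/-! ### Edges of a regular graph -/

section Edges

open Finset

variable {n : ℕ}

/-- The edges of `G`, each as a pair `(i, j)` with `i < j`. -/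
def edgePairs (G : SimpleGraph (Fin n)) [DecidableRel G.Adj] : Finset (Fin n × Fin n) :=
  (univ : Finset (Fin n × Fin n)).filter fun e => e.1 < e.2 ∧ G.Adj e.1 e.2

variable {G : SimpleGraph (Fin n)} [DecidableRel G.Adj] {D : ℕ}

theorem mem_edgePairs {e : Fin n × Fin n} : e ∈ edgePairs G ↔ e.1 < e.2 ∧ G.Adj e.1 e.2 := by
  simp [edgePairs]

theorem two_mul_card_edgePairs (hG : G.IsRegularOfDegree D) : 2 * (edgePairs G).card = n * D := by
  have h1 : (univ.filter fun e : Fin n × Fin n => G.Adj e.1 e.2).card = n * D := by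
    rw [Finset.card_filter, Fintype.sum_prod_type]
    have : ∀ i : Fin n, ∑ j, (if G.Adj i j then 1 else 0) = D := by
      intro i
      rw [← Finset.card_filter, ← hG.degree_eq i, ← G.card_neighborFinset_eq_degree]
      congr 1
      ext j
      simp
    simp [this]
  have h2 : (univ.filter fun e : Fin n × Fin n => G.Adj e.1 e.2) =
      edgePairs G ∪ (edgePairs G).map (Equiv.prodComm _ _).toEmbedding := by
    ext ⟨i, j⟩
    simp only [Finset.mem_filter, Finset.mem_univ, true_and, Finset.mem_union, Finset.mem_map_equiv,
      mem_edgePairs, Equiv.prodComm_symm, Equiv.prodComm_apply, Prod.fst_swap, Prod.snd_swap]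
    constructor
    · intro h
      rcases lt_trichotomy i j with hl | hl | hl
      · exact Or.inl ⟨hl, h⟩
      · exact absurd hl h.ne
      · exact Or.inr ⟨hl, h.symm⟩
    · rintro (h | h)
      · exact h.2
      · exact h.2.symm
  have h3 : Disjoint (edgePairs G) ((edgePairs G).map (Equiv.prodComm _ _).toEmbedding) := by
    rw [Finset.disjoint_left]
    rintro ⟨i, j⟩ h h'
    simp only [Finset.mem_map_equiv, mem_edgePairs, Equiv.prodComm_symm, Equiv.prodComm_apply,
      Prod.fst_swap, Prod.snd_swap] at h h'
    exact lt_asymm h.1 h'.1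
  rw [← h1, h2, Finset.card_union_of_disjoint h3, Finset.card_map]
  ring

/-- Every such edge is the sorted pair of some site of `C` and one of its `D` neighbours. -/
theorem card_touching_le (hG : G.IsRegularOfDegree D) (C : Finset (Fin n)) :
    ((edgePairs G).filter fun e => e.1 ∈ C ∨ e.2 ∈ C).card ≤ C.card * D := by
  have hsub : ((edgePairs G).filter fun e => e.1 ∈ C ∨ e.2 ∈ C) ⊆
      C.biUnion fun c => (G.neighborFinset c).image fun k => if c < k then (c, k) else (k, c) := by
    rintro ⟨i, j⟩ he
    simp only [Finset.mem_filter, mem_edgePairs] at he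
    simp only [Finset.mem_biUnion, Finset.mem_image, SimpleGraph.mem_neighborFinset]
    obtain ⟨⟨hij, hadj⟩, hi | hj⟩ := he
    · exact ⟨i, hi, j, hadj, by simp [hij]⟩
    · exact ⟨j, hj, i, hadj.symm, by simp [hij.le]⟩
  calc _ ≤ _ := Finset.card_le_card hsub
    _ ≤ ∑ c ∈ C, ((G.neighborFinset c).image fun k => if c < k then (c, k) else (k, c)).card :=
        Finset.card_biUnion_le
    _ ≤ ∑ _c ∈ C, D := Finset.sum_le_sum fun c _ => Finset.card_image_le.trans_eq <| by
        rw [G.card_neighborFinset_eq_degree, hG.degree_eq]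
    _ = C.card * D := by simp

end Edges

/-! ### The energy of product states -/

section EnergyBounds

open Finset Function

variable {n d : ℕ}

theorem edgeHamiltonian_expectation (hd : 0 < d) {D : ℕ} (G : SimpleGraph (Fin n))
    [DecidableRel G.Adj] (h : Fin n → Fin n → Matrix (Fin d × Fin d) (Fin d × Fin d) ℂ)
    (ψ : (Fin n → Fin d) → ℂ) :
    (dotProduct (star ψ) ((edgeHamiltonian D G h).mulVec ψ)).re = 2 / ((n : ℝ) * D) *
      ∑ e ∈ edgePairs G, (pairTrace (h e.1 e.2) (rdmTwo ψ e.1 e.2)).re := by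
  rw [edgeHamiltonian, Matrix.smul_mulVec, Matrix.sum_mulVec, dotProduct_smul, dotProduct_sum,
    ← Complex.re_sum, smul_eq_mul,
    show (2 : ℂ) / ((n : ℂ) * (D : ℂ)) = ((2 / ((n : ℝ) * D) : ℝ) : ℂ) by push_cast; rfl,
    Complex.re_ofReal_mul]
  congr 2
  exact Finset.sum_congr rfl fun e he => twoSite_expectation hd ψ (mem_edgePairs.1 he).1.ne _

theorem abs_pairTrace_rdmTwo_le (hd : 0 < d) {h : Matrix (Fin d × Fin d) (Fin d × Fin d) ℂ}
    (hn : operatorNorm h ≤ 1) (φ : (Fin n → Fin d) → ℂ) (i j : Fin n) :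
    |(pairTrace h (rdmTwo φ i j)).re| ≤ sqNorm φ := by
  have hd' : (d : ℝ) ≠ 0 := by exact_mod_cast hd.ne'
  set w : (Fin n → Fin d) → Fin d × Fin d → ℂ := fun x p => φ (update (update x i p.1) j p.2)
  have e : pairTrace h (rdmTwo φ i j) = ((((d : ℝ) ^ 2)⁻¹ : ℝ) : ℂ) *
      ∑ x, ∑ p, ∑ p', h p p' * (w x p' * star (w x p)) := by
    simp only [pairTrace, rdmTwo, Finset.mul_sum]
    rw [Finset.sum_comm (s := (univ : Finset (Fin n → Fin d)))]
    refine Finset.sum_congr rfl fun p _ => ?_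
    rw [Finset.sum_comm (s := (univ : Finset (Fin n → Fin d)))]
    refine Finset.sum_congr rfl fun p' _ => Finset.sum_congr rfl fun x _ => ?_
    push_cast
    ring
  have hs : ∑ x, sqNorm (w x) = (d : ℝ) ^ 2 * sqNorm φ := by
    simp only [sqNorm, w, Fintype.sum_prod_type]
    rw [sum_sum_update i (fun y => ∑ b, Complex.normSq (φ (update y j b))),
      sum_sum_update j (fun y => Complex.normSq (φ y)), nsmul_eq_mul, nsmul_eq_mul]
    ring
  rw [e, Complex.re_ofReal_mul, abs_mul, abs_of_nonneg (by positivity), Complex.re_sum]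
  calc _ ≤ ((d : ℝ) ^ 2)⁻¹ * ∑ x, sqNorm (w x) :=
        mul_le_mul_of_nonneg_left ((Finset.abs_sum_le_sum_abs _ _).trans
          (Finset.sum_le_sum fun x _ => abs_re_dotProduct_mulVec_le hn (w x))) (by positivity)
    _ = sqNorm φ := by rw [hs]; field_simp

/-- The product vector with the given factors. -/
def productVector (u : Fin n → Fin d → ℂ) (x : Fin n → Fin d) : ℂ := ∏ k, u k (x k)

theorem sqNorm_productVector (u : Fin n → Fin d → ℂ) :
    sqNorm (productVector u) = ∏ k, sqNorm (u k) := by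
  simp only [sqNorm, productVector, map_prod]
  rw [Finset.prod_univ_sum, Fintype.piFinset_univ]

theorem rdmTwo_productVector (hd : 0 < d) {u : Fin n → Fin d → ℂ} (hu : ∀ k, sqNorm (u k) = 1)
    {i j : Fin n} (hij : i ≠ j) :
    rdmTwo (productVector u) i j = tensorTwo (rankOne (u i)) (rankOne (u j)) := by
  have hd' : (d : ℂ) ≠ 0 := by exact_mod_cast hd.ne'
  set S : Finset (Fin n) := (univ \ {j}) \ {i} with hS
  have e : ∀ (x : Fin n → Fin d) (p : Fin d × Fin d),
      productVector u (update (update x i p.1) j p.2) =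
        u i p.1 * u j p.2 * ∏ k ∈ S, u k (x k) := by
    intro x p
    have e1 : ∀ k, u k (update (update x i p.1) j p.2 k) =
        update (update (fun k => u k (x k)) i (u i p.1)) j (u j p.2) k := by
      intro k
      rw [Function.apply_update (fun k => u k)]
      congr 1
      funext k
      rw [Function.apply_update (fun k => u k)]
    simp only [productVector, e1]
    rw [Finset.prod_update_of_mem (Finset.mem_univ j), Finset.prod_update_of_mem (by simp [hij])]
    ring
  -- The sum factorizes: sites in `S` contribute their squared norm 1, and the idle coordinates at
  -- `i` and `j` contribute `d` each.
  have hsum : ∑ x : Fin n → Fin d, (∏ k ∈ S, u k (x k)) * star (∏ k ∈ S, u k (x k)) =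
      (d : ℂ) ^ 2 := by
    have e1 : ∀ x : Fin n → Fin d, (∏ k ∈ S, u k (x k)) * star (∏ k ∈ S, u k (x k)) =
        ∏ k, (if k ∈ S then u k (x k) * star (u k (x k)) else 1) := by
      intro x
      rw [Finset.prod_ite_mem, Finset.univ_inter, Finset.prod_mul_distrib, star_prod]
    simp only [e1]
    have e2 := Finset.prod_univ_sum (fun _ : Fin n => (univ : Finset (Fin d)))
      (fun k b => if k ∈ S then u k b * star (u k b) else 1)
    rw [Fintype.piFinset_univ] at e2
    rw [← e2]
    have e3 : ∀ k, ∑ b, (if k ∈ S then u k b * star (u k b) else 1) =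
        if k ∈ ({i, j} : Finset (Fin n)) then (d : ℂ) else 1 := by
      intro k
      by_cases hk : k ∈ S
      · have hk' : k ∉ ({i, j} : Finset (Fin n)) := by
          simp only [hS, Finset.mem_sdiff, Finset.mem_singleton, Finset.mem_univ, true_and] at hk
          simp [hk.1, hk.2]
        simp only [hk, hk', if_true, if_false]
        rw [← ofReal_sqNorm, hu, Complex.ofReal_one]
      · have hk' : k ∈ ({i, j} : Finset (Fin n)) := by
          simp only [hS, Finset.mem_sdiff, Finset.mem_singleton, Finset.mem_univ, true_and] at hk
          rw [Finset.mem_insert, Finset.mem_singleton]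
          tauto
        simp [hk, hk']
    simp only [e3]
    rw [Finset.prod_ite_mem, Finset.univ_inter, Finset.prod_const, Finset.card_pair hij]
  funext p p'
  simp only [rdmTwo, e, tensorTwo, rankOne]
  have e4 : ∀ x : Fin n → Fin d, u i p.1 * u j p.2 * (∏ k ∈ S, u k (x k)) *
      star (u i p'.1 * u j p'.2 * ∏ k ∈ S, u k (x k)) =
      (u i p.1 * star (u i p'.1) * (u j p.2 * star (u j p'.2))) *
        ((∏ k ∈ S, u k (x k)) * star (∏ k ∈ S, u k (x k))) := by
    intro x
    rw [star_mul', star_mul']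
    ring
  simp only [e4, ← Finset.mul_sum, hsum]
  field_simp

variable {D : ℕ} {G : SimpleGraph (Fin n)} [DecidableRel G.Adj]
  {h : Fin n → Fin n → Matrix (Fin d × Fin d) (Fin d × Fin d) ℂ}

theorem two_div_mul_card_edgePairs (hn : 0 < n) (hD : 0 < D) (hG : G.IsRegularOfDegree D) :
    2 / ((n : ℝ) * D) * (edgePairs G).card = 1 := by
  have hc : 2 * ((edgePairs G).card : ℝ) = n * D := by exact_mod_cast two_mul_card_edgePairs hG
  have hn' : (n : ℝ) ≠ 0 := by exact_mod_cast hn.ne'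
  have hD' : (D : ℝ) ≠ 0 := by exact_mod_cast hD.ne'
  rw [div_mul_eq_mul_div, hc, div_self (mul_ne_zero hn' hD')]

theorem abs_edgeHamiltonian_expectation_le (hn : 0 < n) (hd : 0 < d) (hD : 0 < D)
    (hG : G.IsRegularOfDegree D)
    (hh : ∀ i j, i < j → G.Adj i j → (h i j).IsHermitian ∧ operatorNorm (h i j) ≤ 1)
    {ψ : (Fin n → Fin d) → ℂ} (hψ : sqNorm ψ = 1) :
    |(dotProduct (star ψ) ((edgeHamiltonian D G h).mulVec ψ)).re| ≤ 1 := by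
  rw [edgeHamiltonian_expectation hd, abs_mul, abs_of_nonneg (by positivity),
    ← two_div_mul_card_edgePairs hn hD hG]
  refine mul_le_mul_of_nonneg_left ((Finset.abs_sum_le_sum_abs _ _).trans ?_) (by positivity)
  rw [Finset.cast_card]
  refine Finset.sum_le_sum fun e he => ?_
  rw [mem_edgePairs] at he
  rw [← hψ]
  exact abs_pairTrace_rdmTwo_le hd (hh _ _ he.1 he.2).2 ψ _ _

theorem dotProduct_star_self {ι : Type*} [Fintype ι] (ψ : ι → ℂ) :
    dotProduct (star ψ) ψ = (sqNorm ψ : ℂ) := by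
  rw [ofReal_sqNorm]
  exact Finset.sum_congr rfl fun x _ => mul_comm _ _

theorem exists_sqNorm_eq_one (hd : 0 < d) : ∃ ψ : (Fin n → Fin d) → ℂ, sqNorm ψ = 1 :=
  ⟨Pi.single (fun _ => ⟨0, hd⟩) 1, by
    simp [sqNorm, Pi.single_apply, apply_ite Complex.normSq]⟩

theorem groundEnergy_le (hn : 0 < n) (hd : 0 < d) (hD : 0 < D) (hG : G.IsRegularOfDegree D)
    (hh : ∀ i j, i < j → G.Adj i j → (h i j).IsHermitian ∧ operatorNorm (h i j) ≤ 1)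
    {ψ : (Fin n → Fin d) → ℂ} (hψ : sqNorm ψ = 1) :
    groundEnergy (edgeHamiltonian D G h) ≤
      (dotProduct (star ψ) ((edgeHamiltonian D G h).mulVec ψ)).re := by
  refine csInf_le ⟨-1, ?_⟩ ⟨ψ, by rw [dotProduct_star_self, hψ, Complex.ofReal_one], rfl⟩
  rintro E ⟨φ, hφ, rfl⟩
  rw [dotProduct_star_self] at hφ
  exact (abs_le.1 (abs_edgeHamiltonian_expectation_le hn hd hD hG hh (by exact_mod_cast hφ))).1

theorem abs_groundEnergy_le (hn : 0 < n) (hd : 0 < d) (hD : 0 < D) (hG : G.IsRegularOfDegree D)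
    (hh : ∀ i j, i < j → G.Adj i j → (h i j).IsHermitian ∧ operatorNorm (h i j) ≤ 1) :
    |groundEnergy (edgeHamiltonian D G h)| ≤ 1 := by
  obtain ⟨ψ, hψ⟩ := exists_sqNorm_eq_one (n := n) hd
  rw [abs_le]
  constructor
  · refine le_csInf ⟨_, ψ, by rw [dotProduct_star_self, hψ, Complex.ofReal_one], rfl⟩ ?_
    rintro E ⟨φ, hφ, rfl⟩
    rw [dotProduct_star_self] at hφ
    exact (abs_le.1 (abs_edgeHamiltonian_expectation_le hn hd hD hG hh (by exact_mod_cast hφ))).1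
  · exact (groundEnergy_le hn hd hD hG hh hψ).trans
      (abs_le.1 (abs_edgeHamiltonian_expectation_le hn hd hD hG hh hψ)).2

theorem exists_expectation_lt (hd : 0 < d) {H : Matrix (Fin n → Fin d) (Fin n → Fin d) ℂ} {E : ℝ}
    (hE : groundEnergy H < E) :
    ∃ ψ, sqNorm ψ = 1 ∧ (dotProduct (star ψ) (H.mulVec ψ)).re < E := by
  obtain ⟨ψ₀, hψ₀⟩ := exists_sqNorm_eq_one (n := n) hd
  obtain ⟨_, ⟨ψ, hψ, rfl⟩, hlt⟩ := exists_lt_of_csInf_lt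
    (s := {E : ℝ | ∃ ψ : (Fin n → Fin d) → ℂ, dotProduct (star ψ) ψ = 1 ∧
      (dotProduct (star ψ) (H.mulVec ψ)).re = E})
    ⟨_, ψ₀, by rw [dotProduct_star_self, hψ₀, Complex.ofReal_one], rfl⟩ hE
  rw [dotProduct_star_self] at hψ
  exact ⟨ψ, by exact_mod_cast hψ, hlt⟩

/-- Product states have at least the ground-state energy. -/
theorem groundEnergy_le_productEnergy (hn : 0 < n) (hd : 0 < d) (hD : 0 < D)
    (hG : G.IsRegularOfDegree D)
    (hh : ∀ i j, i < j → G.Adj i j → (h i j).IsHermitian ∧ operatorNorm (h i j) ≤ 1)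
    {u : Fin n → Fin d → ℂ} (hu : ∀ k, sqNorm (u k) = 1) :
    groundEnergy (edgeHamiltonian D G h) ≤
      2 / ((n : ℝ) * D) * productEnergy (edgePairs G) h (fun i => rankOne (u i)) := by
  refine (groundEnergy_le hn hd hD hG hh (ψ := productVector u)
    (by simp [sqNorm_productVector, hu])).trans_eq ?_
  rw [edgeHamiltonian_expectation hd]
  congr 1
  refine Finset.sum_congr rfl fun e he => ?_
  rw [rdmTwo_productVector hd hu (mem_edgePairs.1 he).1.ne]

/-- Each normalized state carries one inverse norm and the weight of the outcome cancels one of the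
two. For the zero vector both sides vanish by the convention for division by zero. -/
theorem pairTrace_siteState (A : Matrix (Fin d × Fin d) (Fin d × Fin d) ℂ)
    (φ : (Fin n → Fin d) → ℂ) (i j : Fin n) :
    sqNorm φ * (pairTrace A (tensorTwo (siteState φ i) (siteState φ j))).re =
      (pairTrace A (tensorTwo (rdmOne φ i) (rdmOne φ j))).re / sqNorm φ := by
  have e : pairTrace A (tensorTwo (siteState φ i) (siteState φ j)) =
      (((sqNorm φ)⁻¹ * (sqNorm φ)⁻¹ : ℝ) : ℂ) *
        pairTrace A (tensorTwo (rdmOne φ i) (rdmOne φ j)) := by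
    simp only [pairTrace, tensorTwo, siteState, Finset.mul_sum]
    refine Finset.sum_congr rfl fun p _ => Finset.sum_congr rfl fun p' _ => ?_
    push_cast
    ring
  rw [e, Complex.re_ofReal_mul]
  by_cases h0 : sqNorm φ = 0
  · simp [h0]
  · field_simp

/-- On a regular graph of large degree, product states reach almost the ground-state energy. -/
theorem exists_productEnergy_le (hn : 0 < n) (hd : 0 < d) (hD : 0 < D)
    (hG : G.IsRegularOfDegree D)
    (hh : ∀ i j, i < j → G.Adj i j → (h i j).IsHermitian ∧ operatorNorm (h i j) ≤ 1)
    {ψ : (Fin n → Fin d) → ℂ} (hψ : sqNorm ψ = 1) {g : ℝ} (hg : 0 < g)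
    (hgD : (d : ℝ) ^ 2 * (1 - 1 / d) ≤ g ^ 3 * D) :
    ∃ u : Fin n → Fin d → ℂ, (∀ i, sqNorm (u i) = 1) ∧
      2 / ((n : ℝ) * D) * productEnergy (edgePairs G) h (fun i => rankOne (u i)) ≤
        (dotProduct (star ψ) ((edgeHamiltonian D G h).mulVec ψ)).re + 7 * g := by
  have hn' : (0 : ℝ) < n := by exact_mod_cast hn
  have hd' : (0 : ℝ) < d := by exact_mod_cast hd
  have hD' : (0 : ℝ) < D := by exact_mod_cast hD
  -- The strict bound `C.card < m` absorbs the rounding of the ceiling, so that `C.card ≤ g * n`,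
  -- while `m ≥ g * n` serves the bound on the gains.
  set m := ⌈g * n⌉₊ with hm
  have hm0 : 0 < m := Nat.ceil_pos.2 (by positivity)
  have hm0' : (0 : ℝ) < m := by exact_mod_cast hm0
  have hmg : g * n ≤ m := Nat.le_ceil _
  obtain ⟨X, _, φ, C, ⟨hφ1, hφ2⟩, hC, hgain⟩ := exists_decoupled hd hn ψ hψ hm0
  have hCg : (C.card : ℝ) ≤ g * n := by
    have h1 : (m : ℝ) < g * n + 1 := Nat.ceil_lt_add_one (by positivity)
    have h2 : (C.card : ℝ) + 1 ≤ m := by exact_mod_cast hC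
    linarith
  -- This choice makes the first error term of `correlation_bound`, $2d^2t$, equal to $2g$ per edge.
  set t : ℝ := g / (d : ℝ) ^ 2 with ht
  have ht0 : 0 < t := by positivity
  set V : Fin n × Fin n → ℝ := fun e => (pairTrace (h e.1 e.2) (rdmTwo ψ e.1 e.2)).re with hV
  set P : Fin n × Fin n → ℝ := fun e => ∑ x, sqNorm (φ x) *
    (pairTrace (h e.1 e.2) (tensorTwo (siteState (φ x) e.1) (siteState (φ x) e.2))).re with hP
  have hedge : ∀ e ∈ edgePairs G, P e ≤ V e + (if e.1 ∈ C ∨ e.2 ∈ C then 2 else 0) +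
      2 * (d : ℝ) ^ 2 * t + (∑ x, gain (φ x) e.1 e.2) / (2 * t) := by
    intro e he
    rw [mem_edgePairs] at he
    obtain ⟨hH, hN⟩ := hh _ _ he.1 he.2
    have hg0 : 0 ≤ ∑ x, gain (φ x) e.1 e.2 := Finset.sum_nonneg fun x _ => gain_nonneg hd _ _ _
    -- The ensemble reproduces ψ only on pairs of unmeasured sites. On the other edges both energies
    -- lie in $[-1,1]$, and the difference 2 is accepted.
    by_cases hc : e.1 ∈ C ∨ e.2 ∈ C
    · rw [if_pos hc]
      have h1 : P e ≤ 1 := by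
        rw [← hφ1]
        refine Finset.sum_le_sum fun x _ => ?_
        rcases (sqNorm_nonneg (φ x)).eq_or_lt with h0 | h0
        · simp [← h0]
        · refine mul_le_of_le_one_right h0.le ?_
          exact (abs_le.1 (abs_pairTrace_mixture_le hN (isMixture_siteState hd h0 _)
            (isMixture_siteState hd h0 _))).2
      have h2 : -1 ≤ V e := by
        have := abs_pairTrace_rdmTwo_le hd hN ψ e.1 e.2
        rw [hψ] at this
        exact (abs_le.1 this).1
      have h3 : 0 ≤ (∑ x, gain (φ x) e.1 e.2) / (2 * t) := by positivity
      have h4 : 0 ≤ 2 * (d : ℝ) ^ 2 * t := by positivity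
      linarith
    · rw [if_neg hc]
      rw [not_or] at hc
      have hVe : V e = ∑ x, (pairTrace (h e.1 e.2) (rdmTwo (φ x) e.1 e.2)).re := by
        rw [← Complex.re_sum]
        simp only [hV, pairTrace, ← hφ2 e.1 e.2 hc.1 hc.2, Finset.mul_sum]
        rw [Finset.sum_comm (s := (univ : Finset X))]
        congr 1
        refine Finset.sum_congr rfl fun p _ => ?_
        rw [Finset.sum_comm (s := (univ : Finset X))]
      have h1 : P e ≤ ∑ x, ((pairTrace (h e.1 e.2) (rdmTwo (φ x) e.1 e.2)).re +
          (2 * (d : ℝ) ^ 2 * t * sqNorm (φ x) + gain (φ x) e.1 e.2 / (2 * t))) := by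
        refine Finset.sum_le_sum fun x _ => ?_
        rw [pairTrace_siteState]
        have := correlation_bound hd (φ x) he.1.ne hH hN ht0
        linarith
      rw [Finset.sum_add_distrib, Finset.sum_add_distrib, ← Finset.mul_sum, hφ1, ← hVe,
        ← Finset.sum_div] at h1
      linarith
  have htotal : ∑ x, sqNorm (φ x) * productEnergy (edgePairs G) h (siteState (φ x)) ≤
      ∑ e ∈ edgePairs G, V e + 2 * (C.card * D) + (edgePairs G).card * (2 * (d : ℝ) ^ 2 * t) +
        (n : ℝ) ^ 2 * (1 - 1 / d) / m / (2 * t) := by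
    have h1 : ∑ x, sqNorm (φ x) * productEnergy (edgePairs G) h (siteState (φ x)) =
        ∑ e ∈ edgePairs G, P e := by
      simp only [productEnergy, hP, Finset.mul_sum]
      rw [Finset.sum_comm]
    rw [h1]
    refine (Finset.sum_le_sum hedge).trans ?_
    rw [Finset.sum_add_distrib, Finset.sum_add_distrib, Finset.sum_add_distrib, Finset.sum_const,
      nsmul_eq_mul, ← Finset.sum_filter, Finset.sum_const, nsmul_eq_mul, ← Finset.sum_div]
    have h2 : (((edgePairs G).filter fun e => e.1 ∈ C ∨ e.2 ∈ C).card : ℝ) ≤ C.card * D := by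
      exact_mod_cast card_touching_le hG C
    -- Gains are nonnegative, so the sum over the edges is bounded by the sum over all ordered
    -- pairs, however sparse the graph is.
    have h3 : ∑ e ∈ edgePairs G, ∑ x, gain (φ x) e.1 e.2 ≤ (n : ℝ) ^ 2 * (1 - 1 / d) / m := by
      refine le_trans (Finset.sum_le_sum_of_subset_of_nonneg (Finset.subset_univ _)
        fun e _ _ => Finset.sum_nonneg fun x _ => gain_nonneg hd _ _ _) (le_trans (le_of_eq ?_) hgain)
      rw [Finset.sum_comm]
      exact Finset.sum_congr rfl fun x _ => Fintype.sum_prod_type _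
    have h4 := div_le_div_of_nonneg_right h3 (by positivity : 0 ≤ 2 * t)
    linarith
  obtain ⟨x, hx, hle⟩ := exists_weight_le (fun x => sqNorm_nonneg (φ x)) hφ1 htotal
  obtain ⟨u, hu, hule⟩ := exists_pure_productEnergy_le (E := edgePairs G)
    (fun e he => (mem_edgePairs.1 he).1.ne) h (fun i => isMixture_siteState hd hx i)
  refine ⟨u, hu, ?_⟩
  have hc := two_div_mul_card_edgePairs hn hD hG
  rw [edgeHamiltonian_expectation hd]
  have hfin := mul_le_mul_of_nonneg_left (hule.trans hle)
    (by positivity : 0 ≤ 2 / ((n : ℝ) * D))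
  refine hfin.trans ?_
  -- The loss $7g$ consists of $4g$ for the abandoned edges, $2g$ for the term in `t`, and $g$ for
  -- the gains, where the hypothesis on $g^3D$ enters.
  have e1 : 2 / ((n : ℝ) * D) * (2 * (C.card * D)) ≤ 4 * g := by
    rw [show 2 / ((n : ℝ) * D) * (2 * (C.card * D)) = 4 * C.card / n by field_simp; ring,
      div_le_iff₀ hn']
    linarith
  have e2 : 2 / ((n : ℝ) * D) * ((edgePairs G).card * (2 * (d : ℝ) ^ 2 * t)) = 2 * g := by
    rw [← mul_assoc, hc, ht]
    field_simp
  have e3 : 2 / ((n : ℝ) * D) * ((n : ℝ) ^ 2 * (1 - 1 / d) / m / (2 * t)) ≤ g := by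
    have e4 : 2 / ((n : ℝ) * D) * ((n : ℝ) ^ 2 * (1 - 1 / d) / m / (2 * t)) =
        n * ((d : ℝ) ^ 2 * (1 - 1 / d)) / (D * m * g) := by
      rw [ht]
      field_simp
    rw [e4, div_le_iff₀ (by positivity)]
    calc n * ((d : ℝ) ^ 2 * (1 - 1 / d)) ≤ n * (g ^ 3 * D) :=
          mul_le_mul_of_nonneg_left hgD hn'.le
      _ = g ^ 2 * D * (g * n) := by ring
      _ ≤ g ^ 2 * D * m := mul_le_mul_of_nonneg_left hmg (by positivity)
      _ = g * (D * m * g) := by ring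
  rw [mul_add, mul_add, mul_add]
  linarith

end EnergyBounds

/-! ### The cost of expressions -/

section ExpressionCost

/-- A bound, in units of the largest stored number, for the number of digits of an expression. -/
def RamExpr.weight : RamExpr → ℕ
  | .const z => 1 + Nat.size z.natAbs
  | .load a => a.weight + 1
  | .add a b => a.weight + b.weight + 1
  | .sub a b => a.weight + b.weight + 1
  | .mul a b => a.weight + b.weight
  | .div a b => a.weight + b.weight
  | .intIn a => a.weight + 1
  | .bitIn a => a.weight + 1
  | .realIn a k => a.weight + k.weight + 3

/-- All precisions at which real numbers are read are at most `M`. -/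
def RamExpr.PrecisionLe (x : RamInput) (m : ℕ → ℤ) (M : ℕ) : RamExpr → Prop
  | .const _ => True
  | .load a => a.PrecisionLe x m M
  | .add a b => a.PrecisionLe x m M ∧ b.PrecisionLe x m M
  | .sub a b => a.PrecisionLe x m M ∧ b.PrecisionLe x m M
  | .mul a b => a.PrecisionLe x m M ∧ b.PrecisionLe x m M
  | .div a b => a.PrecisionLe x m M ∧ b.PrecisionLe x m M
  | .intIn a => a.PrecisionLe x m M
  | .bitIn a => a.PrecisionLe x m M
  | .realIn a k => a.PrecisionLe x m M ∧ k.PrecisionLe x m M ∧ (k.eval x m).toNat ≤ M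

/-- All memory cells hold numbers of at most `M` bits. -/
def MemBounded (M : ℕ) (m : ℕ → ℤ) : Prop := ∀ a, |m a| < 2 ^ M

/-- All integers of the input have at most `M` bits. -/
def IntsBounded (M : ℕ) (x : RamInput) : Prop := ∀ a, |x.ints.getD a 0| < 2 ^ M

theorem abs_fixedPoint_le (k : ℕ) (r : ℝ) : |fixedPoint k r| ≤ 4 ^ k := by
  have h4 : (0 : ℤ) ≤ 4 ^ k := by positivity
  rw [fixedPoint, abs_le]
  exact ⟨le_max_left _ _, max_le (by linarith) (min_le_left _ _)⟩

theorem RamExpr.weight_pos (e : RamExpr) : 0 < e.weight := by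
  induction e <;> simp only [RamExpr.weight] <;> omega

/-- Weights add under multiplication, as bit lengths do; a sum or difference gets one unit more, and
since `M` is positive this covers the carry. Loads and inputs are bounded whatever the address. -/
theorem RamExpr.abs_eval_lt {x : RamInput} {m : ℕ → ℤ} {M : ℕ} (hM : 0 < M)
    (hm : MemBounded M m) (hx : IntsBounded M x) (e : RamExpr) (he : e.PrecisionLe x m M) :
    |e.eval x m| < 2 ^ (e.weight * M) := by
  have mono : ∀ {a b : ℕ}, a ≤ b → (2 : ℤ) ^ (a * M) ≤ 2 ^ (b * M) := fun h =>
    pow_le_pow_right₀ (by norm_num) (Nat.mul_le_mul_right M h)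
  have step : ∀ (a b : ℕ), (2 : ℤ) ^ (a * M) + 2 ^ (b * M) ≤ 2 ^ ((a + b + 1) * M) := by
    intro a b
    have h1 : (2 : ℤ) ^ (a * M) ≤ 2 ^ ((a + b) * M) := mono (by omega)
    have h2 : (2 : ℤ) ^ (b * M) ≤ 2 ^ ((a + b) * M) := mono (by omega)
    have h3 : (2 : ℤ) ^ ((a + b) * M + 1) ≤ 2 ^ ((a + b + 1) * M) :=
      pow_le_pow_right₀ (by norm_num) (by nlinarith)
    rw [pow_succ] at h3
    linarith
  have one : (2 : ℤ) ^ M = 2 ^ (1 * M) := by rw [one_mul]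
  induction e with
  | const z =>
    simp only [RamExpr.eval, RamExpr.weight]
    have h1 : z.natAbs < 2 ^ Nat.size z.natAbs := Nat.lt_size_self _
    have h2 : (2 : ℤ) ^ Nat.size z.natAbs ≤ 2 ^ ((1 + Nat.size z.natAbs) * M) :=
      pow_le_pow_right₀ (by norm_num) (by nlinarith)
    refine lt_of_lt_of_le ?_ h2
    rw [Int.abs_eq_natAbs]
    exact_mod_cast h1
  | load a => exact (hm _).trans_le (one ▸ mono (by simp [RamExpr.weight]))
  | add a b iha ihb =>
    exact (abs_add_le _ _).trans_lt ((add_lt_add (iha he.1) (ihb he.2)).trans_le (step _ _))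
  | sub a b iha ihb =>
    exact (abs_sub _ _).trans_lt ((add_lt_add (iha he.1) (ihb he.2)).trans_le (step _ _))
  | mul a b iha ihb =>
    simp only [RamExpr.eval, RamExpr.weight]
    rw [abs_mul, add_mul, pow_add]
    exact mul_lt_mul'' (iha he.1) (ihb he.2) (abs_nonneg _) (abs_nonneg _)
  | div a b iha ihb =>
    exact (Int.abs_ediv_le_abs _ _).trans_lt
      ((iha he.1).trans_le (mono (by simp [RamExpr.weight])))
  | intIn a => exact (hx _).trans_le (one ▸ mono (by simp [RamExpr.weight]))
  | bitIn a =>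
    simp only [RamExpr.eval]
    have h1 : (1 : ℤ) < 2 ^ ((RamExpr.bitIn a).weight * M) :=
      one_lt_pow₀ (by norm_num) (Nat.mul_pos (RamExpr.weight_pos _) hM).ne'
    split_ifs
    · simpa using h1
    · simp
  | realIn a k =>
    refine (abs_fixedPoint_le _ _).trans_lt ?_
    rw [show (4 : ℤ) = 2 ^ 2 by norm_num, ← pow_mul]
    refine pow_lt_pow_right₀ (by norm_num) ?_
    have := he.2.2
    simp only [RamExpr.weight]
    nlinarith

/-- A coefficient that bounds the cost of an expression. -/
def RamExpr.coeff : RamExpr → ℕ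
  | .const z => 2 * (RamExpr.const z).weight
  | .load a => a.coeff + 2 * a.weight + 2 * (RamExpr.load a).weight
  | .add a b => a.coeff + b.coeff + 2 * a.weight + 2 * b.weight
  | .sub a b => a.coeff + b.coeff + 2 * a.weight + 2 * b.weight
  | .mul a b => a.coeff + b.coeff + 2 * a.weight * (2 * b.weight)
  | .div a b => a.coeff + b.coeff + 2 * a.weight * (2 * b.weight)
  | .intIn a => a.coeff + 2 * a.weight + 2 * (RamExpr.intIn a).weight
  | .bitIn a => a.coeff + 2 * a.weight + 1
  | .realIn a k => a.coeff + k.coeff + 2 * a.weight + 2 * k.weight + 3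

theorem wordCount_le {w M c : ℕ} (hw : 0 < w) (hc : 0 < c) {z : ℤ} (hz : |z| < 2 ^ (c * M)) :
    wordCount w z ≤ 2 * c * (1 + M / w) := by
  have h1 : Nat.size z.natAbs ≤ c * M := by
    rw [Nat.size_le]
    rw [Int.abs_eq_natAbs] at hz
    exact_mod_cast hz
  have h2 : Nat.size z.natAbs / w ≤ c * (1 + M / w) := by
    refine (Nat.div_le_div_right h1).trans ?_
    refine Nat.div_le_of_le_mul ?_
    have h3 : M ≤ w * (1 + M / w) := by
      have := Nat.div_add_mod M w
      have := Nat.mod_lt M hw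
      nlinarith
    calc c * M ≤ c * (w * (1 + M / w)) := Nat.mul_le_mul_left c h3
      _ = w * (c * (1 + M / w)) := by ring
  rw [wordCount]
  nlinarith [Nat.zero_le (M / w), Nat.mul_le_mul hc (Nat.le_add_right 1 (M / w))]

/-- Word counts are linear in `1 + M / w`; the square comes from multiplication and division, which
are charged the product of two word counts. -/
theorem RamExpr.cost_le {w : ℕ} (hw : 0 < w) {x : RamInput} {m : ℕ → ℤ} {M : ℕ} (hM : 0 < M)
    (hm : MemBounded M m) (hx : IntsBounded M x) (e : RamExpr) (he : e.PrecisionLe x m M) :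
    e.cost w x m ≤ e.coeff * (1 + M / w) ^ 2 := by
  set W := 1 + M / w with hW
  have hW1 : 1 ≤ W := Nat.le_add_right 1 _
  have hWW : W ≤ W ^ 2 := by nlinarith
  have hwc : ∀ e : RamExpr, e.PrecisionLe x m M →
      wordCount w (e.eval x m) ≤ 2 * e.weight * W := fun e he =>
    wordCount_le hw e.weight_pos (e.abs_eval_lt hM hm hx he)
  have hwc2 : ∀ e : RamExpr, e.PrecisionLe x m M →
      wordCount w (e.eval x m) ≤ 2 * e.weight * W ^ 2 := fun e he =>
    (hwc e he).trans (Nat.mul_le_mul_left _ hWW)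
  have hwm : ∀ a b : RamExpr, a.PrecisionLe x m M → b.PrecisionLe x m M →
      wordCount w (a.eval x m) * wordCount w (b.eval x m) ≤
        2 * a.weight * (2 * b.weight) * W ^ 2 := fun a b ha hb =>
    (Nat.mul_le_mul (hwc a ha) (hwc b hb)).trans_eq (by ring)
  induction e with
  | const z => exact hwc2 (.const z) he
  | load a iha =>
    have h1 := iha he
    have h2 := hwc2 a he
    have h3 := hwc2 (.load a) he
    simp only [RamExpr.cost, RamExpr.coeff, add_mul]
    omega
  | add a b iha ihb =>
    have h1 := iha he.1
    have h2 := ihb he.2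
    have h3 := hwc2 a he.1
    have h4 := hwc2 b he.2
    simp only [RamExpr.cost, RamExpr.coeff, add_mul]
    omega
  | sub a b iha ihb =>
    have h1 := iha he.1
    have h2 := ihb he.2
    have h3 := hwc2 a he.1
    have h4 := hwc2 b he.2
    simp only [RamExpr.cost, RamExpr.coeff, add_mul]
    omega
  | mul a b iha ihb =>
    have h1 := iha he.1
    have h2 := ihb he.2
    have h3 := hwm a b he.1 he.2
    rw [RamExpr.cost, RamExpr.coeff, add_mul, add_mul]
    omega
  | div a b iha ihb =>
    have h1 := iha he.1
    have h2 := ihb he.2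
    have h3 := hwm a b he.1 he.2
    rw [RamExpr.cost, RamExpr.coeff, add_mul, add_mul]
    omega
  | intIn a iha =>
    have h1 := iha he
    have h2 := hwc2 a he
    have h3 := hwc2 (.intIn a) he
    simp only [RamExpr.cost, RamExpr.coeff, add_mul]
    omega
  | bitIn a iha =>
    have h1 := iha he
    have h2 := hwc2 a he
    simp only [RamExpr.cost, RamExpr.coeff, add_mul]
    omega
  | realIn a k iha ihk =>
    have h1 := iha he.1
    have h2 := ihk he.2.1
    have h3 := hwc2 a he.1
    have h4 := hwc2 k he.2.1
    have h5 : 2 * (k.eval x m).toNat / w ≤ 2 * W := by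
      refine Nat.div_le_of_le_mul ?_
      have := he.2.2
      have := Nat.div_add_mod M w
      have := Nat.mod_lt M hw
      nlinarith
    simp only [RamExpr.cost, RamExpr.coeff, add_mul]
    omega

end ExpressionCost

/-! ### Total correctness with running times -/

section Running

/-- A coefficient that bounds the cost of every single step of a program. -/
def RamProg.coeff : RamProg → ℕ
  | .skip => 1
  | .assign a e => a.coeff + e.coeff + 2 * a.weight + 2 * e.weight
  | .seq p q => p.coeff + q.coeff
  | .ite e p q => e.coeff + 1 + p.coeff + q.coeff
  | .loop e p => e.coeff + 1 + p.coeff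

/-- From every bounded memory with `P`, the program halts after at most `s` steps, each of time
at most `U`, in a bounded memory with `Q`. -/
def RunsTo (w : ℕ) (x : RamInput) (M c : ℕ) (P : (ℕ → ℤ) → Prop) (p : RamProg)
    (Q : (ℕ → ℤ) → Prop) (s : ℕ) : Prop :=
  p.coeff ≤ c → ∀ m, MemBounded M m → P m → ∃ m' t, RamExec w x p m m' t ∧ MemBounded M m' ∧
    Q m' ∧ t ≤ c * (1 + M / w) ^ 2 * s

variable {w : ℕ} {x : RamInput} {M c : ℕ} {P Q R : (ℕ → ℤ) → Prop} {p q : RamProg} {s s' : ℕ}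

theorem RunsTo.weaken (h : RunsTo w x M c P p Q s) {P' Q' : (ℕ → ℤ) → Prop}
    (hP : ∀ m, P' m → P m) (hQ : ∀ m, Q m → Q' m) (hs : s ≤ s') : RunsTo w x M c P' p Q' s' := by
  intro hc m hm hPm
  obtain ⟨m', t, h1, h2, h3, h4⟩ := h hc m hm (hP m hPm)
  exact ⟨m', t, h1, h2, hQ m' h3, h4.trans (Nat.mul_le_mul_left _ hs)⟩

theorem RunsTo.skip (hPQ : ∀ m, P m → Q m) : RunsTo w x M c P .skip Q 1 := by
  intro hc m hm hP
  refine ⟨m, 1, .skip m, hm, hPQ m hP, ?_⟩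
  have : 0 < c * (1 + M / w) ^ 2 := Nat.mul_pos (lt_of_lt_of_le one_pos hc) (by positivity)
  omega

theorem MemBounded.update {m : ℕ → ℤ} (hm : MemBounded M m) (a : ℕ) {v : ℤ} (hv : |v| < 2 ^ M) :
    MemBounded M (Function.update m a v) := by
  intro b
  by_cases h : b = a
  · subst h; rwa [Function.update_self]
  · rw [Function.update_of_ne h]; exact hm b

theorem RunsTo.assign (hw : 0 < w) (hM : 0 < M) (hx : IntsBounded M x) {a e : RamExpr}
    (ha : ∀ m, P m → a.PrecisionLe x m M) (he : ∀ m, P m → e.PrecisionLe x m M)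
    (hv : ∀ m, P m → |e.eval x m| < 2 ^ M)
    (hQ : ∀ m, P m → Q (Function.update m (a.eval x m).toNat (e.eval x m))) :
    RunsTo w x M c P (.assign a e) Q 1 := by
  intro hc m hm hP
  refine ⟨_, _, .assign a e m, hm.update _ (hv m hP), hQ m hP, ?_⟩
  rw [mul_one]
  refine le_trans ?_ (Nat.mul_le_mul_right _ hc)
  have h1 := a.cost_le hw hM hm hx (ha m hP)
  have h2 := e.cost_le hw hM hm hx (he m hP)
  have hWW : 1 + M / w ≤ (1 + M / w) ^ 2 := by nlinarith [Nat.zero_le (M / w)]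
  have h3 := (wordCount_le hw a.weight_pos (a.abs_eval_lt hM hm hx (ha m hP))).trans
    (Nat.mul_le_mul_left _ hWW)
  have h4 := (wordCount_le hw e.weight_pos (e.abs_eval_lt hM hm hx (he m hP))).trans
    (Nat.mul_le_mul_left _ hWW)
  simp only [RamProg.coeff, add_mul]
  omega

/-- The premise `p.coeff ≤ c` inside `RunsTo` lets one constant, that of the whole program, price
the steps of every subprogram, so step counts simply add. -/
theorem RunsTo.seq (hp : RunsTo w x M c P p Q s) (hq : RunsTo w x M c Q q R s') :
    RunsTo w x M c P (.seq p q) R (s + s') := by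
  intro hc m hm hP
  simp only [RamProg.coeff] at hc
  obtain ⟨m', t, h1, h2, h3, h4⟩ := hp (by omega) m hm hP
  obtain ⟨m'', t', h1', h2', h3', h4'⟩ := hq (by omega) m' h2 h3
  exact ⟨m'', _, .seq h1 h1', h2', h3', by rw [mul_add]; omega⟩

theorem test_cost_le (hw : 0 < w) (hM : 0 < M) (hx : IntsBounded M x) {m : ℕ → ℤ}
    (hm : MemBounded M m) {e : RamExpr} (he : e.PrecisionLe x m M) (hc : e.coeff + 1 ≤ c) :
    e.cost w x m + 1 ≤ c * (1 + M / w) ^ 2 := by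
  have h1 := e.cost_le hw hM hm hx he
  have h2 := Nat.mul_le_mul_right ((1 + M / w) ^ 2) hc
  have h3 : 0 < (1 + M / w) ^ 2 := by positivity
  rw [add_mul, one_mul] at h2
  omega

theorem RunsTo.ite (hw : 0 < w) (hM : 0 < M) (hx : IntsBounded M x) {e : RamExpr}
    (he : ∀ m, P m → e.PrecisionLe x m M)
    (hp : RunsTo w x M c (fun m => P m ∧ 0 < e.eval x m) p Q s)
    (hq : RunsTo w x M c (fun m => P m ∧ ¬ 0 < e.eval x m) q Q s) :
    RunsTo w x M c P (.ite e p q) Q (1 + s) := by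
  intro hc m hm hP
  simp only [RamProg.coeff] at hc
  have h0 := test_cost_le (c := c) hw hM hx hm (he m hP) (by omega)
  by_cases h : 0 < e.eval x m
  · obtain ⟨m', t, h1, h2, h3, h4⟩ := hp (by omega) m hm ⟨hP, h⟩
    exact ⟨m', _, .iteTrue h h1, h2, h3, by rw [mul_add]; omega⟩
  · obtain ⟨m', t, h1, h2, h3, h4⟩ := hq (by omega) m hm ⟨hP, h⟩
    exact ⟨m', _, .iteFalse h h1, h2, h3, by rw [mul_add]; omega⟩

/-- A loop that is left after exactly `N` rounds. -/
theorem RunsTo.loop (hw : 0 < w) (hM : 0 < M) (hx : IntsBounded M x) {e : RamExpr}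
    (I : ℕ → (ℕ → ℤ) → Prop) (N : ℕ) (he : ∀ k ≤ N, ∀ m, I k m → e.PrecisionLe x m M)
    (hlt : ∀ k < N, ∀ m, I k m → 0 < e.eval x m) (hN : ∀ m, I N m → ¬ 0 < e.eval x m)
    (hp : ∀ k < N, RunsTo w x M c (I k) p (I (k + 1)) s) :
    RunsTo w x M c (I 0) (.loop e p) (I N) (N * (1 + s) + 1) := by
  intro hc
  have hc' : e.coeff + 1 + p.coeff ≤ c := hc
  -- Induction on the number `j` of remaining rounds, for an arbitrary current round `k`.
  have claim : ∀ j k, k + j = N → ∀ m, MemBounded M m → I k m → ∃ m' t,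
      RamExec w x (.loop e p) m m' t ∧ MemBounded M m' ∧ I N m' ∧
        t ≤ c * (1 + M / w) ^ 2 * (j * (1 + s) + 1) := by
    intro j
    induction j with
    | zero =>
      intro k hk m hm hI
      obtain rfl : k = N := by omega
      have h0 := test_cost_le (c := c) hw hM hx hm (he k le_rfl m hI) (by omega)
      exact ⟨m, _, .loopFalse (hN m hI), hm, hI, by simpa using h0⟩
    | succ j ih =>
      intro k hk m hm hI
      have h0 := test_cost_le (c := c) hw hM hx hm (he k (by omega) m hI) (by omega)
      obtain ⟨m', t, h1, h2, h3, h4⟩ := hp k (by omega) (by omega) m hm hI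
      obtain ⟨m'', t', h1', h2', h3', h4'⟩ := ih (k + 1) (by omega) m' h2 h3
      refine ⟨m'', _, .loopTrue (hlt k (by omega) m hI) h1 h1', h2', h3', ?_⟩
      calc e.cost w x m + 1 + t + t' ≤ c * (1 + M / w) ^ 2 + c * (1 + M / w) ^ 2 * s +
            c * (1 + M / w) ^ 2 * (j * (1 + s) + 1) := by omega
        _ = _ := by ring
  intro m hm hI
  exact claim N 0 (by omega) m hm hI

/-- The loop in which cell `v` counts up to the value of `b`. -/
def RamProg.forLoop (v : ℕ) (b : RamExpr) (p : RamProg) : RamProg :=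
  .loop (.sub b (.load (.const v))) (.seq p (.assign (.const v) (.add (.load (.const v)) (.const 1))))

/-- The body must preserve the counter and establish the next invariant for the memory after the
increment, hence the `Function.update` in its postcondition. -/
theorem RunsTo.forLoop (hw : 0 < w) (hM : 0 < M) (hx : IntsBounded M x) {v : ℕ} {b : RamExpr}
    (I : ℕ → (ℕ → ℤ) → Prop) (N : ℕ) (hNM : (N : ℤ) < 2 ^ M)
    (hv : ∀ k ≤ N, ∀ m, I k m → m v = k) (hb : ∀ k ≤ N, ∀ m, I k m → b.eval x m = N)
    (hbs : ∀ k ≤ N, ∀ m, I k m → b.PrecisionLe x m M)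
    (hp : ∀ k < N, RunsTo w x M c (I k) p
      (fun m => m v = k ∧ I (k + 1) (Function.update m v (k + 1))) s) :
    RunsTo w x M c (I 0) (.forLoop v b p) (I N) (N * (s + 2) + 1) := by
  have key : RunsTo w x M c (I 0) (.forLoop v b p) (I N) (N * (1 + (s + 1)) + 1) := by
    refine RunsTo.loop hw hM hx I N ?_ ?_ ?_ ?_
    · intro k hk m hI
      exact ⟨hbs k hk m hI, trivial⟩
    · intro k hk m hI
      simp only [RamExpr.eval, Int.toNat_natCast, hb k hk.le m hI, hv k hk.le m hI]
      omega
    · intro m hI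
      simp [RamExpr.eval, hb N le_rfl m hI, hv N le_rfl m hI]
    · intro k hk
      refine (hp k hk).seq (RunsTo.assign hw hM hx ?_ ?_ ?_ ?_)
      · intro m _; trivial
      · intro m _; exact ⟨trivial, trivial⟩
      · rintro m ⟨h1, -⟩
        simp only [RamExpr.eval, Int.toNat_natCast, h1]
        rw [abs_of_nonneg (by positivity)]
        exact lt_of_le_of_lt (by exact_mod_cast hk) hNM
      · rintro m ⟨h1, h2⟩
        simpa [RamExpr.eval, h1] using h2
  exact key.weaken (fun _ h => h) (fun _ h => h) (by ring_nf; rfl)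

end Running

/-! ### The verifier -/

section Program

namespace Verifier

/-- The content of cell `k`. -/
abbrev cell (k : ℕ) : RamExpr := .load (.const k)

abbrev sites : RamExpr := .intIn (.const 0)

abbrev levels : RamExpr := .intIn (.const 1)

abbrev degree : RamExpr := .intIn (.const 2)

/-- The fourth power of an expression. -/
def fourth (e : RamExpr) : RamExpr := .mul (.mul e e) (.mul e e)

/-- Remainder. -/
def modulo (a b : RamExpr) : RamExpr := .sub a (.mul b (.div a b))

/-- The amplitude with the given index, in units of the inverse of cell 2. -/
def amplitude (i : RamExpr) : RamExpr :=
  .sub (.mul (.const 2) (.load (.add (.const 8) i))) (cell 2)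

/-- Cell 1 becomes the precision `k`, cell 2 becomes `2 ^ k`. -/
def findPrecision : RamProg :=
  .seq (.assign (.const 2) (.const 1))
    (.loop (.sub (.mul (.const 4096) (fourth levels)) (.realIn (.const 2) (cell 1)))
      (.seq (.assign (.const 1) (.add (cell 1) (.const 1)))
        (.assign (.const 2) (.add (cell 2) (cell 2)))))

/-- The amplitudes are read from the witness and stored from cell 8 on. -/
def readAmplitudes : RamProg :=
  .forLoop 3 (.mul (.mul (.const 2) (.mul sites levels)) (cell 1))
    (.assign (.add (.const 8) (.div (cell 3) (cell 1)))
      (.add (.mul (.const 2) (.load (.add (.const 8) (.div (cell 3) (cell 1)))))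
        (.bitIn (cell 3))))

/-- Cell 4 becomes the squared norm of the vector of the site in cell 3. -/
def siteNorm : RamProg :=
  .seq (.assign (.const 4) (.const 0)) (.seq (.assign (.const 7) (.const 0))
    (.forLoop 7 (.mul (.const 2) levels)
      (.assign (.const 4) (.add (cell 4)
        (.mul (amplitude (.add (.mul (.mul (.const 2) levels) (cell 3)) (cell 7)))
          (amplitude (.add (.mul (.mul (.const 2) levels) (cell 3)) (cell 7))))))))

/-- Positive if the norm in cell 4 is too far from one. -/
def normTest : RamExpr :=
  .sub (.mul (.sub (cell 4) (.mul (cell 2) (cell 2))) (.sub (cell 4) (.mul (cell 2) (cell 2))))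
    (.mul (.mul (.mul (.const 8) levels) (cell 2)) (.mul (.mul (.const 8) levels) (cell 2)))

/-- Cell 6 becomes positive if some site has a vector whose norm is too far from one. -/
def checkNorms : RamProg :=
  .seq (.assign (.const 3) (.const 0))
    (.forLoop 3 sites (.seq siteNorm (.ite normTest (.assign (.const 6) (.const 1)) .skip)))

/-- The digits of the index in cell 3 to the base `d`. -/
def shift : ℕ → RamExpr
  | 0 => cell 3
  | k + 1 => .div (shift k) levels

/-- The index of the pair of amplitudes for an end point (the first or the second) of the current
edge and a digit of the index in cell 3. -/
def slot (side : ℤ) (k : ℕ) : RamExpr :=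
  .mul (.const 2) (.add
    (.mul (.intIn (.add (.const (3 + side)) (.mul (.const 2) (shift 4)))) levels)
    (modulo (shift k) levels))

/-- Real part of the product of the amplitudes in the given slots. -/
def prodRe (i j : RamExpr) : RamExpr :=
  .sub (.mul (amplitude i) (amplitude j))
    (.mul (amplitude (.add i (.const 1))) (amplitude (.add j (.const 1))))

/-- Imaginary part of the product of the amplitudes in the given slots. -/
def prodIm (i j : RamExpr) : RamExpr :=
  .add (.mul (amplitude i) (amplitude (.add j (.const 1))))
    (.mul (amplitude (.add i (.const 1))) (amplitude j))

/-- Digits 3 and 2 of the entry index are the row $(a,b)$, digits 1 and 0 the column $(a',b')$; an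
entry multiplies the column product by the conjugate of the row product. -/
def rowRe : RamExpr := prodRe (slot 0 3) (slot 1 2)
def rowIm : RamExpr := prodIm (slot 0 3) (slot 1 2)
def colRe : RamExpr := prodRe (slot 0 1) (slot 1 0)
def colIm : RamExpr := prodIm (slot 0 1) (slot 1 0)

/-- The contribution to the energy of the matrix entry with the index in cell 3. -/
def term : RamExpr :=
  .sub (.mul (.add (.mul rowRe colRe) (.mul rowIm colIm))
      (.realIn (.add (.const 3) (.mul (.const 2) (cell 3))) (cell 1)))
    (.mul (.sub (.mul rowRe colIm) (.mul rowIm colRe))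
      (.realIn (.add (.const 4) (.mul (.const 2) (cell 3))) (cell 1)))

/-- Cell 5 becomes the energy. -/
def addEnergies : RamProg :=
  .seq (.assign (.const 3) (.const 0))
    (.forLoop 3 (.mul (.div (.mul sites degree) (.const 2)) (fourth levels))
      (.assign (.const 5) (.add (cell 5) term)))

/-- Positive if the energy is below the threshold. -/
def energyTest : RamExpr :=
  .sub (.add (.mul (.mul (.mul sites degree) (fourth (cell 2)))
      (.sub (.mul (.const 2) (.realIn (.const 1) (cell 1))) (.realIn (.const 2) (cell 1))))
    (.const 1)) (.mul (.const 4) (cell 5))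

/-- A raised flag leaves the output cell at its initial value 0, which means rejection. -/
def decideEnergy : RamProg :=
  .ite (cell 6) .skip (.ite energyTest (.assign (.const 0) (.const 1)) .skip)

/-- If there are more sites than levels, the witness is a product state whose energy is estimated;
otherwise the gap is so large that the threshold decides. -/
def program : RamProg :=
  .ite (.sub sites levels)
    (.seq findPrecision (.seq readAmplitudes (.seq checkNorms (.seq addEnergies decideEnergy))))
    (.ite (.sub (.realIn (.const 1) (.const 3)) (.const 8)) (.assign (.const 0) (.const 1)) .skip)

/-! #### What the verifier computes -/

/-- The number written by `l` bits from position `s` on. -/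
def bitValue (b : ℕ → Bool) (s : ℕ) : ℕ → ℤ
  | 0 => 0
  | l + 1 => 2 * bitValue b s l + if b (s + l) then 1 else 0

theorem bitValue_nonneg (b : ℕ → Bool) (s l : ℕ) : 0 ≤ bitValue b s l := by
  induction l with
  | zero => simp [bitValue]
  | succ l ih => simp only [bitValue]; split_ifs <;> omega

theorem bitValue_lt (b : ℕ → Bool) (s l : ℕ) : bitValue b s l < 2 ^ l := by
  induction l with
  | zero => simp [bitValue]
  | succ l ih => simp only [bitValue, pow_succ]; split_ifs <;> omega

/-- The data that the verifier reads. -/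
structure Data where
  n : ℕ
  d : ℕ
  D : ℕ
  vertex : ℕ → ℕ
  real : ℕ → ℝ
  bit : ℕ → Bool

/-- `x` presents the data `y`. -/
structure Data.Reads (y : Data) (x : RamInput) : Prop where
  n_eq : x.ints.getD 0 0 = y.n
  d_eq : x.ints.getD 1 0 = y.d
  D_eq : x.ints.getD 2 0 = y.D
  vertex_eq : ∀ a, x.ints.getD (3 + a) 0 = y.vertex a
  real_eq : ∀ a, x.reals.getD a 0 = y.real a
  bit_eq : ∀ a, x.bits.getD a false = y.bit a

variable (y : Data) (K : ℕ)

/-- The content of memory cell `8 + q` after `c` bits were read. -/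
def Data.partialRaw (c q : ℕ) : ℤ := bitValue y.bit (q * K) (min K (c - q * K))

/-- In units of $2^{-K}$: the $K$-bit number $r$ stands for the real number $2r/2^K - 1$ in
$[-1,1)$. -/
def Data.amp (q : ℕ) : ℤ := 2 * y.partialRaw K (2 * (y.n * y.d) * K) q - 2 ^ K

def Data.normSum (i r : ℕ) : ℤ := ∑ a ∈ Finset.range r, y.amp K (2 * y.d * i + a) ^ 2

/-- Squares are compared in order to avoid an absolute value; after division by powers of $2^K$ the
tolerance for the squared norm is $8d/2^K$. -/
def Data.NormBad (i : ℕ) : Prop :=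
  0 < (y.normSum K i (2 * y.d) - 2 ^ K * 2 ^ K) ^ 2 - (8 * y.d * 2 ^ K) ^ 2

/-- The entry index has the number of the edge in front of four digits to the base `d`. The factor 2
is there because real and imaginary parts are stored next to each other. -/
def Data.slot (side t k : ℕ) : ℕ :=
  2 * (y.vertex (side + 2 * (t / y.d ^ 4)) * y.d + t / y.d ^ k % y.d)

def Data.prodRe (i j : ℕ) : ℤ :=
  y.amp K i * y.amp K j - y.amp K (i + 1) * y.amp K (j + 1)

def Data.prodIm (i j : ℕ) : ℤ :=
  y.amp K i * y.amp K (j + 1) + y.amp K (i + 1) * y.amp K j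

/-- Together with `Data.weightIm`, the complex number $\overline{\mathrm{row}}\cdot\mathrm{column}$
in units of $2^{-4K}$. -/
def Data.weightRe (t : ℕ) : ℤ :=
  y.prodRe K (y.slot 0 t 3) (y.slot 1 t 2) * y.prodRe K (y.slot 0 t 1) (y.slot 1 t 0) +
    y.prodIm K (y.slot 0 t 3) (y.slot 1 t 2) * y.prodIm K (y.slot 0 t 1) (y.slot 1 t 0)

def Data.weightIm (t : ℕ) : ℤ :=
  y.prodRe K (y.slot 0 t 3) (y.slot 1 t 2) * y.prodIm K (y.slot 0 t 1) (y.slot 1 t 0) -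
    y.prodIm K (y.slot 0 t 3) (y.slot 1 t 2) * y.prodRe K (y.slot 0 t 1) (y.slot 1 t 0)

noncomputable def Data.term (t : ℕ) : ℤ :=
  y.weightRe K t * fixedPoint K (y.real (3 + 2 * t)) -
    y.weightIm K t * fixedPoint K (y.real (4 + 2 * t))

noncomputable def Data.energySum (N : ℕ) : ℤ := ∑ t ∈ Finset.range N, y.term K t

def Data.entries : ℕ := y.n * y.D / 2 * y.d ^ 4

/-- The criterion for acceptance if there are more sites than levels. -/
def Data.Good : Prop := (∀ i < y.n, ¬ y.NormBad K i) ∧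
  0 < y.n * y.D * (2 ^ K) ^ 4 * (2 * fixedPoint K (y.real 1) - fixedPoint K (y.real 2)) + 1 -
    4 * y.energySum K y.entries

/-! #### Bounds -/

theorem Data.partialRaw_nonneg (c q : ℕ) : 0 ≤ y.partialRaw K c q := bitValue_nonneg _ _ _

theorem Data.partialRaw_lt (c q : ℕ) : y.partialRaw K c q < 2 ^ K :=
  (bitValue_lt _ _ _).trans_le (pow_le_pow_right₀ (by norm_num) (min_le_left _ _))

theorem Data.abs_amp_le (q : ℕ) : |y.amp K q| ≤ 2 ^ K := by
  have h1 := y.partialRaw_nonneg K (2 * (y.n * y.d) * K) q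
  have h2 := y.partialRaw_lt K (2 * (y.n * y.d) * K) q
  rw [Data.amp, abs_le]
  constructor <;> linarith

theorem Data.normSum_nonneg (i r : ℕ) : 0 ≤ y.normSum K i r :=
  Finset.sum_nonneg fun _ _ => sq_nonneg _

theorem Data.normSum_le (i r : ℕ) : y.normSum K i r ≤ r * (2 ^ K) ^ 2 := by
  calc y.normSum K i r ≤ ∑ _a ∈ Finset.range r, (2 ^ K : ℤ) ^ 2 :=
        Finset.sum_le_sum fun a _ => by
          rw [← sq_abs]; exact pow_le_pow_left₀ (abs_nonneg _) (y.abs_amp_le K _) 2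
    _ = _ := by simp

theorem Data.abs_prodRe_le (i j : ℕ) : |y.prodRe K i j| ≤ 2 * (2 ^ K) ^ 2 := by
  have h : ∀ a b, |y.amp K a * y.amp K b| ≤ (2 ^ K) ^ 2 := fun a b => by
    rw [abs_mul, sq]
    exact mul_le_mul (y.abs_amp_le K a) (y.abs_amp_le K b) (abs_nonneg _) (by positivity)
  refine (abs_sub _ _).trans ?_
  linarith [h i j, h (i + 1) (j + 1)]

theorem Data.abs_prodIm_le (i j : ℕ) : |y.prodIm K i j| ≤ 2 * (2 ^ K) ^ 2 := by
  have h : ∀ a b, |y.amp K a * y.amp K b| ≤ (2 ^ K) ^ 2 := fun a b => by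
    rw [abs_mul, sq]
    exact mul_le_mul (y.abs_amp_le K a) (y.abs_amp_le K b) (abs_nonneg _) (by positivity)
  refine (abs_add_le _ _).trans ?_
  linarith [h i (j + 1), h (i + 1) j]

theorem abs_mul_le_of_le {a b A B : ℤ} (ha : |a| ≤ A) (hb : |b| ≤ B) : |a * b| ≤ A * B := by
  rw [abs_mul]
  exact mul_le_mul ha hb (abs_nonneg _) ((abs_nonneg _).trans ha)

theorem Data.abs_weightRe_le (t : ℕ) : |y.weightRe K t| ≤ 8 * (2 ^ K) ^ 4 := by
  refine (abs_add_le _ _).trans ?_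
  have h1 := abs_mul_le_of_le (y.abs_prodRe_le K (y.slot 0 t 3) (y.slot 1 t 2))
    (y.abs_prodRe_le K (y.slot 0 t 1) (y.slot 1 t 0))
  have h2 := abs_mul_le_of_le (y.abs_prodIm_le K (y.slot 0 t 3) (y.slot 1 t 2))
    (y.abs_prodIm_le K (y.slot 0 t 1) (y.slot 1 t 0))
  linarith [h1, h2]

theorem Data.abs_weightIm_le (t : ℕ) : |y.weightIm K t| ≤ 8 * (2 ^ K) ^ 4 := by
  refine (abs_sub _ _).trans ?_
  have h1 := abs_mul_le_of_le (y.abs_prodRe_le K (y.slot 0 t 3) (y.slot 1 t 2))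
    (y.abs_prodIm_le K (y.slot 0 t 1) (y.slot 1 t 0))
  have h2 := abs_mul_le_of_le (y.abs_prodIm_le K (y.slot 0 t 3) (y.slot 1 t 2))
    (y.abs_prodRe_le K (y.slot 0 t 1) (y.slot 1 t 0))
  linarith [h1, h2]

/-- Four amplitudes give the fourth power of $2^K$; the remaining two come from the saturation bound
$4^K$ for a real input, since the entries are arbitrary here. -/
theorem Data.abs_term_le (t : ℕ) : |y.term K t| ≤ 16 * (2 ^ K) ^ 6 := by
  refine (abs_sub _ _).trans ?_
  have h1 := abs_mul_le_of_le (y.abs_weightRe_le K t) (abs_fixedPoint_le K (y.real (3 + 2 * t)))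
  have h2 := abs_mul_le_of_le (y.abs_weightIm_le K t) (abs_fixedPoint_le K (y.real (4 + 2 * t)))
  have e : (4 : ℤ) ^ K = (2 ^ K) ^ 2 := by rw [← pow_mul, mul_comm, pow_mul]; norm_num
  rw [e] at h1 h2
  calc _ ≤ _ := add_le_add h1 h2
    _ = _ := by ring

theorem Data.abs_energySum_le (N : ℕ) : |y.energySum K N| ≤ N * (16 * (2 ^ K) ^ 6) := by
  calc |y.energySum K N| ≤ ∑ _t ∈ Finset.range N, 16 * (2 ^ K : ℤ) ^ 6 :=
        (Finset.abs_sum_le_sum_abs _ _).trans (Finset.sum_le_sum fun t _ => y.abs_term_le K t)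
    _ = _ := by simp

end Verifier

end Program

/-! ### Correctness of the verifier -/

section Execution

namespace Verifier

open Function

/-- Sufficient conditions for the numbers in memory to have at most `M` bits. -/
structure Fits (y : Data) (K M : ℕ) : Prop where
  precision : K < M
  read : 2 * (y.n * y.d) * K < 2 ^ M
  sites : y.n < 2 ^ M
  norm : 2 * y.d * (2 ^ K) ^ 2 < 2 ^ M
  entries : y.entries < 2 ^ M
  energy : y.entries * (16 * (2 ^ K) ^ 6) < 2 ^ M

variable {w M c K : ℕ} {x : RamInput} {y : Data}

theorem eval_cell (m : ℕ → ℤ) (k : ℕ) : (cell k).eval x m = m k := rfl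

theorem Data.Reads.eval_sites (hR : y.Reads x) (m : ℕ → ℤ) : sites.eval x m = y.n := hR.n_eq

theorem Data.Reads.eval_levels (hR : y.Reads x) (m : ℕ → ℤ) : levels.eval x m = y.d := hR.d_eq

theorem Data.Reads.eval_degree (hR : y.Reads x) (m : ℕ → ℤ) : degree.eval x m = y.D := hR.D_eq

theorem eval_fourth (e : RamExpr) (m : ℕ → ℤ) : (fourth e).eval x m = e.eval x m ^ 4 := by
  simp only [fourth, RamExpr.eval]; ring

theorem precisionLe_amplitude {m : ℕ → ℤ} {i : RamExpr} (h : i.PrecisionLe x m M) :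
    (amplitude i).PrecisionLe x m M := by
  simpa [amplitude, RamExpr.PrecisionLe] using h

theorem runsTo_findPrecision (hw : 0 < w) (hM : 0 < M) (hx : IntsBounded M x) (hR : y.Reads x)
    (hF : Fits y K M) (hK : 4096 * (y.d : ℤ) ^ 4 ≤ fixedPoint K (y.real 2))
    (hK' : ∀ k < K, fixedPoint k (y.real 2) < 4096 * (y.d : ℤ) ^ 4) :
    RunsTo w x M c (fun m => m = fun _ => 0) findPrecision
      (fun m => m 1 = K ∧ m 2 = 2 ^ K ∧ ∀ a, a ≠ 1 → a ≠ 2 → m a = 0) (1 + (K * (1 + 2) + 1)) := by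
  have hKM := hF.precision
  have h1M : (1 : ℤ) < 2 ^ M := one_lt_pow₀ (by norm_num) hM.ne'
  have hval : ∀ k : ℕ, ∀ m : ℕ → ℤ, m 1 = k →
      (RamExpr.sub (.mul (.const 4096) (fourth levels)) (.realIn (.const 2) (cell 1))).eval x m =
        4096 * (y.d : ℤ) ^ 4 - fixedPoint k (y.real 2) := by
    intro k m hm
    rw [← hR.real_eq 2]
    simp only [RamExpr.eval, eval_fourth]
    rw [show x.ints.getD (Int.toNat 1) 0 = y.d from hR.d_eq,
      show m (Int.toNat ((1 : ℕ) : ℤ)) = k from hm, Int.toNat_natCast]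
    rfl
  refine RunsTo.seq (Q := fun m => m 1 = (0 : ℕ) ∧ m 2 = 2 ^ 0 ∧ ∀ a, a ≠ 1 → a ≠ 2 → m a = 0)
    (RunsTo.assign hw hM hx ?_ ?_ ?_ ?_) (RunsTo.loop hw hM hx
      (fun k m => m 1 = k ∧ m 2 = 2 ^ k ∧ ∀ a, a ≠ 1 → a ≠ 2 → m a = 0) K ?_ ?_ ?_ ?_)
  · intro m _; trivial
  · intro m _; trivial
  · intro m _; simpa [RamExpr.eval] using h1M
  · rintro m rfl
    refine ⟨by simp [RamExpr.eval], by simp [RamExpr.eval], fun a h1 h2 => ?_⟩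
    simp [RamExpr.eval, update_of_ne h2]
  · rintro k hk m ⟨h1, -⟩
    refine ⟨⟨trivial, by simp [fourth, RamExpr.PrecisionLe]⟩, trivial, trivial, ?_⟩
    rw [eval_cell, h1, Int.toNat_natCast]
    omega
  · rintro k hk m ⟨h1, -⟩
    rw [hval k m h1]
    have := hK' k hk
    omega
  · rintro m ⟨h1, -⟩
    rw [hval K m h1]
    omega
  · intro k hk
    refine RunsTo.seq (s := 1) (s' := 1)
      (Q := fun m => m 1 = ((k + 1 : ℕ) : ℤ) ∧ m 2 = 2 ^ k ∧ ∀ a, a ≠ 1 → a ≠ 2 → m a = 0)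
      (RunsTo.assign hw hM hx ?_ ?_ ?_ ?_) (RunsTo.assign hw hM hx ?_ ?_ ?_ ?_)
    · intro m _; trivial
    · intro m _; exact ⟨trivial, trivial⟩
    · rintro m ⟨h1, -⟩
      simp only [RamExpr.eval]
      rw [show m (Int.toNat ((1 : ℕ) : ℤ)) = k from h1, abs_of_nonneg (by positivity)]
      have h2 : M < 2 ^ M := Nat.lt_two_pow_self
      have h3 : (M : ℤ) < 2 ^ M := by exact_mod_cast h2
      omega
    · rintro m ⟨h1, h2, h3⟩
      refine ⟨by simp [RamExpr.eval, h1], by simp [RamExpr.eval, h2], fun a ha ha' => ?_⟩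
      simp [RamExpr.eval, update_of_ne ha, h3 a ha ha']
    · intro m _; trivial
    · intro m _; exact ⟨trivial, trivial⟩
    · rintro m ⟨-, h2, -⟩
      simp only [RamExpr.eval]
      rw [show m (Int.toNat ((2 : ℕ) : ℤ)) = 2 ^ k from h2, ← two_mul, ← pow_succ',
        abs_of_nonneg (by positivity)]
      exact pow_lt_pow_right₀ (by norm_num) (by omega)
    · rintro m ⟨h1, h2, h3⟩
      refine ⟨by simp [RamExpr.eval, h1], by simp [RamExpr.eval, h2, pow_succ, mul_two],
        fun a ha ha' => ?_⟩
      simp [RamExpr.eval, update_of_ne ha', h3 a ha ha']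

/-- The memory while the witness is read. -/
structure Reading (y : Data) (K c : ℕ) (m : ℕ → ℤ) : Prop where
  precision : m 1 = K
  scale : m 2 = 2 ^ K
  counter : m 3 = c
  rest : ∀ a, a = 0 ∨ (4 ≤ a ∧ a < 8) → m a = 0
  raw : ∀ q, m (q + 8) = y.partialRaw K c q

theorem Data.partialRaw_zero (q : ℕ) : y.partialRaw K 0 q = 0 := by
  simp [Data.partialRaw, bitValue]

theorem Data.partialRaw_succ_self (hK : 0 < K) (k : ℕ) :
    y.partialRaw K (k + 1) (k / K) =
      2 * y.partialRaw K k (k / K) + if y.bit k then 1 else 0 := by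
  have h1 := Nat.div_add_mod k K
  have h2 := Nat.mod_lt k hK
  have h3 : k / K * K = K * (k / K) := mul_comm _ _
  have e1 : min K (k - k / K * K) = k % K := by omega
  have e2 : min K (k + 1 - k / K * K) = k % K + 1 := by omega
  rw [Data.partialRaw, Data.partialRaw, e1, e2, bitValue, show k / K * K + k % K = k by omega]

theorem Data.partialRaw_succ_of_ne (hK : 0 < K) (k q : ℕ) (hq : q ≠ k / K) :
    y.partialRaw K (k + 1) q = y.partialRaw K k q := by
  have h1 := Nat.div_add_mod k K
  have h2 := Nat.mod_lt k hK
  have e : min K (k + 1 - q * K) = min K (k - q * K) := by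
    rcases lt_or_gt_of_ne hq with h | h
    · have : (q + 1) * K ≤ k / K * K := Nat.mul_le_mul_right K h
      have h3 : k / K * K = K * (k / K) := mul_comm _ _
      have h4 : (q + 1) * K = q * K + K := by ring
      omega
    · have : (k / K + 1) * K ≤ q * K := Nat.mul_le_mul_right K h
      have h3 : (k / K + 1) * K = K * (k / K) + K := by ring
      omega
  rw [Data.partialRaw, Data.partialRaw, e]

/-- The bits of each number arrive most significant first, so reading bit `k` doubles cell `8 + k /
K` and adds the bit. The counter in cell 3 and the amplitude cells need no initialization, as memory
starts at zero. -/
theorem runsTo_readAmplitudes (hw : 0 < w) (hM : 0 < M) (hx : IntsBounded M x) (hR : y.Reads x)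
    (hF : Fits y K M) (hK : 0 < K) :
    RunsTo w x M c (fun m => m 1 = K ∧ m 2 = 2 ^ K ∧ ∀ a, a ≠ 1 → a ≠ 2 → m a = 0) readAmplitudes
      (Reading y K (2 * (y.n * y.d) * K)) (2 * (y.n * y.d) * K * (1 + 2) + 1) := by
  have h0 : RunsTo w x M c (Reading y K 0) readAmplitudes
      (Reading y K (2 * (y.n * y.d) * K)) (2 * (y.n * y.d) * K * (1 + 2) + 1) := by
    refine RunsTo.forLoop hw hM hx (Reading y K) _ (by exact_mod_cast hF.read)
      (fun k _ m h => h.counter) ?_ ?_ ?_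
    · intro k _ m h
      have hs := hR.eval_sites m
      have hl := hR.eval_levels m
      simp only [RamExpr.eval] at hs hl ⊢
      rw [hs, hl, show m (Int.toNat ((1 : ℕ) : ℤ)) = K from h.precision]
      push_cast
      ring
    · intro k _ m h
      simp [RamExpr.PrecisionLe]
    · intro k hk
      have haddr : ∀ m, Reading y K k m →
          ((RamExpr.add (.const 8) (.div (cell 3) (cell 1))).eval x m).toNat = k / K + 8 := by
        intro m h
        simp only [RamExpr.eval]
        rw [show m (Int.toNat ((1 : ℕ) : ℤ)) = K from h.precision,
          show m (Int.toNat ((3 : ℕ) : ℤ)) = k from h.counter]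
        norm_cast
        omega
      have hval : ∀ m, Reading y K k m →
          (RamExpr.add (.mul (.const 2) (.load (.add (.const 8) (.div (cell 3) (cell 1)))))
            (.bitIn (cell 3))).eval x m = y.partialRaw K (k + 1) (k / K) := by
        intro m h
        rw [y.partialRaw_succ_self hK, ← h.raw, ← haddr m h, ← hR.bit_eq]
        change 2 * m _ + (if x.bits.getD (m 3).toNat false then 1 else 0) = _
        rw [h.counter, Int.toNat_natCast]
      refine RunsTo.assign hw hM hx ?_ ?_ ?_ ?_
      · intro m _; simp [RamExpr.PrecisionLe]
      · intro m _; simp [RamExpr.PrecisionLe]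
      · intro m h
        rw [hval m h, abs_of_nonneg (y.partialRaw_nonneg _ _ _)]
        exact (y.partialRaw_lt _ _ _).trans (pow_lt_pow_right₀ (by norm_num) hF.precision)
      · intro m h
        rw [hval m h, haddr m h]
        have hne : ∀ a, a < 8 → a ≠ k / K + 8 := fun a ha => by
          generalize k / K = r
          omega
        refine ⟨?_, ?_, ?_, ?_, ?_, ?_⟩
        · rw [update_of_ne (hne 3 (by norm_num)), h.counter]
        · rw [update_of_ne (by norm_num), update_of_ne (hne 1 (by norm_num)), h.precision]
        · rw [update_of_ne (by norm_num), update_of_ne (hne 2 (by norm_num)), h.scale]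
        · rw [update_self]; push_cast; rfl
        · intro a ha
          rw [update_of_ne (by omega), update_of_ne (hne a (by omega)), h.rest a ha]
        · intro q
          rw [update_of_ne (by omega)]
          by_cases hq : q = k / K
          · rw [hq, update_self]
          · rw [update_of_ne fun e => hq (Nat.add_right_cancel e), h.raw, y.partialRaw_succ_of_ne hK k q hq]
  refine h0.weaken ?_ (fun m h => h) le_rfl
  rintro m ⟨h1, h2, h3⟩
  refine ⟨h1, h2, by simpa using h3 3 (by norm_num) (by norm_num),
    fun a ha => h3 a (by omega) (by omega), fun q => ?_⟩
  rw [h3 _ (by omega) (by omega), Data.partialRaw_zero]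

/-- The amplitudes are in memory. -/
structure Stored (y : Data) (K : ℕ) (m : ℕ → ℤ) : Prop where
  output : m 0 = 0
  precision : m 1 = K
  scale : m 2 = 2 ^ K
  raw : ∀ q, m (q + 8) = y.partialRaw K (2 * (y.n * y.d) * K) q

theorem Stored.update {m : ℕ → ℤ} (h : Stored y K m) {a : ℕ} (ha : 3 ≤ a) (ha' : a < 8) (v : ℤ) :
    Stored y K (update m a v) := by
  refine ⟨?_, ?_, ?_, fun q => ?_⟩
  · rw [update_of_ne (by omega), h.output]
  · rw [update_of_ne (by omega), h.precision]
  · rw [update_of_ne (by omega), h.scale]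
  · rw [update_of_ne (by omega), h.raw]

theorem Stored.eval_amplitude {m : ℕ → ℤ} (h : Stored y K m) {i : RamExpr} {q : ℕ}
    (hi : i.eval x m = q) : (amplitude i).eval x m = y.amp K q := by
  simp only [amplitude, RamExpr.eval, hi]
  rw [show (8 + (q : ℤ)).toNat = q + 8 by omega, h.raw,
    show m (Int.toNat ((2 : ℕ) : ℤ)) = 2 ^ K from h.scale, Data.amp]

theorem runsTo_assign_const (hw : 0 < w) (hM : 0 < M) (hx : IntsBounded M x) {a : ℕ} {z : ℤ}
    (hz : |z| < 2 ^ M) {P Q : (ℕ → ℤ) → Prop} (h : ∀ m, P m → Q (Function.update m a z)) :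
    RunsTo w x M c P (.assign (.const a) (.const z)) Q 1 := by
  refine RunsTo.assign hw hM hx (fun _ _ => trivial) (fun _ _ => trivial)
    (fun _ _ => hz) fun m hm => ?_
  simpa [RamExpr.eval] using h m hm

theorem zero_fits : |(0 : ℤ)| < 2 ^ M := by simp

theorem one_fits (hM : 0 < M) : |(1 : ℤ)| < 2 ^ M := by
  simpa using one_lt_pow₀ (by norm_num : (1 : ℤ) < 2) hM.ne'

/-- The memory while the norms are checked, `i` of them being done. -/
structure Checking (y : Data) (K i : ℕ) (m : ℕ → ℤ) : Prop where
  stored : Stored y K m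
  counter : m 3 = i
  energy : m 5 = 0
  flag : 0 < m 6 ↔ ∃ k < i, y.NormBad K k

theorem Checking.update {i : ℕ} {m : ℕ → ℤ} (h : Checking y K i m) {a : ℕ} (ha : a = 4 ∨ a = 7)
    (v : ℤ) : Checking y K i (update m a v) := by
  refine ⟨h.stored.update (by omega) (by omega) v, ?_, ?_, ?_⟩
  · rw [update_of_ne (by omega), h.counter]
  · rw [update_of_ne (by omega), h.energy]
  · rw [update_of_ne (by omega), h.flag]

theorem runsTo_siteNorm (hw : 0 < w) (hM : 0 < M) (hx : IntsBounded M x) (hR : y.Reads x)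
    (hF : Fits y K M) (i : ℕ) :
    RunsTo w x M c (Checking y K i) siteNorm
      (fun m => Checking y K i m ∧ m 4 = y.normSum K i (2 * y.d))
      (1 + (1 + (2 * y.d * (1 + 2) + 1))) := by
  have hnorm : ((2 * y.d : ℕ) : ℤ) * (2 ^ K) ^ 2 < 2 ^ M := by exact_mod_cast hF.norm
  refine (runsTo_assign_const hw hM hx zero_fits (Q := fun m => Checking y K i m ∧ m 4 = 0)
    ?_).seq ((runsTo_assign_const hw hM hx zero_fits
      (Q := fun m => Checking y K i m ∧ m 7 = (0 : ℕ) ∧ m 4 = y.normSum K i 0) ?_).seq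
      ((RunsTo.forLoop hw hM hx
        (fun r m => Checking y K i m ∧ m 7 = r ∧ m 4 = y.normSum K i r) (2 * y.d) ?_
        (fun k _ m h => h.2.1) ?_ ?_ ?_).weaken (fun m h => h) (fun m h => ⟨h.1, h.2.2⟩) le_rfl))
  · intro m h
    exact ⟨h.update (by simp) 0, update_self _ _ _⟩
  · rintro m ⟨h, h4⟩
    refine ⟨h.update (by simp) 0, update_self _ _ _, ?_⟩
    rw [update_of_ne (by norm_num), h4, Data.normSum, Finset.sum_range_zero]
  · have h1 : (1 : ℤ) ≤ (2 ^ K) ^ 2 := one_le_pow₀ (one_le_pow₀ (by norm_num))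
    have h2 : (0 : ℤ) ≤ ((2 * y.d : ℕ) : ℤ) := by positivity
    nlinarith
  · intro k _ m h
    have hl := hR.eval_levels m
    simp only [RamExpr.eval] at hl ⊢
    rw [hl]
    push_cast
    ring
  · intro k _ m h
    simp [RamExpr.PrecisionLe]
  · intro k hk
    have hidx : ∀ m, (Checking y K i m ∧ m 7 = k ∧ m 4 = y.normSum K i k) →
        (RamExpr.add (.mul (.mul (.const 2) levels) (cell 3)) (cell 7)).eval x m =
          ((2 * y.d * i + k : ℕ) : ℤ) := by
      rintro m ⟨h, h7, -⟩
      have hl := hR.eval_levels m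
      simp only [RamExpr.eval] at hl ⊢
      rw [hl, show m (Int.toNat ((3 : ℕ) : ℤ)) = i from h.counter,
        show m (Int.toNat ((7 : ℕ) : ℤ)) = k from h7]
      push_cast
      ring
    have hval : ∀ m, (Checking y K i m ∧ m 7 = k ∧ m 4 = y.normSum K i k) →
        (RamExpr.add (cell 4)
          (.mul (amplitude (.add (.mul (.mul (.const 2) levels) (cell 3)) (cell 7)))
          (amplitude (.add (.mul (.mul (.const 2) levels) (cell 3)) (cell 7))))).eval x m =
          y.normSum K i (k + 1) := by
      rintro m h
      have ha := h.1.stored.eval_amplitude (hidx m h)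
      rw [Data.normSum, Finset.sum_range_succ, ← Data.normSum, ← ha, ← h.2.2, sq]
      rfl
    refine RunsTo.assign hw hM hx (fun _ _ => trivial) ?_ ?_ ?_
    · intro m _
      have : (RamExpr.add (.mul (.mul (.const 2) levels) (cell 3)) (cell 7)).PrecisionLe x m M := by
        simp [RamExpr.PrecisionLe]
      exact ⟨trivial, precisionLe_amplitude this, precisionLe_amplitude this⟩
    · intro m h
      rw [hval m h, abs_of_nonneg (y.normSum_nonneg _ _ _)]
      refine (y.normSum_le K i (k + 1)).trans_lt (lt_of_le_of_lt ?_ hnorm)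
      refine mul_le_mul_of_nonneg_right ?_ (by positivity)
      exact_mod_cast hk
    · intro m h
      rw [hval m h]
      simp only [RamExpr.eval]
      rw [show (Int.toNat 4) = 4 from rfl]
      refine ⟨by rw [update_of_ne (by norm_num)]; exact h.2.1,
        (h.1.update (by simp) _).update (by simp) _, by rw [update_self]; push_cast; rfl, ?_⟩
      rw [update_of_ne (by norm_num), update_self]

theorem runsTo_checkNorms (hw : 0 < w) (hM : 0 < M) (hx : IntsBounded M x) (hR : y.Reads x)
    (hF : Fits y K M) :
    RunsTo w x M c (Reading y K (2 * (y.n * y.d) * K)) checkNorms (Checking y K y.n)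
      (1 + (y.n * ((1 + (1 + (2 * y.d * (1 + 2) + 1))) + (1 + 1) + 2) + 1)) := by
  refine (runsTo_assign_const hw hM hx zero_fits (Q := Checking y K 0) ?_).seq
    (RunsTo.forLoop hw hM hx (Checking y K) y.n (by exact_mod_cast hF.sites)
      (fun k _ m h => h.counter) (fun k _ m _ => hR.eval_sites m)
      (fun k _ m _ => by simp [RamExpr.PrecisionLe]) ?_)
  · intro m h
    have hs : Stored y K m := ⟨h.rest 0 (by simp), h.precision, h.scale, h.raw⟩
    refine ⟨hs.update (by norm_num) (by norm_num) _, by rw [update_self]; rfl, ?_, ?_⟩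
    · rw [update_of_ne (by norm_num), h.rest 5 (by norm_num)]
    · rw [update_of_ne (by norm_num), h.rest 6 (by norm_num)]
      simp
  · intro k hk
    refine (runsTo_siteNorm hw hM hx hR hF k).seq (RunsTo.ite (s := 1) hw hM hx ?_ ?_ ?_)
    · intro m _
      simp [normTest, RamExpr.PrecisionLe]
    all_goals
      have htest : ∀ m, (Checking y K k m ∧ m 4 = y.normSum K k (2 * y.d)) →
          (0 < normTest.eval x m ↔ y.NormBad K k) := by
        rintro m ⟨h, h4⟩
        have hl := hR.eval_levels m
        simp only [normTest, RamExpr.eval] at hl ⊢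
        rw [hl, show m (Int.toNat ((2 : ℕ) : ℤ)) = 2 ^ K from h.stored.scale,
          show m (Int.toNat ((4 : ℕ) : ℤ)) = _ from h4, Data.NormBad, sq, sq]
    · refine runsTo_assign_const hw hM hx (one_fits hM) ?_
      rintro m ⟨h, hpos⟩
      have hbad := (htest m h).1 hpos
      refine ⟨by rw [update_of_ne (by norm_num), h.1.counter],
        (h.1.stored.update (by norm_num) (by norm_num) _).update (by norm_num) (by norm_num) _,
        by rw [update_self]; push_cast; rfl, ?_, ?_⟩
      · rw [update_of_ne (by norm_num), update_of_ne (by norm_num), h.1.energy]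
      · rw [update_of_ne (by norm_num), update_self]
        simp only [zero_lt_one, true_iff]
        exact ⟨k, by omega, hbad⟩
    · refine RunsTo.skip ?_
      rintro m ⟨h, hpos⟩
      have hbad : ¬ y.NormBad K k := fun hb => hpos ((htest m h).2 hb)
      refine ⟨h.1.counter, h.1.stored.update (by norm_num) (by norm_num) _,
        by rw [update_self]; push_cast; rfl, ?_, ?_⟩
      · rw [update_of_ne (by norm_num), h.1.energy]
      · rw [update_of_ne (by norm_num), h.1.flag]
        constructor
        · rintro ⟨j, hj, hjb⟩
          exact ⟨j, by omega, hjb⟩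
        · rintro ⟨j, hj, hjb⟩
          refine ⟨j, lt_of_le_of_ne (by omega) ?_, hjb⟩
          rintro rfl
          exact hbad hjb

end Verifier

end Execution

/-! ### Execution of the energy summation, the final test and the whole program. -/

section EnergyExecution

namespace Verifier

open Function

variable {w M c K : ℕ} {x : RamInput} {y : Data}

theorem Data.Reads.eval_shift (hR : y.Reads x) {m : ℕ → ℤ} {t : ℕ} (ht : m 3 = t) (k : ℕ) :
    (shift k).eval x m = ((t / y.d ^ k : ℕ) : ℤ) := by
  induction k with
  | zero => rw [pow_zero, Nat.div_one]; exact ht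
  | succ k ih =>
    have hl := hR.eval_levels m
    simp only [shift, RamExpr.eval] at hl ⊢
    rw [ih, hl, pow_succ, ← Nat.div_div_eq_div_mul]
    push_cast
    rfl

theorem Data.Reads.eval_slot (hR : y.Reads x) {m : ℕ → ℤ} {t : ℕ} (ht : m 3 = t) (side k : ℕ) :
    (Verifier.slot side k).eval x m = (y.slot side t k : ℤ) := by
  have hl := hR.eval_levels m
  have h4 := hR.eval_shift ht 4
  have hk := hR.eval_shift ht k
  simp only [Verifier.slot, modulo, RamExpr.eval] at hl ⊢
  rw [hl, h4, hk]
  have e : ((3 : ℤ) + side + 2 * ((t / y.d ^ 4 : ℕ) : ℤ)).toNat = 3 + (side + 2 * (t / y.d ^ 4)) := by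
    generalize t / y.d ^ 4 = r
    omega
  rw [e, hR.vertex_eq, Data.slot]
  have e2 := Int.emod_def ((t / y.d ^ k : ℕ) : ℤ) (y.d : ℤ)
  rw [← e2]
  push_cast
  rfl

theorem precisionLe_shift (m : ℕ → ℤ) (k : ℕ) : (shift k).PrecisionLe x m M := by
  induction k with
  | zero => trivial
  | succ k ih => exact ⟨ih, trivial⟩

theorem precisionLe_slot (m : ℕ → ℤ) (side : ℤ) (k : ℕ) : (slot side k).PrecisionLe x m M :=
  ⟨trivial, ⟨⟨trivial, trivial, precisionLe_shift m 4⟩, trivial⟩, precisionLe_shift m k, trivial,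
    precisionLe_shift m k, trivial⟩

theorem precisionLe_prodRe {m : ℕ → ℤ} {i j : RamExpr} (hi : i.PrecisionLe x m M)
    (hj : j.PrecisionLe x m M) : (prodRe i j).PrecisionLe x m M :=
  ⟨⟨precisionLe_amplitude hi, precisionLe_amplitude hj⟩,
    precisionLe_amplitude ⟨hi, trivial⟩, precisionLe_amplitude ⟨hj, trivial⟩⟩

theorem precisionLe_prodIm {m : ℕ → ℤ} {i j : RamExpr} (hi : i.PrecisionLe x m M)
    (hj : j.PrecisionLe x m M) : (prodIm i j).PrecisionLe x m M :=
  ⟨⟨precisionLe_amplitude hi, precisionLe_amplitude ⟨hj, trivial⟩⟩,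
    precisionLe_amplitude ⟨hi, trivial⟩, precisionLe_amplitude hj⟩

theorem precisionLe_term {m : ℕ → ℤ} (hm : (m 1).toNat ≤ M) : term.PrecisionLe x m M := by
  have hre : ∀ k l, (prodRe (slot 0 k) (slot 1 l)).PrecisionLe x m M := fun k l =>
    precisionLe_prodRe (precisionLe_slot m _ k) (precisionLe_slot m _ l)
  have him : ∀ k l, (prodIm (slot 0 k) (slot 1 l)).PrecisionLe x m M := fun k l =>
    precisionLe_prodIm (precisionLe_slot m _ k) (precisionLe_slot m _ l)
  exact ⟨⟨⟨⟨hre _ _, hre _ _⟩, him _ _, him _ _⟩, ⟨trivial, trivial, trivial⟩, trivial, hm⟩,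
    ⟨⟨hre _ _, him _ _⟩, him _ _, hre _ _⟩, ⟨trivial, trivial, trivial⟩, trivial, hm⟩

theorem Stored.eval_prodRe {m : ℕ → ℤ} (h : Stored y K m) {i j : RamExpr} {p q : ℕ}
    (hi : i.eval x m = p) (hj : j.eval x m = q) : (prodRe i j).eval x m = y.prodRe K p q := by
  have hi' : (RamExpr.add i (.const 1)).eval x m = ((p + 1 : ℕ) : ℤ) := by
    simp only [RamExpr.eval, hi]; push_cast; rfl
  have hj' : (RamExpr.add j (.const 1)).eval x m = ((q + 1 : ℕ) : ℤ) := by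
    simp only [RamExpr.eval, hj]; push_cast; rfl
  rw [Data.prodRe, ← h.eval_amplitude hi, ← h.eval_amplitude hj, ← h.eval_amplitude hi',
    ← h.eval_amplitude hj']
  rfl

theorem Stored.eval_prodIm {m : ℕ → ℤ} (h : Stored y K m) {i j : RamExpr} {p q : ℕ}
    (hi : i.eval x m = p) (hj : j.eval x m = q) : (prodIm i j).eval x m = y.prodIm K p q := by
  have hi' : (RamExpr.add i (.const 1)).eval x m = ((p + 1 : ℕ) : ℤ) := by
    simp only [RamExpr.eval, hi]; push_cast; rfl
  have hj' : (RamExpr.add j (.const 1)).eval x m = ((q + 1 : ℕ) : ℤ) := by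
    simp only [RamExpr.eval, hj]; push_cast; rfl
  rw [Data.prodIm, ← h.eval_amplitude hi, ← h.eval_amplitude hj, ← h.eval_amplitude hi',
    ← h.eval_amplitude hj']
  rfl

theorem eval_realIn (hR : y.Reads x) {m : ℕ → ℤ} {a : RamExpr} {q : ℕ} (ha : a.eval x m = q)
    (hm : m 1 = K) : (RamExpr.realIn a (cell 1)).eval x m = fixedPoint K (y.real q) := by
  simp only [RamExpr.eval]
  rw [ha, show m (Int.toNat ((1 : ℕ) : ℤ)) = K from hm, Int.toNat_natCast, Int.toNat_natCast,
    hR.real_eq]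

theorem Stored.eval_term (hR : y.Reads x) {m : ℕ → ℤ} (h : Stored y K m) {t : ℕ} (ht : m 3 = t) :
    term.eval x m = y.term K t := by
  have hs : ∀ k, (slot 0 k).eval x m = (y.slot 0 t k : ℤ) := fun k => hR.eval_slot ht 0 k
  have hs' : ∀ k, (slot 1 k).eval x m = (y.slot 1 t k : ℤ) := fun k => hR.eval_slot ht 1 k
  have e1 : (RamExpr.add (.const 3) (.mul (.const 2) (cell 3))).eval x m =
      ((3 + 2 * t : ℕ) : ℤ) := by
    simp only [RamExpr.eval]
    rw [show m (Int.toNat ((3 : ℕ) : ℤ)) = t from ht]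
    push_cast
    rfl
  have e2 : (RamExpr.add (.const 4) (.mul (.const 2) (cell 3))).eval x m =
      ((4 + 2 * t : ℕ) : ℤ) := by
    simp only [RamExpr.eval]
    rw [show m (Int.toNat ((3 : ℕ) : ℤ)) = t from ht]
    push_cast
    rfl
  rw [Data.term, Data.weightRe, Data.weightIm, ← h.eval_prodRe (hs 3) (hs' 2),
    ← h.eval_prodIm (hs 3) (hs' 2), ← h.eval_prodRe (hs 1) (hs' 0), ← h.eval_prodIm (hs 1) (hs' 0),
    ← eval_realIn hR e1 h.precision, ← eval_realIn hR e2 h.precision]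
  rfl

/-- The memory while the energies are added, the first `t` terms being done. -/
structure Adding (y : Data) (K t : ℕ) (m : ℕ → ℤ) : Prop where
  stored : Stored y K m
  counter : m 3 = t
  energy : m 5 = y.energySum K t
  flag : 0 < m 6 ↔ ∃ k < y.n, y.NormBad K k

theorem runsTo_addEnergies (hw : 0 < w) (hM : 0 < M) (hx : IntsBounded M x) (hR : y.Reads x)
    (hF : Fits y K M) :
    RunsTo w x M c (Checking y K y.n) addEnergies (Adding y K y.entries)
      (1 + (y.entries * (1 + 2) + 1)) := by
  refine (runsTo_assign_const hw hM hx zero_fits (Q := Adding y K 0) ?_).seq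
    (RunsTo.forLoop hw hM hx (Adding y K) y.entries (by exact_mod_cast hF.entries)
      (fun k _ m h => h.counter) ?_ ?_ ?_)
  · intro m h
    refine ⟨h.stored.update (by norm_num) (by norm_num) _, by rw [update_self]; rfl, ?_, ?_⟩
    · rw [update_of_ne (by norm_num), h.energy, Data.energySum, Finset.sum_range_zero]
    · rw [update_of_ne (by norm_num), h.flag]
  · intro k _ m h
    have hs := hR.eval_sites m
    have hl := hR.eval_levels m
    have hd := hR.eval_degree m
    simp only [RamExpr.eval, eval_fourth] at hs hl hd ⊢
    rw [hs, hl, hd, Data.entries]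
    push_cast
    rfl
  · intro k _ m h
    simp [RamExpr.PrecisionLe, fourth]
  · intro k hk
    have hval : ∀ m, Adding y K k m →
        (RamExpr.add (cell 5) term).eval x m = y.energySum K (k + 1) := by
      intro m h
      rw [Data.energySum, Finset.sum_range_succ, ← Data.energySum, ← h.energy,
        ← h.stored.eval_term hR h.counter]
      rfl
    refine RunsTo.assign hw hM hx (fun _ _ => trivial) ?_ ?_ ?_
    · intro m h
      refine ⟨trivial, precisionLe_term ?_⟩
      rw [h.stored.precision, Int.toNat_natCast]
      exact hF.precision.le
    · intro m h
      rw [hval m h]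
      refine (y.abs_energySum_le K (k + 1)).trans_lt
        (lt_of_le_of_lt ?_ (by exact_mod_cast hF.energy :
          (y.entries : ℤ) * (16 * (2 ^ K) ^ 6) < 2 ^ M))
      refine mul_le_mul_of_nonneg_right ?_ (by positivity)
      exact_mod_cast hk
    · intro m h
      rw [hval m h]
      simp only [RamExpr.eval]
      rw [show (Int.toNat 5) = 5 from rfl]
      refine ⟨by rw [update_of_ne (by norm_num)]; exact h.counter,
        (h.stored.update (by norm_num) (by norm_num) _).update (by norm_num) (by norm_num) _,
        by rw [update_self]; push_cast; rfl, ?_, ?_⟩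
      · rw [update_of_ne (by norm_num), update_self]
      · rw [update_of_ne (by norm_num), update_of_ne (by norm_num), h.flag]

theorem runsTo_decideEnergy (hw : 0 < w) (hM : 0 < M) (hx : IntsBounded M x) (hR : y.Reads x)
    (hF : Fits y K M) :
    RunsTo w x M c (Adding y K y.entries) decideEnergy (fun m => m 0 = 1 ↔ y.Good K)
      (1 + (1 + 1)) := by
  refine RunsTo.ite hw hM hx (fun _ _ => trivial) ((RunsTo.skip ?_).weaken (fun _ h => h)
    (fun _ h => h) (by norm_num)) (RunsTo.ite hw hM hx ?_ ?_ (RunsTo.skip ?_))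
  · rintro m ⟨h, h6⟩
    rw [h.stored.output]
    refine ⟨fun h0 => absurd h0 (by norm_num), fun hg => ?_⟩
    obtain ⟨k, hk, hbad⟩ := h.flag.1 h6
    exact absurd hbad (hg.1 k hk)
  · rintro m ⟨h, -⟩
    have h1 : (m 1).toNat ≤ M := by
      rw [h.stored.precision, Int.toNat_natCast]
      exact hF.precision.le
    exact ⟨⟨⟨⟨⟨trivial, trivial⟩, by simp [fourth, RamExpr.PrecisionLe]⟩,
      ⟨trivial, trivial, trivial, h1⟩, trivial, trivial, h1⟩, trivial⟩, trivial, trivial⟩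
  all_goals
    have htest : ∀ m, Adding y K y.entries m → (0 < energyTest.eval x m ↔
        0 < y.n * y.D * (2 ^ K) ^ 4 * (2 * fixedPoint K (y.real 1) - fixedPoint K (y.real 2)) + 1 -
          4 * y.energySum K y.entries) := by
      intro m h
      have hs := hR.eval_sites m
      have hd := hR.eval_degree m
      have h1 := eval_realIn hR (m := m) (a := .const 1) (q := 1) rfl h.stored.precision
      have h2 := eval_realIn hR (m := m) (a := .const 2) (q := 2) rfl h.stored.precision
      rw [← h1, ← h2, ← h.energy, ← hs, ← hd, ← h.stored.scale]
      simp only [energyTest, RamExpr.eval, eval_fourth]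
      rfl
  · refine runsTo_assign_const hw hM hx (one_fits hM) ?_
    rintro m ⟨⟨h, h6⟩, hpos⟩
    rw [update_self]
    simp only [true_iff]
    refine ⟨fun k hk hbad => h6 (h.flag.2 ⟨k, hk, hbad⟩), (htest m h).1 hpos⟩
  · rintro m ⟨⟨h, h6⟩, hpos⟩
    rw [h.stored.output]
    exact ⟨fun h0 => absurd h0 (by norm_num), fun hg => absurd ((htest m h).2 hg.2) hpos⟩

/-- The number of steps of the verifier. -/
def Data.steps (y : Data) (K : ℕ) : ℕ :=
  1 + ((1 + (K * (1 + 2) + 1)) + ((2 * (y.n * y.d) * K * (1 + 2) + 1) +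
    ((1 + (y.n * ((1 + (1 + (2 * y.d * (1 + 2) + 1))) + (1 + 1) + 2) + 1)) +
      ((1 + (y.entries * (1 + 2) + 1)) + (1 + (1 + 1))))))

theorem runsTo_program (hw : 0 < w) (hM : 2 < M) (hx : IntsBounded M x) (hR : y.Reads x)
    (hF : Fits y K M) (hK : 4096 * (y.d : ℤ) ^ 4 ≤ fixedPoint K (y.real 2))
    (hK' : ∀ k < K, fixedPoint k (y.real 2) < 4096 * (y.d : ℤ) ^ 4) (hK0 : 0 < K) :
    RunsTo w x M c (fun m => m = fun _ => 0) program
      (fun m => m 0 = 1 ↔ (y.d < y.n ∧ y.Good K) ∨ (y.n ≤ y.d ∧ 8 < fixedPoint 3 (y.real 1)))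
      (y.steps K) := by
  have hM0 : 0 < M := by omega
  have htest : ∀ m, (RamExpr.sub sites levels).eval x m = y.n - y.d := by
    intro m
    rw [← hR.eval_sites m, ← hR.eval_levels m]
    rfl
  refine RunsTo.ite hw hM0 hx (fun _ _ => ⟨trivial, trivial⟩) ?_ ?_
  · intro hc m hm hP
    have hlt : y.d < y.n := by
      have := hP.2
      rw [htest] at this
      omega
    have h := (runsTo_findPrecision (c := c) hw hM0 hx hR hF hK hK').seq
      ((runsTo_readAmplitudes hw hM0 hx hR hF hK0).seq ((runsTo_checkNorms hw hM0 hx hR hF).seq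
        ((runsTo_addEnergies hw hM0 hx hR hF).seq (runsTo_decideEnergy hw hM0 hx hR hF))))
    refine h.weaken (fun _ h => h) (fun m' h' => ?_) le_rfl hc m hm hP.1
    rw [h']
    simp [hlt, hlt.not_ge]
  · intro hc m hm hP
    have hle : y.n ≤ y.d := by
      have := hP.2
      rw [htest] at this
      omega
    have htest2 : ∀ m, (RamExpr.sub (.realIn (.const 1) (.const 3)) (.const 8)).eval x m =
        fixedPoint 3 (y.real 1) - 8 := by
      intro m
      rw [← hR.real_eq]
      rfl
    have h : RunsTo w x M c (fun m => m = fun _ => 0)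
        (.ite (.sub (.realIn (.const 1) (.const 3)) (.const 8))
          (.assign (.const 0) (.const 1)) .skip)
        (fun m => m 0 = 1 ↔ 8 < fixedPoint 3 (y.real 1)) (1 + 1) := by
      refine RunsTo.ite hw hM0 hx (fun _ _ => ⟨⟨trivial, trivial, hM⟩, trivial⟩)
        (runsTo_assign_const hw hM0 hx (one_fits hM0) ?_) (RunsTo.skip ?_)
      · rintro m ⟨-, hpos⟩
        rw [htest2] at hpos
        rw [update_self]
        simp only [true_iff]
        omega
      · rintro m ⟨rfl, hpos⟩
        rw [htest2] at hpos
        simp only [zero_ne_one, false_iff]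
        omega
    refine h.weaken (fun _ h => h) (fun m' h' => ?_) (by omega) hc m hm hP.1
    rw [h']
    simp [hle, hle.not_gt]

end Verifier

end EnergyExecution

/-! ### The running time -/

section RunningTime

theorem fixedPoint_eq_floor {k : ℕ} {r : ℝ} (hr : |r| ≤ 2 ^ k) :
    fixedPoint k r = ⌊(2 : ℝ) ^ k * r⌋ := by
  rw [abs_le] at hr
  have h4 : (4 : ℝ) ^ k = 2 ^ k * 2 ^ k := by rw [← mul_pow]; norm_num
  have h2 : (0 : ℝ) < 2 ^ k := by positivity
  have h1 : -4 ^ k ≤ ⌊(2 : ℝ) ^ k * r⌋ := by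
    rw [Int.le_floor]
    push_cast
    nlinarith
  have h3 : ⌊(2 : ℝ) ^ k * r⌋ ≤ 4 ^ k := by
    have : (⌊(2 : ℝ) ^ k * r⌋ : ℝ) ≤ ((4 ^ k : ℤ) : ℝ) := by
      refine (Int.floor_le _).trans ?_
      push_cast
      nlinarith
    exact_mod_cast this
  rw [fixedPoint, min_eq_right h3, max_eq_right h1]

theorem abs_fixedPoint_sub_le {k : ℕ} {r : ℝ} (hr : |r| ≤ 2 ^ k) :
    |(fixedPoint k r : ℝ) - 2 ^ k * r| ≤ 1 := by
  rw [fixedPoint_eq_floor hr, abs_le]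
  constructor
  · linarith [Int.lt_floor_add_one ((2 : ℝ) ^ k * r)]
  · linarith [Int.floor_le ((2 : ℝ) ^ k * r)]

/-- Minimality gives the upper bound: at precision `K - 1` the reading of `δ` was still below `b`.
Precision 0 never suffices, since `δ ≤ 1 < b`. -/
theorem exists_precision {δ : ℝ} (hδ : 0 < δ) (hδ1 : δ ≤ 1) {b : ℕ} (hb : 1 < b) :
    ∃ K : ℕ, 0 < K ∧ (b : ℤ) ≤ fixedPoint K δ ∧ (∀ k < K, fixedPoint k δ < b) ∧
      b ≤ 2 ^ K * δ ∧ 2 ^ K * δ < 2 * b := by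
  have hfl : ∀ k, fixedPoint k δ = ⌊(2 : ℝ) ^ k * δ⌋ := fun k => fixedPoint_eq_floor <| by
    rw [abs_of_pos hδ]
    exact hδ1.trans (one_le_pow₀ (by norm_num))
  have hex : ∃ k : ℕ, (b : ℤ) ≤ fixedPoint k δ := by
    obtain ⟨k, hk⟩ := pow_unbounded_of_one_lt ((b : ℝ) / δ) (by norm_num : (1 : ℝ) < 2)
    refine ⟨k, ?_⟩
    rw [hfl, Int.le_floor]
    rw [div_lt_iff₀ hδ] at hk
    exact_mod_cast hk.le
  classical
  have h1 : (b : ℤ) ≤ fixedPoint (Nat.find hex) δ := Nat.find_spec hex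
  have h2 : ∀ k < Nat.find hex, fixedPoint k δ < b := fun k hk => not_le.1 (Nat.find_min hex hk)
  have h0 : 0 < Nat.find hex := by
    rw [Nat.find_pos, hfl, not_le, Int.floor_lt]
    have : (1 : ℝ) < b := by exact_mod_cast hb
    push_cast
    linarith
  refine ⟨Nat.find hex, h0, h1, h2, ?_, ?_⟩
  · rw [hfl, Int.le_floor] at h1
    exact_mod_cast h1
  · have h3 := h2 (Nat.find hex - 1) (by omega)
    rw [hfl, Int.floor_lt] at h3
    obtain ⟨j, hj⟩ : ∃ j, Nat.find hex = j + 1 := ⟨Nat.find hex - 1, by omega⟩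
    rw [hj] at h3 ⊢
    rw [pow_succ]
    simp only [Nat.add_sub_cancel, Int.cast_natCast] at h3
    linarith

namespace Verifier

variable {w K : ℕ} {x : RamInput} {y : Data}

/-- The binary logarithm of `1 / δ`. -/
theorem exists_log_le {δ : ℝ} (hδ : 0 < δ) (hδ1 : δ ≤ 1) :
    ∃ l : ℕ, 1 ≤ 2 ^ l * δ ∧ (l : ℝ) ≤ 1 + 2 * Real.log (1 / δ) := by
  refine ⟨⌈Real.log (1 / δ) / Real.log 2⌉₊, ?_, ?_⟩
  · have h2 : 0 < Real.log 2 := Real.log_pos (by norm_num)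
    have h1 := Nat.le_ceil (Real.log (1 / δ) / Real.log 2)
    rw [div_le_iff₀ h2, ← Real.log_pow, Real.log_le_log_iff (by positivity) (by positivity),
      div_le_iff₀ hδ] at h1
    exact h1
  · have h2 : 1 / 2 < Real.log 2 := by linarith [Real.log_two_gt_d9]
    have h0 : 0 ≤ Real.log (1 / δ) := Real.log_nonneg (by rw [le_div_iff₀ hδ]; linarith)
    have h1 := Nat.ceil_lt_add_one (div_nonneg h0 (by linarith : 0 ≤ Real.log 2))
    have h3 : Real.log (1 / δ) / Real.log 2 ≤ 2 * Real.log (1 / δ) := by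
      rw [div_le_iff₀ (by linarith)]
      nlinarith
    linarith

theorem two_pow_lt_of_precision {l d : ℕ} {δ : ℝ} (hδ : 0 < δ) (hl : 1 ≤ 2 ^ l * δ)
    (hK : 2 ^ K * δ < 2 * ((4096 * d ^ 4 : ℕ) : ℝ)) : 2 ^ K < 2 ^ 13 * d ^ 4 * 2 ^ l := by
  have h1 : (2 : ℝ) ^ K < 2 ^ 13 * d ^ 4 * 2 ^ l := by
    by_contra hcon
    push Not at hcon
    have h2 : (2 ^ 13 * (d : ℝ) ^ 4) * 1 ≤ (2 ^ 13 * (d : ℝ) ^ 4) * (2 ^ l * δ) :=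
      mul_le_mul_of_nonneg_left hl (by positivity)
    have h3 := mul_le_mul_of_nonneg_right hcon hδ.le
    push_cast at hK
    linarith
  exact_mod_cast h1

/-- The origin of the bit bound: $K < 13+4w+l$, and the longest number is the energy sum with
$4w+4+6K$ bits. The assumption `D < n` gives at most $(nd)^4$ matrix entries. -/
theorem fits {l : ℕ} (hd : 0 < y.d) (hD : y.D < y.n)
    (hw : y.n * y.d < 2 ^ w) (hQ : 2 ^ K < 2 ^ 13 * y.d ^ 4 * 2 ^ l) :
    Fits y K (100 + 30 * w + 6 * l) := by
  have hn : 0 < y.n := by omega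
  have hdw : y.d < 2 ^ w := lt_of_le_of_lt (Nat.le_mul_of_pos_left _ hn) hw
  have hnw : y.n < 2 ^ w := lt_of_le_of_lt (Nat.le_mul_of_pos_right _ hd) hw
  have hQ2 : 2 ^ K < 2 ^ (13 + 4 * w + l) := by
    calc 2 ^ K < 2 ^ 13 * y.d ^ 4 * 2 ^ l := hQ
      _ ≤ 2 ^ 13 * (2 ^ w) ^ 4 * 2 ^ l := by gcongr
      _ = _ := by rw [← pow_mul, ← pow_add, ← pow_add]; congr 1; ring
  have hK : K < 13 + 4 * w + l := (Nat.pow_lt_pow_iff_right (by norm_num)).1 hQ2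
  have hent : y.entries < 2 ^ (4 * w) := by
    calc y.entries ≤ y.n * y.D * y.d ^ 4 := Nat.mul_le_mul_right _ (Nat.div_le_self _ _)
      _ ≤ y.n * y.n * y.d ^ 4 := by gcongr
      _ ≤ (y.n * y.n * (y.n * y.n)) * y.d ^ 4 :=
        Nat.mul_le_mul_right _ (Nat.le_mul_of_pos_right _ (by positivity))
      _ = (y.n * y.d) ^ 4 := by ring
      _ < (2 ^ w) ^ 4 := Nat.pow_lt_pow_left hw (by norm_num)
      _ = _ := by rw [← pow_mul]; congr 1; ring
  refine ⟨by omega, ?_, ?_, ?_, ?_, ?_⟩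
  · calc 2 * (y.n * y.d) * K ≤ 2 * 2 ^ w * 2 ^ K := by
          gcongr
          exact Nat.lt_two_pow_self.le
      _ = 2 ^ (1 + w + K) := by ring
      _ < _ := Nat.pow_lt_pow_right (by norm_num) (by omega)
  · exact hnw.trans_le (Nat.pow_le_pow_right (by norm_num) (by omega))
  · calc 2 * y.d * (2 ^ K) ^ 2 ≤ 2 * 2 ^ w * (2 ^ K) ^ 2 := by gcongr
      _ = 2 ^ (1 + w + 2 * K) := by ring
      _ < _ := Nat.pow_lt_pow_right (by norm_num) (by omega)
  · exact hent.trans_le (Nat.pow_le_pow_right (by norm_num) (by omega))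
  · calc y.entries * (16 * (2 ^ K) ^ 6) ≤ 2 ^ (4 * w) * (16 * (2 ^ K) ^ 6) := by gcongr
      _ = 2 ^ (4 * w + 4 + 6 * K) := by ring
      _ < _ := Nat.pow_lt_pow_right (by norm_num) (by omega)

/-- Reading the witness takes about $ndK$ rounds. The crude bound $K \le 17d(1+l)$ is enough,
because $nd^2 \le nDd^4$ is dominated by the number of matrix entries allowed for. -/
theorem steps_le {l : ℕ} (hd : 0 < y.d) (hD0 : 0 < y.D) (hD : y.D < y.n)
    (hQ : 2 ^ K < 2 ^ 13 * y.d ^ 4 * 2 ^ l) :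
    y.steps K ≤ 220 * (y.n * y.D * y.d ^ 4 * (1 + l)) := by
  have hn : 0 < y.n := by omega
  have hQ2 : 2 ^ K < 2 ^ (13 + 4 * y.d + l) := by
    calc 2 ^ K < 2 ^ 13 * y.d ^ 4 * 2 ^ l := hQ
      _ ≤ 2 ^ 13 * (2 ^ y.d) ^ 4 * 2 ^ l := by
        gcongr
        exact Nat.lt_two_pow_self.le
      _ = _ := by rw [← pow_mul, ← pow_add, ← pow_add]; congr 1; ring
  have hK : K < 13 + 4 * y.d + l := (Nat.pow_lt_pow_iff_right (by norm_num)).1 hQ2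
  have hK2 : K ≤ 17 * (y.d * (1 + l)) := by nlinarith
  set X := y.n * y.D * y.d ^ 4 * (1 + l) with hX
  have hent : y.entries ≤ X := by
    calc y.entries ≤ y.n * y.D * y.d ^ 4 := Nat.mul_le_mul_right _ (Nat.div_le_self _ _)
      _ ≤ X := Nat.le_mul_of_pos_right _ (by omega)
  have h1 : y.n * y.d * (y.d * (1 + l)) ≤ X := by
    calc y.n * y.d * (y.d * (1 + l)) = (y.n * y.d ^ 2 * (1 + l)) * (1 * 1) := by ring
      _ ≤ (y.n * y.d ^ 2 * (1 + l)) * (y.D * y.d ^ 2) :=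
        Nat.mul_le_mul_left _ (Nat.mul_le_mul hD0 (Nat.pow_pos hd))
      _ = X := by rw [hX]; ring
  have h2 : y.d * (1 + l) ≤ y.n * y.d * (y.d * (1 + l)) :=
    Nat.le_mul_of_pos_left _ (by positivity)
  have h3 : y.n * y.d ≤ y.n * y.d * (y.d * (1 + l)) := Nat.le_mul_of_pos_right _ (by positivity)
  have h4 : y.n ≤ y.n * y.d := Nat.le_mul_of_pos_right _ hd
  have h5 : y.n * y.d * K ≤ 17 * (y.n * y.d * (y.d * (1 + l))) := by
    calc y.n * y.d * K ≤ y.n * y.d * (17 * (y.d * (1 + l))) := Nat.mul_le_mul_left _ hK2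
      _ = _ := by ring
  have e : y.steps K = 3 * K + 6 * (y.n * y.d * K) + 6 * (y.n * y.d) + 7 * y.n +
      3 * y.entries + 11 := by
    rw [Data.steps]
    ring
  rw [e]
  omega

theorem intsBounded_of_lt {M : ℕ} (hR : y.Reads x) (hn : y.n < 2 ^ M) (hd : y.d < 2 ^ M)
    (hD : y.D < 2 ^ M) (hv : ∀ a, y.vertex a < 2 ^ M) : IntsBounded M x := by
  have key : ∀ r : ℕ, r < 2 ^ M → |(r : ℤ)| < 2 ^ M := fun r hr => by
    rw [abs_of_nonneg (by positivity)]
    exact_mod_cast hr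
  intro a
  match a with
  | 0 => rw [hR.n_eq]; exact key _ hn
  | 1 => rw [hR.d_eq]; exact key _ hd
  | 2 => rw [hR.D_eq]; exact key _ hD
  | a + 3 => rw [add_comm, hR.vertex_eq]; exact key _ (hv a)

/-- The verifier halts in time and decides as specified. -/
theorem exists_run (hR : y.Reads x) (hd : 0 < y.d) (hD0 : 0 < y.D) (hD : y.D < y.n)
    (hv : ∀ a, y.vertex a < y.n) (hδ : 0 < y.real 2) (hδ1 : y.real 2 ≤ 1) (hK0 : 0 < K)
    (hK : 4096 * (y.d : ℤ) ^ 4 ≤ fixedPoint K (y.real 2))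
    (hK' : ∀ k < K, fixedPoint k (y.real 2) < 4096 * (y.d : ℤ) ^ 4)
    (hQ : 2 ^ K * y.real 2 < 2 * ((4096 * y.d ^ 4 : ℕ) : ℝ)) :
    ∃ m t, RamExec (Nat.size (y.n * y.d)) x program (fun _ => 0) m t ∧
      (m 0 = 1 ↔ (y.d < y.n ∧ y.Good K) ∨ (y.n ≤ y.d ∧ 8 < fixedPoint 3 (y.real 1))) ∧
      (t : ℝ) ≤ program.coeff * 280 ^ 2 * 440 * ((y.n : ℝ) * y.D * (y.d : ℝ) ^ 4) *
        (1 + Real.log (1 / y.real 2)) ^ 3 := by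
  have hn : 0 < y.n := by omega
  obtain ⟨l, hl1, hl2⟩ := exists_log_le hδ hδ1
  set lam := Real.log (1 / y.real 2) with hlam
  have hlam0 : 0 ≤ lam := Real.log_nonneg (by rw [le_div_iff₀ hδ]; linarith)
  set w := Nat.size (y.n * y.d) with hw
  have hnd : y.n * y.d < 2 ^ w := Nat.lt_size_self _
  have hw0 : 0 < w := Nat.size_pos.2 (by positivity)
  have hQ2 := two_pow_lt_of_precision hδ hl1 hQ
  have hF := fits hd hD hnd hQ2
  have hdM : y.d < 2 ^ (100 + 30 * w + 6 * l) :=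
    (lt_of_le_of_lt (Nat.le_mul_of_pos_left _ hn) hnd).trans_le
      (Nat.pow_le_pow_right (by norm_num) (by omega))
  have hx : IntsBounded (100 + 30 * w + 6 * l) x := intsBounded_of_lt hR hF.sites hdM
    (hD.trans hF.sites) fun a => (hv a).trans hF.sites
  obtain ⟨m, t, h1, -, h3, h4⟩ := runsTo_program (c := program.coeff) hw0 (by omega) hx hR hF hK hK'
    hK0 le_rfl (fun _ => 0) (fun _ => by simp) rfl
  refine ⟨m, t, h1, h3, ?_⟩
  -- The part of the bit length proportional to `w` costs only a constant number of words, so no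
  -- logarithm of `n` or `d` survives.
  have h5 : (100 + 30 * w + 6 * l) / w ≤ 130 + 6 * l := by
    refine Nat.div_le_of_le_mul ?_
    nlinarith
  have h6 : 1 + (100 + 30 * w + 6 * l) / w ≤ 140 * (1 + l) := by omega
  -- Two factors `1 + l` come from the cost of a step and one from the number of steps, hence the
  -- exponent 3.
  have h7 : t ≤ program.coeff * (140 * (1 + l)) ^ 2 * (220 * (y.n * y.D * y.d ^ 4 * (1 + l))) :=
    h4.trans (Nat.mul_le_mul (Nat.mul_le_mul_left _ (Nat.pow_le_pow_left h6 2))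
      (steps_le hd hD0 hD hQ2))
  have h8 : (t : ℝ) ≤ program.coeff * (140 * (1 + l)) ^ 2 *
      (220 * (y.n * y.D * y.d ^ 4 * (1 + l))) := by exact_mod_cast h7
  have h9 : (1 + l : ℝ) ≤ 2 * (1 + lam) := by linarith
  calc (t : ℝ) ≤ program.coeff * (140 * (1 + l)) ^ 2 *
      (220 * (y.n * y.D * y.d ^ 4 * (1 + l))) := h8
    _ ≤ program.coeff * (140 * (2 * (1 + lam))) ^ 2 *
      (220 * (y.n * y.D * y.d ^ 4 * (2 * (1 + lam)))) := by gcongr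
    _ = _ := by ring

end Verifier

end RunningTime

/-! ### The presentation of an instance -/

section Presentation

open Finset

theorem sum_range_mul_digits {M : Type*} [AddCommMonoid M] (m L : ℕ) (f : ℕ → M) :
    ∑ t ∈ range (m * L), f t = ∑ i ∈ range m, ∑ r ∈ range L, f (i * L + r) := by
  induction m with
  | zero => simp
  | succ m ih => rw [Nat.succ_mul, Finset.sum_range_add, ih, Finset.sum_range_succ]

theorem getD_flatMap_of_length {A B : Type*} {f : A → List B} {L : ℕ}
    (hf : ∀ a, (f a).length = L) (z : B) :
    ∀ (l : List A) (i r : ℕ) (hi : i < l.length), r < L →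
      (l.flatMap f).getD (i * L + r) z = (f l[i]).getD r z
  | [], i, r, hi, _ => absurd hi (by simp)
  | a :: l, 0, r, _, hr => by
    rw [List.flatMap_cons, List.getD_append _ _ _ _ (by rw [hf]; omega)]
    simp
  | a :: l, i + 1, r, hi, hr => by
    have h := getD_flatMap_of_length hf z l i r (by simpa using hi) hr
    rw [List.flatMap_cons, List.getD_append_right _ _ _ _ (by rw [hf]; nlinarith), hf,
      show (i + 1) * L + r - L = i * L + r by rw [add_mul]; omega, h]
    rfl

theorem length_flatMap_of_length {A B : Type*} {f : A → List B} {L : ℕ}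
    (hf : ∀ a, (f a).length = L) (l : List A) : (l.flatMap f).length = l.length * L := by
  simp [List.length_flatMap, hf]

theorem getD_flatMap_finRange {B : Type*} {d L : ℕ} {f : Fin d → List B}
    (hf : ∀ a, (f a).length = L) (z : B) (a : Fin d) {r : ℕ} (hr : r < L) :
    ((List.finRange d).flatMap f).getD (a * L + r) z = (f a).getD r z := by
  rw [getD_flatMap_of_length hf z _ _ _ (by simp) hr]
  simp

theorem length_flatMap_finRange {B : Type*} {d L : ℕ} {f : Fin d → List B}
    (hf : ∀ a, (f a).length = L) : ((List.finRange d).flatMap f).length = d * L := by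
  rw [length_flatMap_of_length hf, List.length_finRange]

theorem mul_add_lt {d L r : ℕ} (a : Fin d) (hr : r < L) : (a : ℕ) * L + r < d * L := by
  have : ((a : ℕ) + 1) * L ≤ d * L := Nat.mul_le_mul_right _ a.2
  rw [add_mul] at this
  omega

theorem length_matrixEntries {d : ℕ} (A : Matrix (Fin d × Fin d) (Fin d × Fin d) ℂ) :
    (matrixEntries A).length = d * (d * (d * (d * 2))) :=
  length_flatMap_finRange fun _ => length_flatMap_finRange fun _ => length_flatMap_finRange
    fun _ => length_flatMap_finRange fun _ => rfl

theorem getD_matrixEntries {d : ℕ} (A : Matrix (Fin d × Fin d) (Fin d × Fin d) ℂ)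
    (a b a' b' : Fin d) {s : ℕ} (hs : s < 2) (z : ℝ) :
    (matrixEntries A).getD
      (a * (d * (d * (d * 2))) + (b * (d * (d * 2)) + (a' * (d * 2) + (b' * 2 + s)))) z =
      [(A (a, b) (a', b')).re, (A (a, b) (a', b')).im].getD s z := by
  rw [matrixEntries, getD_flatMap_finRange (L := d * (d * (d * 2))),
    getD_flatMap_finRange (L := d * (d * 2)), getD_flatMap_finRange (L := d * 2),
    getD_flatMap_finRange (L := 2) (fun _ => rfl) z b' hs]
  · exact fun _ => length_flatMap_finRange fun _ => rfl
  · exact mul_add_lt _ hs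
  · exact fun _ => length_flatMap_finRange fun _ => length_flatMap_finRange fun _ => rfl
  · exact mul_add_lt _ (mul_add_lt _ hs)
  · exact fun _ => length_flatMap_finRange fun _ => length_flatMap_finRange fun _ =>
      length_flatMap_finRange fun _ => rfl
  · exact mul_add_lt _ (mul_add_lt _ (mul_add_lt _ hs))

namespace Verifier

variable {n d D : ℕ} {edges : List (Fin n × Fin n)}
  {h : Fin n → Fin n → Matrix (Fin d × Fin d) (Fin d × Fin d) ℂ} {α β δ : ℝ} {wit : List Bool}

/-- The data presented by a list of numbers. -/
noncomputable def dataOf (n d D : ℕ) (x : RamInput) : Data where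
  n := n
  d := d
  D := D
  vertex a := (x.ints.getD (3 + a) 0).toNat
  real a := x.reals.getD a 0
  bit a := x.bits.getD a false

theorem getD_ints (a : ℕ) : (verifierInput D edges h α β δ wit).ints.getD (3 + a) 0 =
    (edges.flatMap fun e => [((e.1 : ℕ) : ℤ), ((e.2 : ℕ) : ℤ)]).getD a 0 := by
  rw [verifierInput, List.getD_append_right _ _ _ _ (by simp)]
  simp

theorem getD_ints_bounds (hn : 0 < n) (a : ℕ) :
    0 ≤ (verifierInput D edges h α β δ wit).ints.getD (3 + a) 0 ∧
      (verifierInput D edges h α β δ wit).ints.getD (3 + a) 0 < n := by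
  rw [getD_ints]
  set l := edges.flatMap fun e => [((e.1 : ℕ) : ℤ), ((e.2 : ℕ) : ℤ)] with hl
  by_cases ha : a < l.length
  · rw [List.getD_eq_getElem _ _ ha]
    have hmem : l[a] ∈ l := List.getElem_mem ha
    generalize l[a] = z at hmem
    rw [hl, List.mem_flatMap] at hmem
    obtain ⟨e, -, he⟩ := hmem
    simp only [List.mem_cons, List.not_mem_nil, or_false] at he
    rcases he with rfl | rfl
    · exact ⟨by positivity, by exact_mod_cast e.1.2⟩
    · exact ⟨by positivity, by exact_mod_cast e.2.2⟩
  · rw [List.getD_eq_default _ _ (not_lt.1 ha)]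
    exact ⟨le_rfl, by exact_mod_cast hn⟩

theorem reads (hn : 0 < n) :
    (dataOf n d D (verifierInput D edges h α β δ wit)).Reads
      (verifierInput D edges h α β δ wit) where
  n_eq := rfl
  d_eq := rfl
  D_eq := rfl
  vertex_eq a := (Int.toNat_of_nonneg (getD_ints_bounds hn a).1).symm
  real_eq _ := rfl
  bit_eq _ := rfl

theorem vertex_lt (hn : 0 < n) (a : ℕ) :
    (dataOf n d D (verifierInput D edges h α β δ wit)).vertex a < n := by
  have := getD_ints_bounds (D := D) (edges := edges) (h := h) (α := α) (β := β) (δ := δ)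
    (wit := wit) hn a
  simp only [dataOf]
  omega

theorem vertex_fst {i : ℕ} (hi : i < edges.length) :
    (dataOf n d D (verifierInput D edges h α β δ wit)).vertex (0 + 2 * i) = (edges[i]).1 := by
  simp only [dataOf, getD_ints]
  rw [show 0 + 2 * i = i * 2 + 0 by ring,
    getD_flatMap_of_length (L := 2) (fun _ => rfl) _ _ _ _ hi (by norm_num)]
  rfl

theorem vertex_snd {i : ℕ} (hi : i < edges.length) :
    (dataOf n d D (verifierInput D edges h α β δ wit)).vertex (1 + 2 * i) = (edges[i]).2 := by
  simp only [dataOf, getD_ints]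
  rw [show 1 + 2 * i = i * 2 + 1 by ring,
    getD_flatMap_of_length (L := 2) (fun _ => rfl) _ _ _ _ hi (by norm_num)]
  rfl

/-- The position of a matrix entry. -/
def entryIndex (d i a b a' b' : ℕ) : ℕ := (((i * d + a) * d + b) * d + a') * d + b'

theorem real_entry {i : ℕ} (hi : i < edges.length) (a b a' b' : Fin d) {s : ℕ} (hs : s < 2) :
    (dataOf n d D (verifierInput D edges h α β δ wit)).real
        (3 + s + 2 * entryIndex d i a b a' b') =
      [(h (edges[i]).1 (edges[i]).2 (a, b) (a', b')).re,
        (h (edges[i]).1 (edges[i]).2 (a, b) (a', b')).im].getD s 0 := by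
  simp only [dataOf, verifierInput]
  rw [List.getD_append_right _ _ _ _ (by simp; omega),
    show 3 + s + 2 * entryIndex d i a b a' b' - [α, β, δ].length = i * (d * (d * (d * (d * 2)))) +
      (a * (d * (d * (d * 2))) + (b * (d * (d * 2)) + (a' * (d * 2) + (b' * 2 + s)))) by
      simp only [List.length_cons, List.length_nil, entryIndex]
      rw [show 3 + s + 2 * ((((i * d + a) * d + b) * d + a') * d + b') =
        (s + 2 * ((((i * d + a) * d + b) * d + a') * d + b')) + 3 by ring, Nat.add_sub_cancel]
      ring,
    getD_flatMap_of_length (L := d * (d * (d * (d * 2)))) (fun _ => length_matrixEntries _) _ _ _ _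
      hi (mul_add_lt _ (mul_add_lt _ (mul_add_lt _ (mul_add_lt _ hs)))),
    getD_matrixEntries _ _ _ _ _ hs]

theorem digit_div {d i r : ℕ} (hr : r < d) : (i * d + r) / d = i := by
  rw [mul_comm, Nat.mul_add_div (by omega), Nat.div_eq_of_lt hr, add_zero]

theorem digit_mod {d i r : ℕ} (hr : r < d) : (i * d + r) % d = r := by
  rw [mul_comm, Nat.mul_add_mod, Nat.mod_eq_of_lt hr]

theorem digits_entryIndex (i : ℕ) (a b a' b' : Fin d) :
    entryIndex d i a b a' b' / d ^ 4 = i ∧ entryIndex d i a b a' b' / d ^ 3 % d = a ∧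
      entryIndex d i a b a' b' / d ^ 2 % d = b ∧ entryIndex d i a b a' b' / d ^ 1 % d = a' ∧
      entryIndex d i a b a' b' / d ^ 0 % d = b' := by
  have e1 : entryIndex d i a b a' b' / d = ((i * d + a) * d + b) * d + a' := digit_div b'.2
  have e2 : entryIndex d i a b a' b' / d ^ 2 = (i * d + a) * d + b := by
    rw [sq, ← Nat.div_div_eq_div_mul, e1, digit_div a'.2]
  have e3 : entryIndex d i a b a' b' / d ^ 3 = i * d + a := by
    rw [pow_succ, ← Nat.div_div_eq_div_mul, e2, digit_div b.2]
  have e4 : entryIndex d i a b a' b' / d ^ 4 = i := by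
    rw [pow_succ, ← Nat.div_div_eq_div_mul, e3, digit_div a.2]
  rw [e4, e3, e2, pow_one, e1, pow_zero, Nat.div_one, entryIndex, digit_mod a.2, digit_mod b.2,
    digit_mod a'.2, digit_mod b'.2]
  exact ⟨rfl, rfl, rfl, rfl, rfl⟩

theorem energySum_eq (y : Data) (K m : ℕ) : y.energySum K (m * y.d ^ 4) =
    ∑ i ∈ range m, ∑ a : Fin y.d, ∑ b : Fin y.d, ∑ a' : Fin y.d, ∑ b' : Fin y.d,
      y.term K (entryIndex y.d i a b a' b') := by
  rw [Data.energySum, show m * y.d ^ 4 = m * y.d * y.d * y.d * y.d by ring, sum_range_mul_digits,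
    sum_range_mul_digits, sum_range_mul_digits, sum_range_mul_digits]
  simp only [Finset.sum_range, entryIndex]

end Verifier

theorem sum_edges {n : ℕ} {G : SimpleGraph (Fin n)} [DecidableRel G.Adj]
    {edges : List (Fin n × Fin n)} (hE : ListsEdges G edges) (f : Fin n × Fin n → ℝ) :
    ∑ i : Fin edges.length, f edges[i] = ∑ e ∈ edgePairs G, f e := by
  have h1 : edges.toFinset = edgePairs G := by
    ext e
    rw [List.mem_toFinset, hE.2, mem_edgePairs]
  rw [← h1, List.sum_toFinset _ hE.1]
  exact Fin.sum_univ_fun_getElem edges f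

theorem length_edges {n : ℕ} {G : SimpleGraph (Fin n)} [DecidableRel G.Adj]
    {edges : List (Fin n × Fin n)} (hE : ListsEdges G edges) :
    edges.length = (edgePairs G).card := by
  have h1 : edges.toFinset = edgePairs G := by
    ext e
    rw [List.mem_toFinset, hE.2, mem_edgePairs]
  rw [← h1, List.toFinset_card_of_nodup hE.1]

end Presentation

/-! ### Accuracy -/

section Accuracy

open Finset

namespace Verifier

/-- The vector of site `i` that is stored in memory. -/
noncomputable def Data.vec (y : Data) (K i a : ℕ) : ℂ :=
  ⟨y.amp K (2 * (i * y.d + a)) / 2 ^ K, y.amp K (2 * (i * y.d + a) + 1) / 2 ^ K⟩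

variable {n d D : ℕ} {edges : List (Fin n × Fin n)}
  {h : Fin n → Fin n → Matrix (Fin d × Fin d) (Fin d × Fin d) ℂ} {α β δ : ℝ} {wit : List Bool}
  {G : SimpleGraph (Fin n)} [DecidableRel G.Adj]

theorem normSum_div_eq (y : Data) (K i : ℕ) : (y.normSum K i (2 * y.d) : ℝ) / (2 ^ K) ^ 2 =
    sqNorm fun a : Fin y.d => y.vec K i a := by
  rw [Data.normSum, mul_comm 2 y.d, sum_range_mul_digits]
  push_cast
  rw [Finset.sum_div, Finset.sum_range, sqNorm]
  refine Finset.sum_congr rfl fun a _ => ?_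
  rw [Finset.sum_range_succ, Finset.sum_range_one, Complex.normSq_apply, Data.vec]
  rw [show y.d * 2 * i + (a * 2 + 0) = 2 * (i * y.d + a) by ring,
    show y.d * 2 * i + (a * 2 + 1) = 2 * (i * y.d + a) + 1 by ring]
  field_simp

theorem weight_eq (y : Data) (K i j : ℕ) (a b a' b' t : ℕ)
    (ha : y.slot 0 t 3 = 2 * (i * y.d + a)) (hb : y.slot 1 t 2 = 2 * (j * y.d + b))
    (ha' : y.slot 0 t 1 = 2 * (i * y.d + a')) (hb' : y.slot 1 t 0 = 2 * (j * y.d + b')) :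
    (⟨y.weightRe K t / (2 ^ K) ^ 4, y.weightIm K t / (2 ^ K) ^ 4⟩ : ℂ) =
      y.vec K i a' * star (y.vec K i a) * (y.vec K j b' * star (y.vec K j b)) := by
  rw [Data.weightRe, Data.weightIm, ha, hb, ha', hb']
  simp only [Data.prodRe, Data.prodIm, Data.vec]
  apply Complex.ext
  · simp only [Complex.mul_re, Complex.mul_im, Complex.star_def, Complex.conj_re, Complex.conj_im]
    push_cast
    field_simp
    ring
  · simp only [Complex.mul_re, Complex.mul_im, Complex.star_def, Complex.conj_re, Complex.conj_im]
    push_cast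
    field_simp
    ring

theorem norm_entry_le_one {A : Matrix (Fin d × Fin d) (Fin d × Fin d) ℂ} (hA : operatorNorm A ≤ 1)
    (p p' : Fin d × Fin d) : ‖A p p'‖ ≤ 1 := by
  have h1 := sum_normSq_col_le hA p'
  have h2 := Finset.single_le_sum (f := fun p => Complex.normSq (A p p'))
    (fun _ _ => Complex.normSq_nonneg _) (Finset.mem_univ p)
  have h3 : ‖A p p'‖ ^ 2 ≤ 1 := by
    rw [← Complex.normSq_eq_norm_sq]
    exact h2.trans h1
  exact (sq_le_one_iff₀ (norm_nonneg _)).1 h3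

/-- The stored amplitudes enter exactly; only the two parts of the matrix entry are rounded, by at
most one unit each, against weights of at most $8\cdot 2^{4K}$. -/
theorem abs_term_sub_le (y : Data) (K : ℕ) {t : ℕ} {z W : ℂ} (hz : ‖z‖ ≤ 1)
    (h3 : y.real (3 + 2 * t) = z.re) (h4 : y.real (4 + 2 * t) = z.im)
    (hW : (⟨y.weightRe K t / (2 ^ K) ^ 4, y.weightIm K t / (2 ^ K) ^ 4⟩ : ℂ) = W) :
    |(y.term K t : ℝ) / (2 ^ K) ^ 5 - (z * W).re| ≤ 16 / 2 ^ K := by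
  have hQ : (0 : ℝ) < 2 ^ K := by positivity
  have hQ1 : (1 : ℝ) ≤ 2 ^ K := one_le_pow₀ (by norm_num)
  have hre : |z.re| ≤ 2 ^ K := (Complex.abs_re_le_norm z).trans (hz.trans hQ1)
  have him : |z.im| ≤ 2 ^ K := (Complex.abs_im_le_norm z).trans (hz.trans hQ1)
  have e1 := abs_fixedPoint_sub_le hre
  have e2 := abs_fixedPoint_sub_le him
  have w1 : |(y.weightRe K t : ℝ)| ≤ 8 * (2 ^ K) ^ 4 := by exact_mod_cast y.abs_weightRe_le K t
  have w2 : |(y.weightIm K t : ℝ)| ≤ 8 * (2 ^ K) ^ 4 := by exact_mod_cast y.abs_weightIm_le K t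
  have e : (y.term K t : ℝ) / (2 ^ K) ^ 5 - (z * W).re =
      (y.weightRe K t * (fixedPoint K z.re - 2 ^ K * z.re) -
        y.weightIm K t * (fixedPoint K z.im - 2 ^ K * z.im)) / (2 ^ K) ^ 5 := by
    rw [← hW, Data.term, h3, h4, Complex.mul_re]
    push_cast
    field_simp
    ring
  rw [e, abs_div, abs_of_pos (by positivity : (0 : ℝ) < (2 ^ K) ^ 5),
    div_le_div_iff₀ (by positivity) hQ]
  have s1 : |(y.weightRe K t : ℝ) * (fixedPoint K z.re - 2 ^ K * z.re)| ≤ 8 * (2 ^ K) ^ 4 * 1 := by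
    rw [abs_mul]
    exact mul_le_mul w1 e1 (abs_nonneg _) (by positivity)
  have s2 : |(y.weightIm K t : ℝ) * (fixedPoint K z.im - 2 ^ K * z.im)| ≤ 8 * (2 ^ K) ^ 4 * 1 := by
    rw [abs_mul]
    exact mul_le_mul w2 e2 (abs_nonneg _) (by positivity)
  calc _ ≤ (8 * (2 ^ K) ^ 4 * 1 + 8 * (2 ^ K) ^ 4 * 1) * 2 ^ K :=
        mul_le_mul_of_nonneg_right ((abs_sub _ _).trans (add_le_add s1 s2)) hQ.le
    _ = _ := by ring

theorem pairTrace_rankOne_re (A : Matrix (Fin d × Fin d) (Fin d × Fin d) ℂ) (u v : Fin d → ℂ) :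
    (pairTrace A (tensorTwo (rankOne u) (rankOne v))).re = ∑ a, ∑ b, ∑ a', ∑ b',
      (A (a, b) (a', b') * (u a' * star (u a) * (v b' * star (v b)))).re := by
  simp only [pairTrace, Fintype.sum_prod_type, Complex.re_sum, tensorTwo, rankOne]

theorem abs_sum_four_le {f : Fin d → Fin d → Fin d → Fin d → ℝ} {c : ℝ}
    (hf : ∀ a b a' b', |f a b a' b'| ≤ c) :
    |∑ a, ∑ b, ∑ a', ∑ b', f a b a' b'| ≤ (d : ℝ) ^ 4 * c := by
  calc _ ≤ ∑ _a : Fin d, ∑ _b : Fin d, ∑ _a' : Fin d, ∑ _b' : Fin d, c :=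
        (Finset.abs_sum_le_sum_abs _ _).trans (Finset.sum_le_sum fun a _ =>
          (Finset.abs_sum_le_sum_abs _ _).trans (Finset.sum_le_sum fun b _ =>
            (Finset.abs_sum_le_sum_abs _ _).trans (Finset.sum_le_sum fun a' _ =>
              (Finset.abs_sum_le_sum_abs _ _).trans (Finset.sum_le_sum fun b' _ =>
                hf a b a' b'))))
    _ = _ := by simp; ring

/-- The energy that the verifier computes is the one of the stored vectors, up to rounding. -/
theorem abs_energySum_sub_le (hE : ListsEdges G edges)
    (hh : ∀ i j, i < j → G.Adj i j → (h i j).IsHermitian ∧ operatorNorm (h i j) ≤ 1) (K : ℕ)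
    {y : Data} (hy : y = dataOf n d D (verifierInput D edges h α β δ wit)) :
    |(y.energySum K ((edgePairs G).card * d ^ 4) : ℝ) / (2 ^ K) ^ 5 -
      productEnergy (edgePairs G) h (fun i => rankOne fun a => y.vec K i a)| ≤
        (edgePairs G).card * ((d : ℝ) ^ 4 * (16 / 2 ^ K)) := by
  have hyd : y.d = d := by rw [hy]; rfl
  have hsum := energySum_eq (dataOf n d D (verifierInput D edges h α β δ wit)) K (edgePairs G).card
  rw [← length_edges hE, Finset.sum_range] at hsum
  rw [← length_edges hE, productEnergy, ← sum_edges hE]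
  subst hy
  set y := dataOf n d D (verifierInput D edges h α β δ wit) with hy
  rw [show y.energySum K (edges.length * d ^ 4) = _ from hsum]
  push_cast
  rw [Finset.sum_div, ← Finset.sum_sub_distrib]
  calc _ ≤ ∑ _i : Fin edges.length, (d : ℝ) ^ 4 * (16 / 2 ^ K) := by
        refine (Finset.abs_sum_le_sum_abs _ _).trans (Finset.sum_le_sum fun i _ => ?_)
        have hadj := (hE.2 edges[i]).1 (List.getElem_mem i.2)
        rw [pairTrace_rankOne_re]
        change |(∑ a : Fin d, ∑ b : Fin d, ∑ a' : Fin d, ∑ b' : Fin d,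
          ((y.term K (entryIndex d i a b a' b') : ℤ) : ℝ)) / (2 ^ K) ^ 5 - _| ≤ _
        simp only [Finset.sum_div, ← Finset.sum_sub_distrib]
        refine abs_sum_four_le fun a b a' b' => ?_
        obtain ⟨d4, d3, d2, d1, d0⟩ := digits_entryIndex i a b a' b'
        refine abs_term_sub_le y K (norm_entry_le_one (hh _ _ hadj.1 hadj.2).2 _ _)
          (real_entry i.2 a b a' b' (s := 0) (by norm_num))
          (real_entry i.2 a b a' b' (s := 1) (by norm_num))
          (weight_eq y K (edges[i]).1 (edges[i]).2 a b a' b' _ ?_ ?_ ?_ ?_)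
        all_goals
          rw [Data.slot, show y.d = d from rfl, d4]
        · rw [d3, vertex_fst i.2]; rfl
        · rw [d2, vertex_snd i.2]; rfl
        · rw [d1, vertex_fst i.2]; rfl
        · rw [d0, vertex_snd i.2]; rfl
    _ = _ := by simp

theorem norm_vec_sub_le {u v : ℂ} {ε : ℝ} (hre : |u.re - v.re| ≤ ε) (him : |u.im - v.im| ≤ ε) :
    ‖u - v‖ ≤ 2 * ε := by
  refine (Complex.norm_le_abs_re_add_abs_im _).trans ?_
  rw [Complex.sub_re, Complex.sub_im]
  linarith

theorem norm_mul_sub_mul_le {a b a' b' : ℂ} {A B ε η : ℝ} (ha : ‖a‖ ≤ A) (hb' : ‖b'‖ ≤ B)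
    (hε : ‖a - a'‖ ≤ ε) (hη : ‖b - b'‖ ≤ η) : ‖a * b - a' * b'‖ ≤ A * η + ε * B := by
  have e : a * b - a' * b' = a * (b - b') + (a - a') * b' := by ring
  rw [e]
  refine (norm_add_le _ _).trans ?_
  rw [norm_mul, norm_mul]
  exact add_le_add (mul_le_mul ha hη (norm_nonneg _) ((norm_nonneg _).trans ha))
    (mul_le_mul hε hb' (norm_nonneg _) ((norm_nonneg _).trans hε))

/-- Product energies depend continuously on the vectors. -/
theorem abs_productEnergy_sub_le
    (hh : ∀ i j, i < j → G.Adj i j → (h i j).IsHermitian ∧ operatorNorm (h i j) ≤ 1)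
    {u v : Fin n → Fin d → ℂ} {ε : ℝ} (hu : ∀ i a, ‖u i a‖ ≤ 2) (hv : ∀ i a, ‖v i a‖ ≤ 2)
    (huv : ∀ i a, ‖u i a - v i a‖ ≤ ε) :
    |productEnergy (edgePairs G) h (fun i => rankOne (u i)) -
      productEnergy (edgePairs G) h (fun i => rankOne (v i))| ≤
        (edgePairs G).card * ((d : ℝ) ^ 4 * (32 * ε)) := by
  rw [productEnergy, productEnergy, ← Finset.sum_sub_distrib]
  calc _ ≤ ∑ _e ∈ edgePairs G, (d : ℝ) ^ 4 * (32 * ε) := by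
        refine (Finset.abs_sum_le_sum_abs _ _).trans (Finset.sum_le_sum fun e he => ?_)
        rw [mem_edgePairs] at he
        rw [pairTrace_rankOne_re, pairTrace_rankOne_re]
        simp only [← Finset.sum_sub_distrib]
        refine abs_sum_four_le fun a b a' b' => ?_
        rw [← Complex.sub_re, ← mul_sub]
        refine (Complex.abs_re_le_norm _).trans ?_
        rw [norm_mul]
        have hpair : ∀ i a a', ‖u i a' * star (u i a) - v i a' * star (v i a)‖ ≤ 2 * ε + ε * 2 :=
          fun i a a' => norm_mul_sub_mul_le (hu i a') (by rw [norm_star]; exact hv i a) (huv i a')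
            (by rw [← star_sub, norm_star]; exact huv i a)
        have hb : ∀ i a a', ‖u i a' * star (u i a)‖ ≤ 2 * 2 := fun i a a' => by
          rw [norm_mul, norm_star]
          exact mul_le_mul (hu i a') (hu i a) (norm_nonneg _) (by norm_num)
        have hb' : ∀ i a a', ‖v i a' * star (v i a)‖ ≤ 2 * 2 := fun i a a' => by
          rw [norm_mul, norm_star]
          exact mul_le_mul (hv i a') (hv i a) (norm_nonneg _) (by norm_num)
        -- Telescoping over the two sites: the pair products have norm at most 4 and differ by at
        -- most $4\varepsilon$, which gives $4\cdot 4\varepsilon + 4\varepsilon\cdot 4 =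
        -- 32\varepsilon$.
        have h1 := norm_mul_sub_mul_le (hb e.1 a a') (hb' e.2 b b') (hpair e.1 a a')
          (hpair e.2 b b')
        have h2 := norm_entry_le_one (hh _ _ he.1 he.2).2 (a, b) (a', b')
        calc _ ≤ 1 * (2 * 2 * (2 * ε + ε * 2) + (2 * ε + ε * 2) * (2 * 2)) :=
              mul_le_mul h2 h1 (norm_nonneg _) (by norm_num)
          _ = _ := by ring
    _ = _ := by simp

/-! #### Encoding vectors -/

/-- The number whose bits encode an amplitude. -/
noncomputable def encode (K : ℕ) (v : ℝ) : ℕ := min (2 ^ K - 1) ⌊(2 : ℝ) ^ K * (1 + v) / 2⌋₊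

theorem encode_lt (K : ℕ) (v : ℝ) : encode K v < 2 ^ K :=
  (min_le_left _ _).trans_lt (Nat.sub_lt (by positivity) one_pos)

/-- The floor costs one unit, doubled by the scaling of amplitudes. The cap in `encode` takes effect
only at `v = 1`, where the floor would need one bit more. -/
theorem abs_encode_sub_le (K : ℕ) {v : ℝ} (hv : |v| ≤ 1) :
    |((2 * (encode K v : ℤ) - 2 ^ K : ℤ) : ℝ) / 2 ^ K - v| ≤ 2 / 2 ^ K := by
  rw [abs_le] at hv
  have hQ : (0 : ℝ) < 2 ^ K := by positivity
  have h0 : 0 ≤ (2 : ℝ) ^ K * (1 + v) / 2 := by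
    have : 0 ≤ 1 + v := by linarith
    positivity
  have h1 := Nat.floor_le h0
  have h2 := Nat.lt_floor_add_one ((2 : ℝ) ^ K * (1 + v) / 2)
  have h3 : (encode K v : ℝ) ≤ ⌊(2 : ℝ) ^ K * (1 + v) / 2⌋₊ :=
    Nat.cast_le.2 (min_le_right _ _)
  have h4 : (2 : ℝ) ^ K * v - 2 ≤ 2 * encode K v - 2 ^ K := by
    rcases min_choice (2 ^ K - 1) ⌊(2 : ℝ) ^ K * (1 + v) / 2⌋₊ with hc | hc
    · rw [encode, hc, Nat.cast_sub Nat.one_le_two_pow]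
      push_cast
      nlinarith
    · rw [encode, hc]
      linarith
  have e : ((2 * (encode K v : ℤ) - 2 ^ K : ℤ) : ℝ) / 2 ^ K - v =
      (2 * encode K v - 2 ^ K - 2 ^ K * v) / 2 ^ K := by
    push_cast
    field_simp
  rw [e, abs_div, abs_of_pos hQ]
  refine div_le_div_of_nonneg_right ?_ hQ.le
  rw [abs_le]
  constructor <;> linarith

/-- With the most significant bit first, the first `l` bits form the leading part `r / 2 ^ (K - l)`.
-/
theorem bitValue_testBit {b : ℕ → Bool} {s K r : ℕ} (hr : r < 2 ^ K)
    (hb : ∀ l < K, b (s + l) = decide (r / 2 ^ (K - 1 - l) % 2 = 1)) {l : ℕ} (hl : l ≤ K) :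
    bitValue b s l = (r / 2 ^ (K - l) : ℕ) := by
  induction l with
  | zero => simp [bitValue, Nat.div_eq_of_lt hr]
  | succ l ih =>
    rw [bitValue, ih (by omega), hb l (by omega)]
    obtain ⟨j, hj⟩ : ∃ j, K = j + (l + 1) := ⟨K - (l + 1), by omega⟩
    rw [show K - l = j + 1 by omega, show K - 1 - l = j by omega, show K - (l + 1) = j by omega,
      pow_succ, ← Nat.div_div_eq_div_mul]
    have := Nat.div_add_mod (r / 2 ^ j) 2
    simp only [decide_eq_true_eq]
    split_ifs <;> omega

/-- The witness in which the number `r q` takes the bits from `q * K` on. -/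
def witness (N K : ℕ) (r : ℕ → ℕ) : List Bool :=
  (List.range (N * K)).map fun c => decide (r (c / K) / 2 ^ (K - 1 - c % K) % 2 = 1)

theorem length_witness (N K : ℕ) (r : ℕ → ℕ) : (witness N K r).length = N * K := by
  simp [witness]

theorem amp_witness {y : Data} {K : ℕ} {r : ℕ → ℕ} (hr : ∀ q, r q < 2 ^ K)
    (hbit : ∀ c, y.bit c = (witness (2 * (y.n * y.d)) K r).getD c false) {q : ℕ}
    (hq : q < 2 * (y.n * y.d)) : y.amp K q = 2 * (r q : ℤ) - 2 ^ K := by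
  have h1 : (q + 1) * K ≤ 2 * (y.n * y.d) * K := Nat.mul_le_mul_right K hq
  rw [add_mul, one_mul] at h1
  have h2 : min K (2 * (y.n * y.d) * K - q * K) = K := min_eq_left (by omega)
  rw [Data.amp, Data.partialRaw, h2, bitValue_testBit (hr q) _ le_rfl]
  · simp
  · intro l hl
    have hlt : q * K + l < (witness (2 * (y.n * y.d)) K r).length := by
      rw [length_witness]; omega
    have hK : 0 < K := by omega
    rw [hbit, List.getD_eq_getElem _ _ hlt]
    simp only [witness, List.getElem_map, List.getElem_range]
    rw [digit_div hl, digit_mod hl]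

end Verifier

end Accuracy

/-! ### Soundness and completeness -/

section Decision

open Finset

theorem fixedPoint_le {K : ℕ} {r : ℝ} (hr : -2 ^ K ≤ r) : (fixedPoint K r : ℝ) ≤ 2 ^ K * r := by
  have h4 : (4 : ℝ) ^ K = 2 ^ K * 2 ^ K := by rw [← mul_pow]; norm_num
  have h2 : (0 : ℝ) < 2 ^ K := by positivity
  rw [fixedPoint]
  push_cast
  refine max_le (by nlinarith) ((min_le_right _ _).trans (Int.floor_le _))

/-- The minimum covers readings that saturate: a very large threshold is then still read as a number
far above every energy. -/
theorem le_fixedPoint (K : ℕ) (r : ℝ) :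
    min ((2 : ℝ) ^ K * 2 ^ K) (2 ^ K * r - 1) ≤ fixedPoint K r := by
  have h4 : (4 : ℝ) ^ K = 2 ^ K * 2 ^ K := by rw [← mul_pow]; norm_num
  rw [fixedPoint]
  push_cast
  refine le_trans ?_ (le_max_right _ _)
  rw [h4]
  exact min_le_min le_rfl (by linarith [Int.lt_floor_add_one ((2 : ℝ) ^ K * r)])

theorem fixedPoint_eq_of_lt {K : ℕ} {r : ℝ} (hr : r < -2 ^ K) :
    (fixedPoint K r : ℝ) = -(2 ^ K * 2 ^ K) := by
  have h4 : (4 : ℝ) ^ K = 2 ^ K * 2 ^ K := by rw [← mul_pow]; norm_num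
  have h2 : (0 : ℝ) < 2 ^ K := by positivity
  rw [fixedPoint]
  push_cast
  rw [← h4]
  refine max_eq_left ((min_le_right _ _).trans ((Int.floor_le _).trans ?_))
  rw [h4]
  nlinarith

variable {n d D : ℕ} {G : SimpleGraph (Fin n)} [DecidableRel G.Adj]
  {h : Fin n → Fin n → Matrix (Fin d × Fin d) (Fin d × Fin d) ℂ}

theorem sqNorm_eq_one_of_normalize {ι : Type*} [Fintype ι] {v : ι → ℂ} (hv : 0 < sqNorm v) :
    sqNorm (fun a => (((Real.sqrt (sqNorm v))⁻¹ : ℝ) : ℂ) * v a) = 1 := by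
  rw [sqNorm_smul, inv_pow, Real.sq_sqrt hv.le, inv_mul_cancel₀ hv.ne']

theorem rankOne_eq_smul_normalize {v : Fin d → ℂ} (hv : 0 < sqNorm v) :
    rankOne v = fun a a' => ∑ _x : Unit, ((sqNorm v : ℝ) : ℂ) *
      rankOne (fun a => (((Real.sqrt (sqNorm v))⁻¹ : ℝ) : ℂ) * v a) a a' := by
  funext a a'
  have e : ((sqNorm v : ℝ) : ℂ) * ((((Real.sqrt (sqNorm v))⁻¹ : ℝ) : ℂ) *
      (((Real.sqrt (sqNorm v))⁻¹ : ℝ) : ℂ)) = 1 := by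
    rw [← Complex.ofReal_mul, ← Complex.ofReal_mul, ← mul_inv,
      Real.mul_self_sqrt hv.le, mul_inv_cancel₀ hv.ne', Complex.ofReal_one]
  simp only [rankOne, star_mul', show ∀ c : ℝ, star (c : ℂ) = c from Complex.conj_ofReal,
    Finset.univ_unique, Finset.sum_singleton]
  linear_combination (-(v a * star (v a'))) * e

/-- Almost normalized product vectors have almost at least the ground-state energy. -/
theorem groundEnergy_le_of_almost_normalized (hn : 0 < n) (hd : 0 < d) (hD : 0 < D)
    (hG : G.IsRegularOfDegree D)
    (hh : ∀ i j, i < j → G.Adj i j → (h i j).IsHermitian ∧ operatorNorm (h i j) ≤ 1)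
    {v : Fin n → Fin d → ℂ} {η : ℝ} (hη : η < 1) (hv : ∀ i, |sqNorm (v i) - 1| ≤ η) :
    groundEnergy (edgeHamiltonian D G h) ≤
      2 / ((n : ℝ) * D) * productEnergy (edgePairs G) h (fun i => rankOne (v i)) + 3 * η := by
  have hpos : ∀ i, 0 < sqNorm (v i) := fun i => by
    have := abs_le.1 (hv i)
    linarith
  set u : Fin n → Fin d → ℂ :=
    fun i a => (((Real.sqrt (sqNorm (v i)))⁻¹ : ℝ) : ℂ) * v i a with hu
  have hu1 : ∀ i, sqNorm (u i) = 1 := fun i => sqNorm_eq_one_of_normalize (hpos i)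
  have hE := groundEnergy_le_productEnergy hn hd hD hG hh hu1
  have hclose : productEnergy (edgePairs G) h (fun i => rankOne (u i)) ≤
      productEnergy (edgePairs G) h (fun i => rankOne (v i)) + (edgePairs G).card * (3 * η) := by
    rw [productEnergy, productEnergy, ← nsmul_eq_mul, ← Finset.sum_const, ← Finset.sum_add_distrib]
    refine Finset.sum_le_sum fun e he => ?_
    rw [mem_edgePairs] at he
    have h1 := abs_pairTrace_rankOne_le (hh _ _ he.1 he.2).2 (u e.1) (u e.2)
    rw [hu1, hu1, one_mul] at h1
    rw [rankOne_eq_smul_normalize (hpos e.1), pairTrace_tensorTwo_sum_left _ (fun _ => _),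
      Finset.univ_unique, Finset.sum_singleton, rankOne_eq_smul_normalize (hpos e.2),
      pairTrace_tensorTwo_sum_right _ (fun _ => _), Finset.univ_unique, Finset.sum_singleton]
    change _ ≤ sqNorm (v e.1) * (sqNorm (v e.2) *
      (pairTrace (h e.1 e.2) (tensorTwo (rankOne (u e.1)) (rankOne (u e.2)))).re) + 3 * η
    generalize (pairTrace (h e.1 e.2) (tensorTwo (rankOne (u e.1)) (rankOne (u e.2)))).re = p at h1 ⊢
    have h2 := abs_le.1 (hv e.1)
    have h3 := abs_le.1 (hv e.2)
    -- The deviation is at most $2\eta+\eta^2$, and $\eta<1$.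
    have h4 : |sqNorm (v e.1) * sqNorm (v e.2) - 1| ≤ 3 * η := by
      rw [abs_le]
      constructor <;> nlinarith
    have h5 : |(sqNorm (v e.1) * sqNorm (v e.2) - 1) * p| ≤ 3 * η * 1 := by
      rw [abs_mul]
      exact mul_le_mul h4 h1 (abs_nonneg _) ((abs_nonneg _).trans h4)
    have h6 := (abs_le.1 h5).1
    nlinarith
  have hc := two_div_mul_card_edgePairs hn hD hG
  have h0 : 0 ≤ 2 / ((n : ℝ) * D) := by positivity
  have := mul_le_mul_of_nonneg_left hclose h0
  rw [mul_add, ← mul_assoc, hc, one_mul] at this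
  linarith

namespace Verifier

variable {edges : List (Fin n × Fin n)} {α β δ : ℝ} {wit : List Bool}

/-- The energy estimate of the verifier. -/
noncomputable def Data.estimate (y : Data) (K : ℕ) : ℝ :=
  2 / ((y.n : ℝ) * y.D) * ((y.energySum K y.entries : ℝ) / (2 ^ K) ^ 5)

/-- The integer test with denominators cleared; the added 1 turns `≤` into positivity. The threshold
$\beta-\delta/2$ leaves room for rounding on both sides. -/
theorem good_iff {y : Data} (hn : 0 < y.n) (hD : 0 < y.D) (K : ℕ) :
    y.Good K ↔ (∀ i < y.n, ¬ y.NormBad K i) ∧ y.estimate K ≤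
      (fixedPoint K (y.real 1) : ℝ) / 2 ^ K - (fixedPoint K (y.real 2) : ℝ) / 2 ^ K / 2 := by
  have hn' : (0 : ℝ) < y.n := by exact_mod_cast hn
  have hD' : (0 : ℝ) < y.D := by exact_mod_cast hD
  rw [Data.Good]
  refine and_congr_right fun _ => ?_
  rw [show ∀ a b : ℤ, 0 < a + 1 - b ↔ b ≤ a by intro a b; omega,
    ← Int.cast_le (R := ℝ), Data.estimate]
  push_cast
  generalize (y.energySum K y.entries : ℝ) = S
  generalize (fixedPoint K (y.real 1) : ℝ) = b
  generalize (fixedPoint K (y.real 2) : ℝ) = e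
  have e1 : b / 2 ^ K - e / 2 ^ K / 2 - 2 / ((y.n : ℝ) * y.D) * (S / (2 ^ K) ^ 5) =
      (y.n * y.D * (2 ^ K) ^ 4 * (2 * b - e) - 4 * S) / (2 * y.n * y.D * (2 ^ K) ^ 5) := by
    field_simp
    ring
  rw [← sub_nonneg, ← sub_nonneg (b := 2 / ((y.n : ℝ) * y.D) * (S / (2 ^ K) ^ 5)), e1,
    le_div_iff₀ (by positivity), zero_mul]

theorem normBad_iff (y : Data) (K i : ℕ) : ¬ y.NormBad K i ↔
    |(sqNorm fun a : Fin y.d => y.vec K i a) - 1| ≤ 8 * y.d / 2 ^ K := by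
  rw [← normSum_div_eq, Data.NormBad, not_lt, sub_nonpos, sq_le_sq, ← Int.cast_le (R := ℝ)]
  push_cast
  rw [abs_of_nonneg (by positivity : (0 : ℝ) ≤ 8 * y.d * 2 ^ K),
    show (y.normSum K i (2 * y.d) : ℝ) / (2 ^ K) ^ 2 - 1 =
      (y.normSum K i (2 * y.d) - 2 ^ K * 2 ^ K) / (2 ^ K) ^ 2 by field_simp, abs_div,
    abs_of_pos (by positivity : (0 : ℝ) < (2 ^ K) ^ 2),
    div_le_div_iff₀ (by positivity) (by positivity)]
  constructor
  · intro h1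
    calc _ ≤ 8 * (y.d : ℝ) * 2 ^ K * 2 ^ K := mul_le_mul_of_nonneg_right h1 (by positivity)
      _ = _ := by ring
  · intro h1
    refine le_of_mul_le_mul_right (h1.trans_eq ?_) (by positivity : (0 : ℝ) < 2 ^ K)
    ring

theorem abs_estimate_sub_le (hn : 0 < n) (hD : 0 < D) (hG : G.IsRegularOfDegree D)
    (hE : ListsEdges G edges)
    (hh : ∀ i j, i < j → G.Adj i j → (h i j).IsHermitian ∧ operatorNorm (h i j) ≤ 1) (K : ℕ)
    {y : Data} (hy : y = dataOf n d D (verifierInput D edges h α β δ wit)) :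
    |y.estimate K - 2 / ((n : ℝ) * D) *
      productEnergy (edgePairs G) h (fun i => rankOne fun a => y.vec K i a)| ≤
        16 * ((d : ℝ) ^ 4 / 2 ^ K) := by
  have h1 := abs_energySum_sub_le hE hh K hy
  have hc := two_div_mul_card_edgePairs hn hD hG
  have h0 : 0 ≤ 2 / ((n : ℝ) * D) := by positivity
  have hent : y.entries = (edgePairs G).card * d ^ 4 := by
    rw [hy]
    change n * D / 2 * d ^ 4 = _
    rw [← two_mul_card_edgePairs hG, Nat.mul_div_cancel_left _ (by norm_num)]
  have e : y.estimate K = 2 / ((n : ℝ) * D) *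
      ((y.energySum K ((edgePairs G).card * d ^ 4) : ℝ) / (2 ^ K) ^ 5) := by
    rw [Data.estimate, hent, hy]
    rfl
  rw [e, ← mul_sub, abs_mul, abs_of_nonneg h0]
  calc _ ≤ 2 / ((n : ℝ) * D) * ((edgePairs G).card * ((d : ℝ) ^ 4 * (16 / 2 ^ K))) :=
        mul_le_mul_of_nonneg_left h1 h0
    _ = 2 / ((n : ℝ) * D) * (edgePairs G).card * ((d : ℝ) ^ 4 * (16 / 2 ^ K)) := by ring
    _ = _ := by rw [hc]; ring

/-- If the ground-state energy is at least `β`, no witness passes the test. -/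
theorem not_good (hn : 0 < n) (hd : 0 < d) (hD : 0 < D) (hG : G.IsRegularOfDegree D)
    (hE : ListsEdges G edges)
    (hh : ∀ i j, i < j → G.Adj i j → (h i j).IsHermitian ∧ operatorNorm (h i j) ≤ 1)
    (hδ : 0 < δ) (hδ1 : δ ≤ 1) {K : ℕ} (hK : 4096 * (d : ℝ) ^ 4 ≤ 2 ^ K * δ)
    (hβ : β ≤ groundEnergy (edgeHamiltonian D G h)) {y : Data}
    (hy : y = dataOf n d D (verifierInput D edges h α β δ wit)) : ¬ y.Good K := by
  have hyn : y.n = n := by rw [hy]; rfl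
  have hyd : y.d = d := by rw [hy]; rfl
  have hyD : y.D = D := by rw [hy]; rfl
  have hQ : (0 : ℝ) < 2 ^ K := by positivity
  have hd1 : (1 : ℝ) ≤ d := by exact_mod_cast hd
  have hd4 : (d : ℝ) ≤ (d : ℝ) ^ 4 := le_self_pow₀ hd1 (by norm_num)
  have hq : (d : ℝ) ^ 4 / 2 ^ K ≤ δ / 4096 := by
    rw [div_le_div_iff₀ hQ (by norm_num)]
    linarith
  have hq1 : (d : ℝ) / 2 ^ K ≤ (d : ℝ) ^ 4 / 2 ^ K := div_le_div_of_nonneg_right hd4 hQ.le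
  have hq2 : 1 / (2 : ℝ) ^ K ≤ d / 2 ^ K := div_le_div_of_nonneg_right hd1 hQ.le
  intro hgood
  rw [good_iff (by omega) (by omega)] at hgood
  obtain ⟨hnorm, hest⟩ := hgood
  have hreal1 : y.real 1 = β := by rw [hy]; rfl
  have hreal2 : y.real 2 = δ := by rw [hy]; rfl
  rw [hreal1, hreal2] at hest
  have hv : ∀ i : Fin n, |(sqNorm fun a : Fin d => y.vec K i a) - 1| ≤ 8 * d / 2 ^ K := by
    intro i
    have := (normBad_iff y K i).1 (hnorm i (by rw [hyn]; exact i.2))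
    subst hy
    exact this
  have h8 : 8 * (d : ℝ) / 2 ^ K = 8 * (d / 2 ^ K) := by ring
  rw [h8] at hv
  have h1 := groundEnergy_le_of_almost_normalized hn hd hD hG hh (by linarith) hv
  have h2 := (abs_le.1 (abs_estimate_sub_le hn hD hG hE hh K hy)).1
  have h3 := (abs_le.1 (abs_groundEnergy_le hn hd hD hG hh)).1
  have h4 : δ - 1 / 2 ^ K ≤ (fixedPoint K δ : ℝ) / 2 ^ K := by
    have h5 := (abs_le.1 (abs_fixedPoint_sub_le (k := K) (r := δ)
      (by rw [abs_of_pos hδ]; exact hδ1.trans (one_le_pow₀ (by norm_num))))).1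
    rw [le_div_iff₀ hQ, sub_mul, div_mul_cancel₀ _ hQ.ne']
    linarith
  -- If the reading of `β` does not saturate, norms, matrix entries and `δ` contribute at most $24 +
  -- 16 + 1/2$ units of $d^4/2^K \le \delta/4096$, less than $\delta/2$. If it saturates at the
  -- lower end, the threshold is at most $-2^K \le -4096$, which no estimate reaches.
  by_cases hb : -2 ^ K ≤ β
  · have h5 : (fixedPoint K β : ℝ) / 2 ^ K ≤ β := by
      rw [div_le_iff₀ hQ, mul_comm]
      exact fixedPoint_le hb
    linarith
  · have h5 : (fixedPoint K β : ℝ) / 2 ^ K = -2 ^ K := by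
      rw [fixedPoint_eq_of_lt (not_le.1 hb)]
      field_simp
    have hQ1 : (4096 : ℝ) ≤ 2 ^ K := by nlinarith [one_le_pow₀ hd1 (n := 4)]
    linarith

/-- If a product state has energy well below `β`, then there is a witness that passes the test. -/
theorem exists_good (hn : 0 < n) (hd : 0 < d) (hD : 0 < D) (hG : G.IsRegularOfDegree D)
    (hE : ListsEdges G edges)
    (hh : ∀ i j, i < j → G.Adj i j → (h i j).IsHermitian ∧ operatorNorm (h i j) ≤ 1)
    (hδ : 0 < δ) (hδ1 : δ ≤ 1) {K : ℕ} (hK : 4096 * (d : ℝ) ^ 4 ≤ 2 ^ K * δ)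
    {u : Fin n → Fin d → ℂ} (hu : ∀ i, sqNorm (u i) = 1)
    (huE : 2 / ((n : ℝ) * D) * productEnergy (edgePairs G) h (fun i => rankOne (u i)) ≤
      β - 9 / 10 * δ) :
    ∃ wit : List Bool, wit.length = 2 * (n * d) * K ∧
      (dataOf n d D (verifierInput D edges h α β δ wit)).Good K := by
  have hQ : (0 : ℝ) < 2 ^ K := by positivity
  have hd1 : (1 : ℝ) ≤ d := by exact_mod_cast hd
  have hd4 : (d : ℝ) ≤ (d : ℝ) ^ 4 := le_self_pow₀ hd1 (by norm_num)
  have hq : (d : ℝ) ^ 4 / 2 ^ K ≤ δ / 4096 := by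
    rw [div_le_div_iff₀ hQ (by norm_num)]
    linarith
  have hq1 : (d : ℝ) / 2 ^ K ≤ (d : ℝ) ^ 4 / 2 ^ K := div_le_div_of_nonneg_right hd4 hQ.le
  have hq2 : 1 / (2 : ℝ) ^ K ≤ d / 2 ^ K := div_le_div_of_nonneg_right hd1 hQ.le
  have hnorm1 : ∀ i a, ‖u i a‖ ≤ 1 := by
    intro i a
    have h1 := Finset.single_le_sum (f := fun a => Complex.normSq (u i a))
      (fun _ _ => Complex.normSq_nonneg _) (Finset.mem_univ a)
    rw [show ∑ a, Complex.normSq (u i a) = 1 from hu i, Complex.normSq_eq_norm_sq] at h1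
    exact (sq_le_one_iff₀ (norm_nonneg _)).1 h1
  -- The order in which the verifier reads: by site, then by level, real part before imaginary part.
  set part : ℕ → ℝ := fun q =>
    if hq : q < 2 * (n * d) then
      let z := u ⟨q / 2 / d, by
        rw [Nat.div_div_eq_div_mul]
        exact Nat.div_lt_of_lt_mul (by linarith)⟩ ⟨q / 2 % d, Nat.mod_lt _ hd⟩
      if q % 2 = 0 then z.re else z.im
    else 0 with hpart
  have hidx : ∀ (i : Fin n) (a : Fin d), 2 * (i * d + a) + 1 < 2 * (n * d) := fun i a => by
    have := mul_add_lt i a.2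
    omega
  have hpart0 : ∀ (i : Fin n) (a : Fin d), part (2 * (i * d + a)) = (u i a).re := by
    intro i a
    have h1 := hidx i a
    simp only [hpart]
    rw [dif_pos (by omega)]
    simp only [Nat.mul_mod_right, if_true, Nat.mul_div_cancel_left _ (zero_lt_two),
      digit_div a.2, digit_mod a.2]
  have hpart1 : ∀ (i : Fin n) (a : Fin d), part (2 * (i * d + a) + 1) = (u i a).im := by
    intro i a
    have h1 := hidx i a
    simp only [hpart]
    rw [dif_pos h1]
    simp only [show (2 * ((i : ℕ) * d + a) + 1) % 2 = 1 by omega, one_ne_zero, if_false,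
      show (2 * ((i : ℕ) * d + a) + 1) / 2 = i * d + a by omega, digit_div a.2, digit_mod a.2]
  refine ⟨witness (2 * (n * d)) K fun q => encode K (part q), length_witness _ _ _, ?_⟩
  set y := dataOf n d D (verifierInput D edges h α β δ
    (witness (2 * (n * d)) K fun q => encode K (part q))) with hy
  have hamp : ∀ q, q < 2 * (n * d) → y.amp K q = 2 * (encode K (part q) : ℤ) - 2 ^ K :=
    fun q hq => amp_witness (y := y) (r := fun q => encode K (part q)) (fun q => encode_lt K _)
      (fun c => rfl) hq
  have hre : ∀ (i : Fin n) (a : Fin d), |(y.vec K i a).re - (u i a).re| ≤ 2 / 2 ^ K := by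
    intro i a
    have h1 := abs_encode_sub_le K ((Complex.abs_re_le_norm (u i a)).trans (hnorm1 i a))
    rw [← hpart0, ← hamp _ (by have := hidx i a; omega)] at h1
    rw [← hpart0]
    exact h1
  have him : ∀ (i : Fin n) (a : Fin d), |(y.vec K i a).im - (u i a).im| ≤ 2 / 2 ^ K := by
    intro i a
    have h1 := abs_encode_sub_le K ((Complex.abs_im_le_norm (u i a)).trans (hnorm1 i a))
    rw [← hpart1, ← hamp _ (hidx i a)] at h1
    rw [← hpart1]
    exact h1
  have hamp1 : ∀ q, |(y.amp K q : ℝ) / 2 ^ K| ≤ 1 := by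
    intro q
    rw [abs_div, abs_of_pos hQ, div_le_one hQ]
    exact_mod_cast y.abs_amp_le K q
  have hvec2 : ∀ (i : Fin n) (a : Fin d), ‖y.vec K i a‖ ≤ 2 := fun i a =>
    (Complex.norm_le_abs_re_add_abs_im _).trans
      ((add_le_add (hamp1 _) (hamp1 _)).trans_eq (by norm_num))
  rw [good_iff hn hD]
  refine ⟨fun i hi => (normBad_iff y K i).2 ?_, ?_⟩
  · change |(sqNorm fun a : Fin d => y.vec K i a) - 1| ≤ 8 * d / 2 ^ K
    rw [← hu ⟨i, hi⟩, sqNorm, sqNorm, ← Finset.sum_sub_distrib]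
    have hsq : ∀ s t ε : ℝ, |s| ≤ 1 → |t| ≤ 1 → |s - t| ≤ ε → |s * s - t * t| ≤ ε * 2 := by
      intro s t ε hs ht hst
      rw [show s * s - t * t = (s - t) * (s + t) by ring, abs_mul]
      exact mul_le_mul hst ((abs_add_le _ _).trans (by linarith)) (abs_nonneg _)
        ((abs_nonneg _).trans hst)
    -- Each of the `d` coordinates contributes at most $8/2^K$, exactly the tolerance of the norm
    -- test.
    calc _ ≤ ∑ _a : Fin d, (2 / 2 ^ K * 2 + 2 / 2 ^ K * 2 : ℝ) := by
          refine (Finset.abs_sum_le_sum_abs _ _).trans (Finset.sum_le_sum fun a _ => ?_)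
          rw [Complex.normSq_apply, Complex.normSq_apply, add_sub_add_comm]
          exact (abs_add_le _ _).trans (add_le_add
            (hsq _ _ _ (hamp1 _) ((Complex.abs_re_le_norm _).trans (hnorm1 _ _))
              (hre ⟨i, hi⟩ a))
            (hsq _ _ _ (hamp1 _) ((Complex.abs_im_le_norm _).trans (hnorm1 _ _))
              (him ⟨i, hi⟩ a)))
      _ = _ := by simp; ring
  · change y.estimate K ≤ (fixedPoint K β : ℝ) / 2 ^ K - (fixedPoint K δ : ℝ) / 2 ^ K / 2
    have h1 := (abs_le.1 (abs_estimate_sub_le hn hD hG hE hh K hy)).2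
    have h2 := (abs_le.1 (abs_productEnergy_sub_le hh (u := fun (i : Fin n) (a : Fin d) => y.vec K i a)
      hvec2 (fun i a => (hnorm1 i a).trans (by norm_num))
      (fun i a => norm_vec_sub_le (hre i a) (him i a)))).2
    have hc := two_div_mul_card_edgePairs hn hD hG
    have h0 : 0 ≤ 2 / ((n : ℝ) * D) := by positivity
    have h3 := mul_le_mul_of_nonneg_left h2 h0
    rw [mul_sub, ← mul_assoc, hc, one_mul,
      show (d : ℝ) ^ 4 * (32 * (2 * (2 / 2 ^ K))) = 128 * ((d : ℝ) ^ 4 / 2 ^ K) by ring] at h3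
    have h4 : 2 / ((n : ℝ) * D) * productEnergy (edgePairs G) h (fun i => rankOne (u i)) ≤ 1 := by
      rw [← hc]
      refine mul_le_mul_of_nonneg_left ?_ h0
      rw [productEnergy, Finset.cast_card]
      refine Finset.sum_le_sum fun e he => ?_
      rw [mem_edgePairs] at he
      have := (abs_le.1 (abs_pairTrace_rankOne_le (hh _ _ he.1 he.2).2 (u e.1) (u e.2))).2
      rwa [hu, hu, one_mul] at this
    have h5 : (fixedPoint K δ : ℝ) / 2 ^ K ≤ δ := by
      rw [div_le_iff₀ hQ, mul_comm]
      exact fixedPoint_le (by linarith)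
    have h6 : min ((2 : ℝ) ^ K) (β - 1 / 2 ^ K) ≤ (fixedPoint K β : ℝ) / 2 ^ K := by
      rw [le_div_iff₀ hQ, min_mul_of_nonneg _ _ hQ.le, sub_mul, div_mul_cancel₀ _ hQ.ne',
        mul_comm β]
      exact le_fixedPoint K β
    have hQ1 : (4096 : ℝ) ≤ 2 ^ K := by nlinarith [one_le_pow₀ hd1 (n := 4)]
    -- When the reading of `β` saturates, the threshold is near $2^K$ or above, while product
    -- energies are at most 1 (`h4`). Otherwise the slack $\frac{9}{10}\delta-\frac12\delta$ exceeds
    -- the $128+16+1$ units of $d^4/2^K$ lost by rounding.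
    rcases min_choice ((2 : ℝ) ^ K) (β - 1 / 2 ^ K) with hc' | hc' <;> rw [hc'] at h6 <;> linarith

end Verifier

end Decision


/-! ### The decision problem -/

namespace Verifier

variable {n d D : ℕ} {G : SimpleGraph (Fin n)} [DecidableRel G.Adj]
  {edges : List (Fin n × Fin n)}
  {h : Fin n → Fin n → Matrix (Fin d × Fin d) (Fin d × Fin d) ℂ} {α β δ : ℝ}

theorem eight_lt_fixedPoint {r : ℝ} (hr : 2 ≤ r) : 8 < fixedPoint 3 r := by
  have h1 := le_fixedPoint 3 r
  rw [← Int.cast_lt (R := ℝ)]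
  refine lt_of_lt_of_le (lt_min ?_ ?_) h1
  · norm_num
  · push_cast
    linarith

theorem fixedPoint_le_eight {r : ℝ} (hr : r ≤ 1) : fixedPoint 3 r ≤ 8 := by
  rw [← Int.cast_le (R := ℝ)]
  rcases lt_or_ge r (-2 ^ 3) with h1 | h1
  · rw [fixedPoint_eq_of_lt h1]
    norm_num
  · refine (fixedPoint_le h1).trans ?_
    push_cast
    linarith

/-- From $\ln d \ge 1-1/d$ follows $d\ln d \ge d-1$. When there are more levels than the degree,
this forces the promise gap to be at least 12. -/
theorem one_le_sq_mul_log_div (hd : D < d) (hD : 0 < D) :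
    1 ≤ (d : ℝ) ^ 2 * Real.log d / D := by
  have hD' : (0 : ℝ) < D := by exact_mod_cast hD
  have hd' : (D : ℝ) < d := by exact_mod_cast hd
  have hd2 : (2 : ℝ) ≤ d := by exact_mod_cast (by omega : 2 ≤ d)
  have hlog := Real.one_sub_inv_le_log_of_pos (by linarith : (0 : ℝ) < d)
  have h2 : (d : ℝ) * (1 - (d : ℝ)⁻¹) = d - 1 := by
    field_simp
  rw [le_div_iff₀ hD', one_mul]
  calc (D : ℝ) ≤ d * (d * (1 - (d : ℝ)⁻¹)) := by rw [h2]; nlinarith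
    _ ≤ d * (d * Real.log d) := by gcongr
    _ = _ := by ring

/-- Since $n \ge 2$ and $d < n$, constants and powers of `d` are absorbed into powers of $n \le
n/\delta$, giving $2^K \le (n/\delta)^{18}$; the bound $\ln 2 > 1/2$ doubles the exponent. Here `d <
n` is essential. -/
theorem precision_le (hdn : d < n) (hd : 0 < d) (hδ : 0 < δ) (hδ1 : δ ≤ 1) {K : ℕ}
    (hK : 2 ^ K * δ < 2 * ((4096 * d ^ 4 : ℕ) : ℝ)) :
    (K : ℝ) ≤ 36 * Real.log (n / δ) := by
  have hd' : (0 : ℝ) < d := by exact_mod_cast hd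
  have hn2 : (2 : ℝ) ≤ n := by exact_mod_cast (by omega : 2 ≤ n)
  have hdn' : (d : ℝ) ≤ n := by exact_mod_cast hdn.le
  set r : ℝ := n / δ with hr
  have hnr : (n : ℝ) ≤ r := by
    rw [hr, le_div_iff₀ hδ]
    nlinarith
  have h1 : (2 : ℝ) ^ K ≤ r ^ 18 := by
    push_cast at hK
    calc (2 : ℝ) ^ K ≤ 2 ^ 13 * d ^ 4 / δ := by
          rw [le_div_iff₀ hδ]
          linarith
      _ ≤ 2 ^ 13 * n ^ 4 / δ := by gcongr
      _ ≤ n ^ 13 * n ^ 4 / δ := by gcongr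
      _ = n ^ 16 * r := by rw [hr]; ring
      _ ≤ r ^ 16 * r := by gcongr
      _ ≤ r ^ 16 * r * r := le_mul_of_one_le_right (by positivity) (by linarith)
      _ = r ^ 18 := by ring
  have h2 := Real.log_le_log (by positivity) h1
  rw [Real.log_pow, Real.log_pow] at h2
  push_cast at h2
  nlinarith [Real.log_two_gt_d9]

/-- In the yes case there is a product state whose energy is well below `β`. -/
theorem exists_productEnergy_le_sub (hn : 0 < n) (hd : 0 < d) (hD : 0 < D)
    (hG : G.IsRegularOfDegree D)
    (hh : ∀ i j, i < j → G.Adj i j → (h i j).IsHermitian ∧ operatorNorm (h i j) ≤ 1)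
    (hδ : 0 < δ)
    (hβ : β - α ≥ 12 * (((d : ℝ) ^ 2 * Real.log d / D) ^ ((1 : ℝ) / 3)) + δ)
    (hα : groundEnergy (edgeHamiltonian D G h) ≤ α) :
    ∃ u : Fin n → Fin d → ℂ, (∀ i, sqNorm (u i) = 1) ∧
      2 / ((n : ℝ) * D) * productEnergy (edgePairs G) h (fun i => rankOne (u i)) ≤
        β - 9 / 10 * δ := by
  have hd' : (0 : ℝ) < d := by exact_mod_cast hd
  have hD' : (0 : ℝ) < D := by exact_mod_cast hD
  have hd1 : (1 : ℝ) ≤ d := by exact_mod_cast hd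
  have hX : 0 ≤ (d : ℝ) ^ 2 * Real.log d / D :=
    div_nonneg (mul_nonneg (by positivity) (Real.log_nonneg hd1)) hD'.le
  set γ := ((d : ℝ) ^ 2 * Real.log d / D) ^ ((1 : ℝ) / 3) with hγ
  have hγ0 : 0 ≤ γ := Real.rpow_nonneg hX _
  have hγ3 : γ ^ 3 = (d : ℝ) ^ 2 * Real.log d / D := by
    rw [hγ, ← Real.rpow_natCast, ← Real.rpow_mul hX]
    norm_num
  have hlog := Real.one_sub_inv_le_log_of_pos hd'
  -- The summand `δ / 100` keeps the parameter positive when `d = 1`, where `γ` vanishes.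
  have hg : (d : ℝ) ^ 2 * (1 - 1 / d) ≤ (γ + δ / 100) ^ 3 * D := by
    calc (d : ℝ) ^ 2 * (1 - 1 / d) ≤ (d : ℝ) ^ 2 * Real.log d := by
          rw [one_div]
          gcongr
      _ = γ ^ 3 * D := by rw [hγ3, div_mul_cancel₀ _ hD'.ne']
      _ ≤ _ := by gcongr; linarith
  obtain ⟨ψ, hψ, hψE⟩ := exists_expectation_lt hd (lt_of_le_of_lt hα
    (by linarith : α < α + δ / 100))
  obtain ⟨u, hu, huE⟩ := exists_productEnergy_le hn hd hD hG hh hψ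
    (by positivity : 0 < γ + δ / 100) hg
  -- The total loss is $7(\gamma+\delta/100)+\delta/100 = 7\gamma+\frac{8}{100}\delta$, well within
  -- the promised $12\gamma+\delta$.
  exact ⟨u, hu, by linarith⟩

end Verifier

theorem mainTheorem5 :
    ∃ (verifier : RamProg) (C : ℝ) (c : ℕ),
      ∀ (n d D : ℕ) (G : SimpleGraph (Fin n)) [DecidableRel G.Adj]
        (edges : List (Fin n × Fin n))
        (h : Fin n → Fin n → Matrix (Fin d × Fin d) (Fin d × Fin d) ℂ) (α β δ : ℝ),
        0 < n → 0 < d → 0 < D → G.IsRegularOfDegree D → ListsEdges G edges →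
        (∀ i j, i < j → G.Adj i j → (h i j).IsHermitian ∧ operatorNorm (h i j) ≤ 1) →
        0 < δ → δ ≤ 1 →
        β - α ≥ 12 * (((d : ℝ) ^ 2 * Real.log d / D) ^ ((1 : ℝ) / 3)) + δ →
        -- the verifier is fast on every witness string
        (∀ wit : List Bool,
          HaltsWithin (wordLength n d) verifier (verifierInput D edges h α β δ wit)
            (C * ((n : ℝ) * D * (d : ℝ) ^ 4) * (1 + Real.log (1 / δ)) ^ c)) ∧
        -- in the yes case there is a short witness that is accepted
        (groundEnergy (edgeHamiltonian D G h) ≤ α →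
          ∃ wit : List Bool,
            (wit.length : ℝ) ≤ C * ((n : ℝ) * d * Real.log (n / δ)) ∧
            Accepts (wordLength n d) verifier (verifierInput D edges h α β δ wit)) ∧
        -- in the no case every witness is rejected
        (β ≤ groundEnergy (edgeHamiltonian D G h) →
          ∀ wit : List Bool,
            ¬ Accepts (wordLength n d) verifier (verifierInput D edges h α β δ wit)) := by
  -- The first summand serves the running time; the 72 serves the length $2ndK$ of the witness,
  -- where $K \le 36\ln(n/\delta)$.
  refine ⟨Verifier.program, Verifier.program.coeff * 280 ^ 2 * 440 + 72, 3, ?_⟩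
  intro n d D G _ edges h α β δ hn hd hD hG hE hh hδ hδ1 hβ
  have hDn : D < n := by
    have h1 := G.degree_lt_card_verts ⟨0, hn⟩
    rwa [hG, Fintype.card_fin] at h1
  obtain ⟨K, hK0, hK, hK', hKδ, hQ⟩ := exists_precision hδ hδ1 (b := 4096 * d ^ 4)
    (by have := pow_pos hd 4; omega)
  have hlog : 0 ≤ Real.log (1 / δ) := Real.log_nonneg (by rw [le_div_iff₀ hδ]; linarith)
  have hlog' : 0 ≤ Real.log (n / δ) := Real.log_nonneg <| by
    rw [le_div_iff₀ hδ, one_mul]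
    exact hδ1.trans (by exact_mod_cast hn)
  have hrun (wit : List Bool) := Verifier.exists_run (K := K)
    (Verifier.reads (D := D) (edges := edges) (h := h) (α := α) (β := β) (δ := δ) (wit := wit) hn)
    hd hD hDn (Verifier.vertex_lt hn) hδ hδ1 hK0 (by exact_mod_cast hK)
    (fun k hk => by exact_mod_cast hK' k hk) hQ
  have hKδ' : 4096 * (d : ℝ) ^ 4 ≤ 2 ^ K * δ := by exact_mod_cast hKδ
  have hcoef : (0 : ℝ) ≤ Verifier.program.coeff := Nat.cast_nonneg _
  refine ⟨fun wit => ?_, fun hα => ?_, fun hβ wit => ?_⟩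
  · obtain ⟨m, t, hm, -, ht⟩ := hrun wit
    refine ⟨m, t, hm, ht.trans ?_⟩
    gcongr ?_ * _ * _
    exact le_add_of_nonneg_right (by norm_num)
  · rcases lt_or_ge d n with hdn | hdn
    · obtain ⟨u, hu, huE⟩ := Verifier.exists_productEnergy_le_sub hn hd hD hG hh hδ hβ hα
      obtain ⟨wit, hlen, hgood⟩ := Verifier.exists_good (α := α) hn hd hD hG hE hh hδ hδ1 hKδ'
        hu huE
      obtain ⟨m, t, hm, hacc, -⟩ := hrun wit
      refine ⟨wit, ?_, m, t, hm, hacc.2 (Or.inl ⟨hdn, hgood⟩)⟩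
      have hKle := Verifier.precision_le hdn hd hδ hδ1 hQ
      rw [hlen]
      push_cast
      calc 2 * ((n : ℝ) * d) * K ≤ 2 * ((n : ℝ) * d) * (36 * Real.log (n / δ)) := by gcongr
        _ = 72 * ((n : ℝ) * d * Real.log (n / δ)) := by ring
        _ ≤ _ := by
          gcongr
          exact le_add_of_nonneg_left (by positivity)
    -- No witness is needed: the gap of at least 12 and $\alpha \ge -1$ put `β` above 2, whereas in
    -- the no case it is at most 1.
    · obtain ⟨m, t, hm, hacc, -⟩ := hrun []
      refine ⟨[], by simpa using by positivity, m, t, hm, hacc.2 (Or.inr ⟨hdn, ?_⟩)⟩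
      have h1 := Real.one_le_rpow (Verifier.one_le_sq_mul_log_div (hDn.trans_le hdn) hD)
        (by norm_num : (0 : ℝ) ≤ 1 / 3)
      have h2 := (abs_le.1 (abs_groundEnergy_le hn hd hD hG hh)).1
      exact Verifier.eight_lt_fixedPoint (r := β) (by linarith)
  · rintro ⟨m', t', hm', hm1⟩
    obtain ⟨m, t, hm, hacc, -⟩ := hrun wit
    -- Determinism identifies the hypothetical accepting run with the analysed one.
    obtain ⟨rfl, -⟩ := hm.det hm'
    rcases hacc.1 hm1 with ⟨-, hgood⟩ | ⟨-, h8⟩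
    · exact Verifier.not_good hn hd hD hG hE hh hδ hδ1 hKδ' hβ rfl hgood
    · exact absurd h8 (not_lt.2 (Verifier.fixedPoint_le_eight (r := β)
        (hβ.trans (abs_le.1 (abs_groundEnergy_le hn hd hD hG hh)).2)))
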